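/- **Setting.** Let $(E,d)$ be a Polish space with its Borel $\sigma$-field and a probability measure $\mu$, and let $q:E\times E\to[0,\infty)$ be measurable with $q(x,x)=0$ and $$\lambda:=\sup_{x\in E}\int_E (1\wedge d(x,y)^2)\,q(x,y)\,\mu(dy)<\infty .$$ Put $\Gamma(f)(x)=\int_E (f(x)-f(y))^2q(x,y)\,\mu(dy)$, let $\mathscr A$ be the set of bounded measurable $f$ with $\Gamma(f)$ bounded, and assume that $\mathscr A$ is dense in $L^2(\mu)$. Fix $o\in E$, let $\rho(x)=d(o,x)$, let $V:E\to\mathbb R$ be measurable, bounded on $\{\rho\le R\}$ for every $R>0$, with $\mu(e^V)=1$, and let $\mu_V(dx)=e^{V(x)}\mu(dx)$. Let $(\mathscr E,\mathscr D(\mathscr E))$ and $(\mathscr E_V,\mathscr D(\mathscr E_V))$ be the closures in $L^2(\mu)$ and $L^2(\mu_V)$ of the forms given on $\mathscr A$ by $\mathscr E(f)=\mu(\Gamma(f))$ and $\mathscr E_V(f)=\mu_V(\Gamma(f))$. Assume the super Poincaré inequality $$\text{(sp)}\qquad \mu(f^2)\le r\,\mathscr E(f)+\beta(r)\,\mu(|f|)^2,\qquad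 r>0,\ f\in\mathscr D(\mathscr E),$$ for a decreasing function $\beta:(0,\infty)\to(0,\infty)$. Let $\beta^{-1}(s)=\inf\{r>0:\beta(r)\le s\}$, with $\inf\emptyset=\infty$, $1/0=\infty$ and $\beta^{-1}(\infty)=0$. **Quantities.** For $n,k\ge1$, $i\ge 1$ and $\delta>1$ let $$K_{n,k}=\sup_{\rho\le n+2}V-\inf_{\rho\le n+k+2}V,\qquad J_{n,k}=\sup_{\rho\le n+1}V-2\inf_{\rho\le n+k+2}V,\qquad Z_n=\sup_{\rho\le n+1}V,$$ $$\varepsilon_{n,k}=\sup_{m\ge n}\beta^{-1}\Big(\tfrac1{2\mu(\rho>m-1)}\Big)e^{K_{m,k}},\qquad \zeta_n=\sup_{m\ge n}\beta^{-1}\Big(\tfrac1{2\mu(\rho>m-1)}\Big)e^{Z_{m+1}},\qquad t_{i,n,k}=\beta^{-1}\big(\tfrac14\delta^ie^{-J_{n,k}}\big),$$ $$\gamma_{n,k}=\iint_{\{d(x,y)>k,\ \rho(y)\ge n-1\}}q(x,y)\,\mu(dy)\mu(dx),\qquad \eta_{n,k}=\iint_{\{\rho(x)>n+k+2,\ \rho(y)\le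 n+1\}}q(x,y)\,\mu(dy)\mu(dx),$$ with values in $[0,\infty]$ for $\varepsilon,\zeta,t,\gamma,\eta$, and $0\cdot\infty=0$. For a sequence $(n_i,k_i)_{i\ge1}$ of pairs of positive integers with $n_i\uparrow\infty$ consider - (A1) $\lim_{i\to\infty}\big(\varepsilon_{n_i,k_i}+t_{i,n_i,k_i}e^{K_{n_i,k_i}}\big)=0$; - (A1′) $\limsup_{i\to\infty}\big(\varepsilon_{n_i,k_i}+t_{i,n_i,k_i}\big)<\infty$; - (A2) $\sum_{i\ge1}\big\{\zeta_{n_i}\gamma_{n_i,k_i}+t_{i,n_i,k_i}e^{Z_{n_i}}\eta_{n_i,k_i}\big\}<\infty$; - (A2$_\delta$) $\sum_{i\ge1}\big\{\zeta_{n_i}\gamma_{n_i,k_i}+t_{i,n_i,k_i}e^{Z_{n_i}}\eta_{n_i,k_i}\big\}\,\delta^i<\infty$. Let $I_\delta$ be the set of all such sequences with (A1) and (A2$_\delta$). For $r>0$ and $(n_i,k_i)\in I_\delta$ let $D(r,(n_i,k_i))$ be the set of integers $j\ge1$ with $$\sup_{i\ge j}\big(8\varepsilon_{n_i,k_i}+t_{i,n_i,k_i}e^{K_{n_i,k_i}}\big)\le\frac1{64\lambda}\wedge\frac{c(\delta)r}{16},\qquad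 c(\delta)=\Big(\frac{\sqrt\delta-1}{\delta}\Big)^2,$$ $$\sum_{i\ge j}\big(6\zeta_{n_i}\gamma_{n_i,k_i}+t_{i,n_i,k_i}e^{Z_{n_i}}\eta_{n_i,k_i}\big)\delta^{i+2}\le\frac1{256}.$$ **Theorem.** Assume (sp). 1. If $\delta>1$ and $I_\delta\neq\emptyset$, then for every $r>0$ $$\beta_V(r):=\inf\big\{2\delta^j:\ (n_i,k_i)\in I_\delta,\ j\in D(r,(n_i,k_i))\big\}<\infty ,$$ and the super Poincaré inequality $$\mu_V(f^2)\le r\,\mathscr E_V(f)+\beta_V(r)\,\mu_V(|f|)^2,\qquad r>0,\ f\in\mathscr D(\mathscr E_V),$$ holds. 2. If for some $\delta>1$ there is a sequence of pairs of positive integers $(n_i,k_i)_{i\ge1}$ with $n_i\uparrow\infty$ that satisfies (A1′) and (A2), then there are constants $C_1,C_2>0$ such that the defective Poincaré inequality $$\mu_V(f^2)\le C_1\mathscr E_V(f)+C_2\,\mu_V(|f|)^2,\qquad f\in\mathscr D(\mathscr E_V),$$ holds. -/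

import Mathlib

open MeasureTheory Filter Topology
open scoped ENNReal

namespace LevyForm

section Form

variable {E : Type*} [MeasurableSpace E]

/-- `λ = sup_x ∫ (1 ∧ d(x,y)²) q(x,y) μ(dy)`. -/
noncomputable def jumpBound [MetricSpace E] (μ : Measure E) (q : E → E → ℝ) : ℝ≥0∞ :=
  ⨆ x, ∫⁻ y, ENNReal.ofReal (min 1 (dist x y ^ 2) * q x y) ∂μ

/-- `Γ(f)(x) = ∫ (f(x) - f(y))² q(x,y) μ(dy)`. -/
noncomputable def carre (μ : Measure E) (q : E → E → ℝ) (f : E → ℝ) (x : E) : ℝ≥0∞ :=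
  ∫⁻ y, ENNReal.ofReal ((f x - f y) ^ 2 * q x y) ∂μ

/-- The class `𝒜` of bounded measurable functions `f` with `Γ(f)` bounded. -/
def core (μ : Measure E) (q : E → E → ℝ) : Set (E → ℝ) :=
  {f | Measurable f ∧ (∃ C : ℝ, ∀ x, |f x| ≤ C) ∧ ∃ C : ℝ, ∀ x, carre μ q f x ≤ ENNReal.ofReal C}

/-- `∬ (f(x) - f(y))² q(x,y) μ(dy) ν(dx)`. The choice `ν = μ` gives `ℰ(f)`, and
`ν = μ_V` gives `ℰ_V(f)`. -/
noncomputable def energy (μ : Measure E) (q : E → E → ℝ) (ν : Measure E) (f : E → ℝ) : ℝ≥0∞ :=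
  ∫⁻ x, carre μ q f x ∂ν

/-- `u` is a sequence in `𝒜` that converges to `f` in `L²(ν)` and is Cauchy for the energy. -/
def IsApprox (μ : Measure E) (q : E → E → ℝ) (ν : Measure E) (u : ℕ → E → ℝ) (f : E → ℝ) : Prop :=
  (∀ n, u n ∈ core μ q) ∧
  Tendsto (fun n => eLpNorm (u n - f) 2 ν) atTop (𝓝 0) ∧
  Tendsto (fun p : ℕ × ℕ => energy μ q ν (u p.1 - u p.2)) atTop (𝓝 0)

/-- The domain of the closure in `L²(ν)` of the form `(energy μ q ν, 𝒜)`. On this domain the closed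
form is again given by `energy μ q ν`: see `tendsto_energy`. -/
def formDomain (μ : Measure E) (q : E → E → ℝ) (ν : Measure E) : Set (E → ℝ) :=
  {f | MemLp f 2 ν ∧ ∃ u, IsApprox μ q ν u f}

/-- `μ_V(dx) = e^{V(x)} μ(dx)`. -/
noncomputable def perturbed (μ : Measure E) (V : E → ℝ) : Measure E :=
  μ.withDensity fun x => ENNReal.ofReal (Real.exp (V x))

theorem energy_eq_eLpNorm {μ ν : Measure E} [SFinite μ] [SFinite ν] (hac : μ ≪ ν)
    {q : E → E → ℝ} (hq : Measurable (Function.uncurry q)) (hq0 : ∀ x y, 0 ≤ q x y)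
    {f : E → ℝ} (hf : AEStronglyMeasurable f ν) :
    AEStronglyMeasurable (fun p : E × E => f p.1 - f p.2) (ν.prod μ) ∧
    energy μ q ν f ^ (1 / 2 : ℝ) = eLpNorm (fun p : E × E => f p.1 - f p.2) 2
      ((ν.prod μ).withDensity fun p => ENNReal.ofReal (q p.1 p.2)) := by
  have hG : AEStronglyMeasurable (fun p : E × E => f p.1 - f p.2) (ν.prod μ) :=
    (hf.comp_fst).sub ((hf.mono_ac hac).comp_snd)
  have hqm : Measurable fun p : E × E => ENNReal.ofReal (q p.1 p.2) := hq.ennreal_ofReal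
  refine ⟨hG, ?_⟩
  rw [eLpNorm_eq_lintegral_rpow_enorm_toReal (by norm_num) (by norm_num),
    lintegral_withDensity_eq_lintegral_mul₀ hqm.aemeasurable (by fun_prop),
    lintegral_prod _ (by fun_prop)]
  simp only [ENNReal.toReal_ofNat]
  congr 1
  refine lintegral_congr fun x => lintegral_congr fun y => ?_
  simp only [Pi.mul_apply]
  rw [mul_comm, ENNReal.ofReal_mul (hq0 x y), Real.enorm_eq_ofReal_abs,
    ENNReal.ofReal_rpow_of_nonneg (abs_nonneg _) (by norm_num)]
  norm_num

/-- The energies of an approximating sequence converge to the energy of its limit. In particular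
the form is closable, and `energy` on `formDomain` is its closure. -/
theorem tendsto_energy {μ ν : Measure E} [SFinite μ] [SFinite ν] (hac : μ ≪ ν)
    {q : E → E → ℝ} (hq : Measurable (Function.uncurry q)) (hq0 : ∀ x y, 0 ≤ q x y)
    {u : ℕ → E → ℝ} {f : E → ℝ} (hf : MemLp f 2 ν) (hu : IsApprox μ q ν u f) :
    Tendsto (fun n => energy μ q ν (u n - f)) atTop (𝓝 0) ∧
    Tendsto (fun n => energy μ q ν (u n)) atTop (𝓝 (energy μ q ν f)) := by
  obtain ⟨huA, huL, huC⟩ := hu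
  have hum : ∀ n, AEStronglyMeasurable (u n) ν := fun n => (huA n).1.aestronglyMeasurable
  have hfm := hf.1
  set π := (ν.prod μ).withDensity fun p : E × E => ENNReal.ofReal (q p.1 p.2) with hπ
  have hπac : π ≪ ν.prod μ := withDensity_absolutelyContinuous _ _
  set G : (E → ℝ) → E × E → ℝ := fun w p => w p.1 - w p.2 with hG
  have key : ∀ w, AEStronglyMeasurable w ν →
      AEStronglyMeasurable (G w) π ∧ energy μ q ν w ^ (1 / 2 : ℝ) = eLpNorm (G w) 2 π :=
    fun w hw => ⟨(energy_eq_eLpNorm hac hq hq0 hw).1.mono_ac hπac,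
      (energy_eq_eLpNorm hac hq hq0 hw).2⟩
  have sq : ∀ a : ℝ≥0∞, (a ^ (1 / 2 : ℝ)) ^ (2 : ℝ) = a := fun a => by
    rw [← ENNReal.rpow_mul]; norm_num
  obtain ⟨ns, hns, hae⟩ := (tendstoInMeasure_of_tendsto_eLpNorm (by norm_num) hum hfm
    huL).exists_seq_tendsto_ae
  have hGae : ∀ᵐ p ∂π, Tendsto (fun k => G (u (ns k)) p) atTop (𝓝 (G f p)) := by
    apply hπac.ae_le
    filter_upwards [Measure.quasiMeasurePreserving_fst.ae hae,
      Measure.quasiMeasurePreserving_snd.ae (hac.ae_le hae)] with p h1 h2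
    exact h1.sub h2
  have hC : Tendsto (fun p : ℕ × ℕ => eLpNorm (G (u p.1 - u p.2)) 2 π) atTop (𝓝 0) := by
    have := (ENNReal.continuous_rpow_const (y := (1 / 2 : ℝ))).tendsto 0 |>.comp huC
    rw [ENNReal.zero_rpow_of_pos (by norm_num)] at this
    refine this.congr fun p => ?_
    exact (key _ ((hum _).sub (hum _))).2
  have hlim : Tendsto (fun n => eLpNorm (G (u n - f)) 2 π) atTop (𝓝 0) := by
    rw [ENNReal.tendsto_nhds_zero] at hC ⊢
    intro ε hε
    obtain ⟨⟨a, b⟩, hab⟩ := eventually_atTop.1 (hC ε hε)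
    refine eventually_atTop.2 ⟨a, fun n hn => ?_⟩
    refine (Lp.eLpNorm_lim_le_liminf_eLpNorm (f := fun k => G (u n - u (ns k)))
      (fun k => (key _ ((hum _).sub (hum _))).1) _ ?_).trans ?_
    · filter_upwards [hGae] with p hp
      have : ∀ k, G (u n - u (ns k)) p = G (u n) p - G (u (ns k)) p := fun k => by
        simp only [hG, Pi.sub_apply]; ring
      simp only [this]
      have h2 : G (u n - f) p = G (u n) p - G f p := by
        simp only [hG, Pi.sub_apply]; ring
      rw [h2]
      exact tendsto_const_nhds.sub hp
    · refine liminf_le_of_frequently_le' (Eventually.frequently ?_)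
      filter_upwards [hns.tendsto_atTop.eventually_ge_atTop b] with k hk
      exact hab (n, ns k) ⟨hn, hk⟩
  have hnorm : Tendsto (fun n => eLpNorm (G (u n)) 2 π) atTop (𝓝 (eLpNorm (G f) 2 π)) := by
    have e1 : ∀ n, eLpNorm (G (u n)) 2 π ≤ eLpNorm (G f) 2 π + eLpNorm (G (u n - f)) 2 π := by
      intro n
      have : G (u n) = G f + G (u n - f) := by
        funext p; simp only [hG, Pi.sub_apply, Pi.add_apply]; ring
      conv_lhs => rw [this]
      exact eLpNorm_add_le (key _ hfm).1 (key _ ((hum n).sub hfm)).1 (by norm_num)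
    have e2 : ∀ n, eLpNorm (G f) 2 π - eLpNorm (G (u n - f)) 2 π ≤ eLpNorm (G (u n)) 2 π := by
      intro n
      have : G f = G (u n) - G (u n - f) := by
        funext p; simp only [hG, Pi.sub_apply]; ring
      rw [tsub_le_iff_right]
      conv_lhs => rw [this]
      exact eLpNorm_sub_le (key _ (hum n)).1 (key _ ((hum n).sub hfm)).1 (by norm_num)
    refine tendsto_of_tendsto_of_tendsto_of_le_of_le ?_ ?_ e2 e1
    · simpa using ENNReal.Tendsto.sub tendsto_const_nhds hlim (Or.inr (by simp))
    · simpa using tendsto_const_nhds.add hlim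
  have c2 := ENNReal.continuous_rpow_const (y := (2 : ℝ))
  constructor
  · have := (c2.tendsto 0).comp hlim
    rw [ENNReal.zero_rpow_of_pos (by norm_num)] at this
    refine this.congr fun n => ?_
    simp only [Function.comp, ← (key _ ((hum n).sub hfm)).2, sq]
  · have := (c2.tendsto _).comp hnorm
    rw [← (key _ hfm).2, sq] at this
    refine this.congr fun n => ?_
    simp only [Function.comp, ← (key _ (hum n)).2, sq]

/-- `ν(f²) ≤ a ℰ(f) + b ν(|f|)²`, where `ℰ` is the energy with respect to `ν`. -/
def PoincareBound (μ : Measure E) (q : E → E → ℝ) (ν : Measure E) (a b : ℝ≥0∞) (f : E → ℝ) : Prop :=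
  ∫⁻ x, ENNReal.ofReal (f x ^ 2) ∂ν
    ≤ a * energy μ q ν f + b * (∫⁻ x, ENNReal.ofReal |f x| ∂ν) ^ 2

/-- The super Poincaré inequality with rate function `β`:
`ν(f²) ≤ r ℰ(f) + β(r) ν(|f|)²` for all `r > 0` and all `f` in the domain of the closed form. -/
def SuperPoincare (μ : Measure E) (q : E → E → ℝ) (ν : Measure E) (β : ℝ → ℝ≥0∞) : Prop :=
  ∀ r : ℝ, 0 < r → ∀ f ∈ formDomain μ q ν, PoincareBound μ q ν (ENNReal.ofReal r) (β r) f

/-- The defective Poincaré inequality: `ν(f²) ≤ C₁ ℰ(f) + C₂ ν(|f|)²` for all `f` in the domain of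
the closed form, with some constants `C₁, C₂ > 0`. -/
def DefectivePoincare (μ : Measure E) (q : E → E → ℝ) (ν : Measure E) : Prop :=
  ∃ C₁ C₂ : ℝ, 0 < C₁ ∧ 0 < C₂ ∧ ∀ f ∈ formDomain μ q ν,
    PoincareBound μ q ν (ENNReal.ofReal C₁) (ENNReal.ofReal C₂) f

end Form

section Growth

/-- `β⁻¹(s) = inf {r > 0 : β(r) ≤ s}`, with `inf ∅ = ∞`; thus `β⁻¹(∞) = 0`. -/
noncomputable def betaInv (β : ℝ → ℝ) (s : ℝ≥0∞) : ℝ≥0∞ :=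
  ⨅ (r : ℝ) (_ : 0 < r) (_ : ENNReal.ofReal (β r) ≤ s), ENNReal.ofReal r

variable {E : Type*} [MetricSpace E]

/-- `sup_{ρ(x) ≤ R} V(x)`, where `ρ(x) = d(o,x)`. -/
noncomputable def supBall (o : E) (V : E → ℝ) (R : ℝ) : ℝ := sSup (V '' {x | dist o x ≤ R})

/-- `inf_{ρ(x) ≤ R} V(x)`. -/
noncomputable def infBall (o : E) (V : E → ℝ) (R : ℝ) : ℝ := sInf (V '' {x | dist o x ≤ R})

/-- `K_{n,k}(V)`. -/
noncomputable def Kval (o : E) (V : E → ℝ) (n k : ℕ) : ℝ :=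
  supBall o V (n + 2) - infBall o V (n + k + 2)

/-- `J_{n,k}(V)`. -/
noncomputable def Jval (o : E) (V : E → ℝ) (n k : ℕ) : ℝ :=
  supBall o V (n + 1) - 2 * infBall o V (n + k + 2)

/-- `Z_n(V)`. -/
noncomputable def Zval (o : E) (V : E → ℝ) (n : ℕ) : ℝ := supBall o V (n + 1)

/-- `t_{i,n,k}(δ,V) = β⁻¹(δ^i e^{-J_{n,k}(V)} / 4)`. -/
noncomputable def tval (β : ℝ → ℝ) (o : E) (V : E → ℝ) (δ : ℝ) (i n k : ℕ) : ℝ≥0∞ :=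
  betaInv β (ENNReal.ofReal (1 / 4 * δ ^ i * Real.exp (-Jval o V n k)))

variable [MeasurableSpace E]

/-- `β⁻¹(1 / [2 μ(ρ > m - 1)])`. -/
noncomputable def tailInv (μ : Measure E) (β : ℝ → ℝ) (o : E) (m : ℕ) : ℝ≥0∞ :=
  betaInv β (1 / (2 * μ {x | (m : ℝ) - 1 < dist o x}))

/-- `ε_{n,k}(V)`. -/
noncomputable def epsval (μ : Measure E) (β : ℝ → ℝ) (o : E) (V : E → ℝ) (n k : ℕ) : ℝ≥0∞ :=
  ⨆ (m : ℕ) (_ : n ≤ m), tailInv μ β o m * ENNReal.ofReal (Real.exp (Kval o V m k))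

/-- `ζ_n(V)`. -/
noncomputable def zetaval (μ : Measure E) (β : ℝ → ℝ) (o : E) (V : E → ℝ) (n : ℕ) : ℝ≥0∞ :=
  ⨆ (m : ℕ) (_ : n ≤ m), tailInv μ β o m * ENNReal.ofReal (Real.exp (Zval o V (m + 1)))

/-- `γ_{n,k} = ∬_{d(x,y) > k, ρ(y) ≥ n-1} q(x,y) μ(dy) μ(dx)`. -/
noncomputable def gammaval (μ : Measure E) (q : E → E → ℝ) (o : E) (n k : ℕ) : ℝ≥0∞ :=
  ∫⁻ x, ∫⁻ y in {y | (k : ℝ) < dist x y ∧ (n : ℝ) - 1 ≤ dist o y}, ENNReal.ofReal (q x y) ∂μ ∂μ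

/-- `η_{n,k} = ∬_{ρ(x) > n+k+2, ρ(y) ≤ n+1} q(x,y) μ(dy) μ(dx)`. -/
noncomputable def etaval (μ : Measure E) (q : E → E → ℝ) (o : E) (n k : ℕ) : ℝ≥0∞ :=
  ∫⁻ x in {x | (n : ℝ) + k + 2 < dist o x},
    ∫⁻ y in {y | dist o y ≤ (n : ℝ) + 1}, ENNReal.ofReal (q x y) ∂μ ∂μ

/-- `(n_i, k_i)_{i ≥ 1}` are pairs of positive integers with `n_i ↑ ∞`. The values at `i = 0` play
no role. -/
structure IsIndexSeq (n k : ℕ → ℕ) : Prop where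
  pos : ∀ i, 1 ≤ i → 1 ≤ n i ∧ 1 ≤ k i
  mono : ∀ i j, 1 ≤ i → i ≤ j → n i ≤ n j
  tendsto : Tendsto n atTop atTop

variable (μ : Measure E) (q : E → E → ℝ) (β : ℝ → ℝ) (o : E) (V : E → ℝ) (δ : ℝ) (n k : ℕ → ℕ)

/-- `t_{i,n_i,k_i}(δ,V) e^{K_{n_i,k_i}(V)}`. -/
noncomputable def tK (i : ℕ) : ℝ≥0∞ :=
  tval β o V δ i (n i) (k i) * ENNReal.ofReal (Real.exp (Kval o V (n i) (k i)))

/-- `ζ_{n_i}(V) γ_{n_i,k_i}`. -/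
noncomputable def zetaGamma (i : ℕ) : ℝ≥0∞ :=
  zetaval μ β o V (n i) * gammaval μ q o (n i) (k i)

/-- `t_{i,n_i,k_i}(δ,V) e^{Z_{n_i}(V)} η_{n_i,k_i}`. -/
noncomputable def tZeta (i : ℕ) : ℝ≥0∞ :=
  tval β o V δ i (n i) (k i) * ENNReal.ofReal (Real.exp (Zval o V (n i))) *
    etaval μ q o (n i) (k i)

/-- (A1): `ε_{n_i,k_i}(V) + t_{i,n_i,k_i}(δ,V) e^{K_{n_i,k_i}(V)} → 0`. -/
def CondA1 : Prop :=
  Tendsto (fun i => epsval μ β o V (n i) (k i) + tK β o V δ n k i) atTop (𝓝 0)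

/-- (A1'): `limsup_i (ε_{n_i,k_i}(V) + t_{i,n_i,k_i}(δ,V)) < ∞`. -/
def CondA1' : Prop :=
  limsup (fun i => epsval μ β o V (n i) (k i) + tval β o V δ i (n i) (k i)) atTop < ⊤

/-- The unweighted summability condition `∑_{i ≥ 1} {ζγ + t e^Z η} < ∞`. -/
def CondA2 : Prop :=
  ∑' i : ℕ, (zetaGamma μ q β o V n k (1 + i) + tZeta μ q β o V δ n k (1 + i)) < ⊤

/-- The weighted summability condition `∑_{i ≥ 1} {ζγ + t e^Z η} δ^i < ∞`. -/
def CondA2Weighted : Prop :=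
  ∑' i : ℕ, (zetaGamma μ q β o V n k (1 + i) + tZeta μ q β o V δ n k (1 + i)) *
    ENNReal.ofReal (δ ^ (1 + i)) < ⊤

/-- Membership of `{(n_i,k_i)}` in `I_δ`. -/
def MemI : Prop :=
  IsIndexSeq n k ∧ CondA1 μ β o V δ n k ∧ CondA2Weighted μ q β o V δ n k

/-- `c(δ) = ((√δ - 1) / δ)²`. -/
noncomputable def cdelta : ℝ := ((Real.sqrt δ - 1) / δ) ^ 2

/-- Membership of `j` in `D(r, {(n_i,k_i)})`. Here `1 / (64 λ) = ∞` if `λ = 0`. -/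
def MemD (r : ℝ) (j : ℕ) : Prop :=
  1 ≤ j ∧
  (∀ i, j ≤ i → 8 * epsval μ β o V (n i) (k i) + tK β o V δ n k i
    ≤ min (1 / (64 * jumpBound μ q)) (ENNReal.ofReal (cdelta δ * r / 16))) ∧
  ∑' i : ℕ, (6 * zetaGamma μ q β o V n k (j + i) + tZeta μ q β o V δ n k (j + i)) *
    ENNReal.ofReal (δ ^ (j + i + 2)) ≤ 1 / 256

/-- `β_V(r) = inf {2 δ^j : {(n_i,k_i)} ∈ I_δ, j ∈ D(r, {(n_i,k_i)})}`, with `inf ∅ = ∞`. -/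
noncomputable def betaV (r : ℝ) : ℝ≥0∞ :=
  ⨅ (n : ℕ → ℕ) (k : ℕ → ℕ) (_ : MemI μ q β o V δ n k) (j : ℕ)
    (_ : MemD μ q β o V δ n k r j), ENNReal.ofReal (2 * δ ^ j)

end Growth

end LevyForm

/-! Both inequalities come from one localization scheme. On functions with small support, (sp) and
Cauchy–Schwarz absorb the L¹ term and leave a genuine Poincaré inequality
(`lintegral_sq_le_of_measure_support_le`). The density e^V is nearly harmless on a ring {ρ ≈ m}, at
the price of its oscillation. So `μ_V(f²)` is split by radial cutoffs, each localized energy is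
compared with `ℰ_V`, and jumps that start far outside a ring are estimated separately, because there
the weights at the two ends cannot be compared. The cutoff gradients cost only λ in total, however
many rings are used. Inequalities are proved on `𝒜` and then carried to the closed form by
`poincareBound_of_core`.

Super Poincaré: `lintegral_sq_perturbed_le` applies this to a bounded function, with error terms ζγ
and t e^Z η multiplied by the square of its sup norm. A general f is cut at the levels √(μ_V(f²))
δ^{i/2}, and the i-th slice gets its own pair (n_i, k_i). By Chebyshev the slice lives on a set of
μ_V-measure at most δ^{-i}, which pays for its L¹ term. Its squared height is proportional to
μ_V(f²) δ^i, so (A2_δ) makes the errors summable. The slice energies add up to at most `ℰ_V(f)`.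
Summation and absorption give `poincareBound_of_memD`.

Defective Poincaré: the input is the finiteness of ε_{n,k} for a single pair. In
`lintegral_sq_ring_le` the radius that separates near from far points is chosen from the measure p
of the support of the localized slice. Jumps from beyond it have length at least 1, so they
contribute at most λ p times the squared height, and p is turned into an integral of the weight
`infWeight` over the support. For dyadic slices this support term is controlled by the slice one
level below (`sum_level_weight_le`). If V is unbounded, its oscillation on a large ball exceeds any
L, so `infWeight` is at most e^{-L} times the ring weights and every term with λ is absorbed. If V
is a.e. bounded, the densities e^V and 1 are comparable and the claim is immediate. -/

namespace LevyForm

/-! ### Slicing a function at geometric levels. -/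

section Truncation

/-- The part of `|u|` between the levels `a` and `b`. -/
noncomputable def levelCut (a b u : ℝ) : ℝ := min (max (|u| - a) 0) (b - a)

theorem levelCut_nonneg {a b : ℝ} (hab : a ≤ b) (u : ℝ) : 0 ≤ levelCut a b u :=
  le_min (le_max_right _ _) (sub_nonneg.2 hab)

theorem levelCut_le (a b u : ℝ) : levelCut a b u ≤ b - a := min_le_right _ _

theorem levelCut_mono {a b u v : ℝ} (h : |u| ≤ |v|) : levelCut a b u ≤ levelCut a b v := by
  unfold levelCut
  gcongr

theorem levelCut_le_abs {a b u : ℝ} (ha : 0 ≤ a) : levelCut a b u ≤ |u| :=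
  (min_le_left _ _).trans (max_le (by linarith) (abs_nonneg u))

theorem levelCut_of_le {a b u : ℝ} (hab : a ≤ b) (h : |u| ≤ a) : levelCut a b u = 0 := by
  rw [levelCut, max_eq_right (by linarith), min_eq_left (by linarith)]

theorem levelCut_of_ge {a b u : ℝ} (hab : a ≤ b) (h : b ≤ |u|) : levelCut a b u = b - a := by
  rw [levelCut, max_eq_left (by linarith), min_eq_right (by linarith)]

theorem levelCut_of_mem {a b u : ℝ} (h : a ≤ |u|) (h' : |u| ≤ b) : levelCut a b u = |u| - a := by
  rw [levelCut, max_eq_left (by linarith), min_eq_left (by linarith)]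

theorem measurable_levelCut (a b : ℝ) : Measurable (levelCut a b) := by
  unfold levelCut; fun_prop

theorem sum_levelCut {a : ℕ → ℝ} (ha : Monotone a) {j N : ℕ} (hN : j ≤ N) (u : ℝ) :
    ∑ i ∈ Finset.Ico j N, levelCut (a i) (a (i + 1)) u = levelCut (a j) (a N) u := by
  induction N, hN using Nat.le_induction with
  | base => simp [levelCut]
  | succ N hN ih =>
    rw [Finset.sum_Ico_succ_top hN, ih]
    have h1 := ha hN
    have h2 := ha N.le_succ
    rw [Nat.succ_eq_add_one] at h2
    rcases le_total |u| (a N) with h | h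
    · rw [levelCut_of_le h2 h, add_zero]
      unfold levelCut
      rw [min_eq_left, min_eq_left] <;> exact max_le (by linarith) (by linarith)
    · rw [levelCut_of_ge h1 h]
      unfold levelCut
      rw [max_eq_left (by linarith), max_eq_left (by linarith), ← min_add_add_left]
      congr 1 <;> ring

theorem levelCut_sub_le {a b u v : ℝ} (h : |v| ≤ |u|) :
    levelCut a b u - levelCut a b v ≤ |u - v| := by
  have h1 := abs_sub_abs_le_abs_sub u v
  unfold levelCut
  rcases min_cases (max (|v| - a) 0) (b - a) with h3 | h3 <;>
  rcases max_cases (|v| - a) 0 with h4 | h4 <;>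
  rcases min_cases (max (|u| - a) 0) (b - a) with h5 | h5 <;>
  rcases max_cases (|u| - a) 0 with h6 | h6 <;> linarith

/-- All slices are increasing functions of the modulus, so their increments share one sign and a sum
of squares is at most the square of the sum. This is why the energies of the slices do not exceed
the energy of the function. -/
theorem sum_levelCut_sub_sq_le {a : ℕ → ℝ} (ha : Monotone a) {j N : ℕ} (hN : j ≤ N) (u v : ℝ) :
    ∑ i ∈ Finset.Ico j N, (levelCut (a i) (a (i + 1)) u - levelCut (a i) (a (i + 1)) v) ^ 2
      ≤ (u - v) ^ 2 := by
  wlog h : |v| ≤ |u| generalizing u v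
  · have := this v u (le_of_not_ge h)
    rw [← neg_sub v u, neg_sq]
    convert this using 2
    ring
  refine (Finset.sum_sq_le_sq_sum_of_nonneg fun i _ => ?_).trans ?_
  · exact sub_nonneg.2 (levelCut_mono h)
  · rw [Finset.sum_sub_distrib, sum_levelCut ha hN, sum_levelCut ha hN, ← sq_abs (u - v)]
    exact pow_le_pow_left₀ (sub_nonneg.2 (levelCut_mono h)) (levelCut_sub_le h) 2

/-- Squares of slices are generally smaller than the square of their sum, but for geometric levels
the top slices dominate. Full slices satisfy (a_{i+1} - a_i)² = (s-1)/(s+1) · (a_{i+1}² - a_i²),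
which telescopes; only the last slice can be partial. -/
theorem sq_levelCut_le_sum {H s : ℝ} (hH : 0 ≤ H) (hs : 1 < s) {j N : ℕ} (hN : j ≤ N) {u : ℝ}
    (hu : |u| ≤ H * s ^ N) :
    (max (|u| - H * s ^ j) 0) ^ 2 ≤ 2 * s / (s - 1) *
      ∑ i ∈ Finset.Ico j N, levelCut (H * s ^ i) (H * s ^ (i + 1)) u ^ 2 := by
  have hmono : ∀ {i l : ℕ}, i ≤ l → H * s ^ i ≤ H * s ^ l := fun h =>
    mul_le_mul_of_nonneg_left (pow_le_pow_right₀ hs.le h) hH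
  have hs1 : 0 < s - 1 := by linarith
  induction N, hN using Nat.le_induction with
  | base => simp [max_eq_right (sub_nonpos.2 hu)]
  | succ N hN ih =>
    rw [Finset.sum_Ico_succ_top hN]
    rcases le_total |u| (H * s ^ N) with h | h
    · refine (ih h).trans ?_
      gcongr
      nlinarith [sq_nonneg (levelCut (H * s ^ N) (H * s ^ (N + 1)) u)]
    · have hfull : ∑ i ∈ Finset.Ico j N, levelCut (H * s ^ i) (H * s ^ (i + 1)) u ^ 2
          = (s - 1) / (s + 1) * ((H * s ^ N) ^ 2 - (H * s ^ j) ^ 2) := by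
        have : ∀ i ∈ Finset.Ico j N, levelCut (H * s ^ i) (H * s ^ (i + 1)) u ^ 2
            = (s - 1) / (s + 1) * (H * s ^ (i + 1)) ^ 2 - (s - 1) / (s + 1) * (H * s ^ i) ^ 2 := by
          intro i hi
          rw [levelCut_of_ge (hmono (Nat.le_add_right i 1))
            ((hmono (Nat.succ_le_of_lt (Finset.mem_Ico.1 hi).2)).trans h)]
          field_simp
          ring
        rw [Finset.sum_congr rfl this,
          Finset.sum_Ico_sub (fun i => (s - 1) / (s + 1) * (H * s ^ i) ^ 2) hN]
        ring
      rw [hfull, levelCut_of_mem h hu, max_eq_left (by linarith [hmono hN])]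
      have hb := hmono hN
      have hb0 : 0 ≤ H * s ^ j := by positivity
      generalize H * s ^ N = b at *
      generalize H * s ^ j = a at *
      obtain ⟨p, hpu⟩ : ∃ p, |u| = p + b := ⟨|u| - b, by ring⟩
      rw [hpu] at h hu ⊢
      have e : 2 * s / (s - 1) * ((s - 1) / (s + 1) * (b ^ 2 - a ^ 2) + (p + b - b) ^ 2)
          = (2 * s * (s - 1) * (b ^ 2 - a ^ 2) + 2 * s * (s + 1) * p ^ 2) / ((s - 1) * (s + 1)) := by
        field_simp
        ring
      rw [e, le_div_iff₀ (by positivity)]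
      have hp : 0 ≤ p := by linarith
      have h3 : 0 ≤ b - a := by linarith
      have h1 : (b - a) ^ 2 ≤ b ^ 2 - a ^ 2 := by nlinarith
      -- After b² - a² is lowered to (b - a)², the two sides differ by exactly this square, which is
      -- where the constant 2s/(s-1) comes from.
      have h2 : 0 ≤ ((s + 1) * p - (s - 1) * (b - a)) ^ 2 := sq_nonneg _
      have h4 : 2 * s * (s - 1) * (b - a) ^ 2 ≤ 2 * s * (s - 1) * (b ^ 2 - a ^ 2) := by
        gcongr
      nlinarith

end Truncation

/-! ### Radial cutoffs with uniformly summable increments. -/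

section Cutoff

/-- A continuous approximation of the indicator of `(j - 1, ∞)`, constant `1` for `j ≤ n₀`. -/
noncomputable def step (n₀ j : ℕ) (t : ℝ) : ℝ :=
  if j ≤ n₀ then 1 else min (max (t - j + 1) 0) 1

/-- A continuous cutoff equal to `1` on `[m, m + 1]` and vanishing off `(m - 1, m + 2)`; for
`m = n₀` the inner cutoff is absent. -/
noncomputable def ring (n₀ m : ℕ) (t : ℝ) : ℝ := step n₀ m t - step n₀ (m + 2) t

theorem measurable_step (n₀ j : ℕ) : Measurable (step n₀ j) := by
  unfold step
  split_ifs <;> fun_prop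

theorem measurable_ring (n₀ m : ℕ) : Measurable (ring n₀ m) :=
  (measurable_step _ _).sub (measurable_step _ _)

theorem step_nonneg (n₀ j : ℕ) (t : ℝ) : 0 ≤ step n₀ j t := by
  unfold step
  split_ifs
  · exact zero_le_one
  · positivity

theorem step_le_one (n₀ j : ℕ) (t : ℝ) : step n₀ j t ≤ 1 := by
  unfold step
  split_ifs
  · exact le_rfl
  · exact min_le_right _ _

theorem step_anti (n₀ : ℕ) {i j : ℕ} (h : i ≤ j) (t : ℝ) : step n₀ j t ≤ step n₀ i t := by
  by_cases hi : i ≤ n₀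
  · rw [step.eq_def n₀ i, if_pos hi]
    exact step_le_one _ _ _
  · rw [step, step, if_neg hi, if_neg (by omega)]
    gcongr

theorem step_mono (n₀ j : ℕ) {t t' : ℝ} (h : t' ≤ t) : step n₀ j t' ≤ step n₀ j t := by
  unfold step
  split_ifs
  · exact le_rfl
  · gcongr

theorem step_eq_one {n₀ j : ℕ} {t : ℝ} (h : (j : ℝ) ≤ t) : step n₀ j t = 1 := by
  unfold step
  split_ifs
  · rfl
  · rw [min_eq_right]
    exact le_max_of_le_left (by linarith)

theorem step_eq_zero {n₀ j : ℕ} {t : ℝ} (hj : n₀ < j) (h : t ≤ j - 1) : step n₀ j t = 0 := by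
  rw [step, if_neg (by omega), max_eq_right (by linarith), min_eq_left zero_le_one]

/-- The right side is the length of [t', t] ∩ [j-1, j]; written with `min` it telescopes in j. -/
theorem step_sub_le (n₀ j : ℕ) {t t' : ℝ} (h : t' ≤ t) :
    step n₀ j t - step n₀ j t' ≤
      (min t j - min t (j - 1)) - (min t' j - min t' (j - 1)) := by
  unfold step
  split_ifs
  · rcases min_cases t (j : ℝ) with h1 | h1 <;> rcases min_cases t ((j : ℝ) - 1) with h2 | h2 <;>
    rcases min_cases t' (j : ℝ) with h3 | h3 <;> rcases min_cases t' ((j : ℝ) - 1) with h4 | h4 <;>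
    linarith
  · have key : ∀ u : ℝ, min (max (u - j + 1) 0) 1 = min u j - min u (j - 1) := by
      intro u
      rcases min_cases u (j : ℝ) with h1 | h1 <;> rcases min_cases u ((j : ℝ) - 1) with h2 | h2 <;>
      rcases max_cases (u - j + 1) 0 with h3 | h3 <;>
      rcases min_cases (max (u - j + 1) 0) 1 with h4 | h4 <;> linarith
    rw [key, key]

theorem sum_step_sub_le (n₀ : ℕ) {p J : ℕ} (hJ : p ≤ J) {t t' : ℝ} (h : t' ≤ t) :
    ∑ j ∈ Finset.Ico p J, (step n₀ j t - step n₀ j t') ≤ t - t' := by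
  have : ∑ j ∈ Finset.Ico p J, (step n₀ j t - step n₀ j t') ≤
      min t (J - 1) - min t' (J - 1) := by
    induction J, hJ using Nat.le_induction with
    | base => simpa using Or.inl h
    | succ J hJ ih =>
      rw [Finset.sum_Ico_succ_top hJ]
      have := step_sub_le n₀ J h
      push_cast
      rw [add_sub_cancel_right]
      linarith
  refine this.trans ?_
  rcases min_cases t ((J : ℝ) - 1) with h1 | h1 <;> rcases min_cases t' ((J : ℝ) - 1) with h2 | h2 <;>
    linarith

theorem ring_nonneg (n₀ m : ℕ) (t : ℝ) : 0 ≤ ring n₀ m t :=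
  sub_nonneg.2 (step_anti _ (by omega) _)

theorem ring_le_one (n₀ m : ℕ) (t : ℝ) : ring n₀ m t ≤ 1 := by
  have := step_le_one n₀ m t
  have := step_nonneg n₀ (m + 2) t
  unfold ring
  linarith

theorem ring_eq_zero_of_ge {n₀ m : ℕ} {t : ℝ} (h : (m : ℝ) + 2 ≤ t) : ring n₀ m t = 0 := by
  rw [ring, step_eq_one (by linarith), step_eq_one (by push_cast; linarith), sub_self]

theorem ring_eq_zero_of_le {n₀ m : ℕ} {t : ℝ} (hm : n₀ < m) (h : t ≤ m - 1) :
    ring n₀ m t = 0 := by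
  rw [ring, step_eq_zero hm h, step_eq_zero (by omega) (by push_cast; linarith), sub_self]

theorem ring_eq_one {n₀ m : ℕ} {t : ℝ} (hm : n₀ ≤ m) (h : m ≤ n₀ ∨ (m : ℝ) ≤ t)
    (h' : t ≤ m + 1) : ring n₀ m t = 1 := by
  rw [ring, step_eq_zero (j := m + 2) (by omega) (by push_cast; linarith), sub_zero]
  rcases h with h | h
  · rw [step, if_pos h]
  · exact step_eq_one h

/-- The cutoffs lie in [0,1], so squares can be replaced by first powers, whose sum telescopes to at
most two steps. -/
theorem sum_ring_sq_le (n₀ : ℕ) {n M : ℕ} (hM : n ≤ M) (t : ℝ) :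
    ∑ m ∈ Finset.Ico n M, ring n₀ m t ^ 2 ≤ 2 := by
  have h1 : ∑ m ∈ Finset.Ico n M, ring n₀ m t =
      step n₀ n t + step n₀ (n + 1) t - step n₀ M t - step n₀ (M + 1) t := by
    induction M, hM using Nat.le_induction with
    | base => simp
    | succ M hM ih =>
      rw [Finset.sum_Ico_succ_top hM, ih, ring]
      ring
  calc ∑ m ∈ Finset.Ico n M, ring n₀ m t ^ 2
      ≤ ∑ m ∈ Finset.Ico n M, ring n₀ m t := by
        refine Finset.sum_le_sum fun m _ => ?_
        nlinarith [ring_nonneg n₀ m t, ring_le_one n₀ m t]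
    _ ≤ 2 := by
        rw [h1]
        linarith [step_le_one n₀ n t, step_le_one n₀ (n + 1) t, step_nonneg n₀ M t,
          step_nonneg n₀ (M + 1) t]

theorem sum_step_sub_sq_le (n₀ : ℕ) {n M : ℕ} (hM : n ≤ M) {t t' : ℝ} (h : t' ≤ t) :
    ∑ m ∈ Finset.Ico n M, (step n₀ m t - step n₀ m t') ^ 2 ≤ (t - t') ^ 2 := by
  have h0 : ∀ m, 0 ≤ step n₀ m t - step n₀ m t' := fun m => sub_nonneg.2 (step_mono _ _ h)
  refine (Finset.sum_sq_le_sq_sum_of_nonneg fun m _ => h0 m).trans ?_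
  exact pow_le_pow_left₀ (Finset.sum_nonneg fun m _ => h0 m) (sum_step_sub_le n₀ hM h) 2

/-- The bound does not depend on the number of rings, and its form 1 ∧ |t - t'|² is the one that
integrates against q to λ. The two steps of a ring increase together, so the square of the
difference of their increments is at most the sum of the squares. -/
theorem sum_ring_sub_sq_le (n₀ : ℕ) {n M : ℕ} (hM : n ≤ M) (t t' : ℝ) :
    ∑ m ∈ Finset.Ico n M, (ring n₀ m t - ring n₀ m t') ^ 2 ≤ 4 * min 1 ((t - t') ^ 2) := by
  rw [mul_min_of_nonneg _ _ (by norm_num : (0 : ℝ) ≤ 4)]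
  refine le_min ?_ ?_
  · calc ∑ m ∈ Finset.Ico n M, (ring n₀ m t - ring n₀ m t') ^ 2
        ≤ ∑ m ∈ Finset.Ico n M, (ring n₀ m t ^ 2 + ring n₀ m t' ^ 2) := by
          refine Finset.sum_le_sum fun m _ => ?_
          nlinarith [mul_nonneg (ring_nonneg n₀ m t) (ring_nonneg n₀ m t')]
      _ ≤ 4 * 1 := by
          rw [Finset.sum_add_distrib]
          linarith [sum_ring_sq_le n₀ hM t, sum_ring_sq_le n₀ hM t']
  · wlog h : t' ≤ t generalizing t t'
    · have := this t' t (le_of_not_ge h)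
      rw [← neg_sub t' t, neg_sq]
      convert this using 2
      ring
    have h0 : ∀ m, 0 ≤ step n₀ m t - step n₀ m t' := fun m => sub_nonneg.2 (step_mono _ _ h)
    calc ∑ m ∈ Finset.Ico n M, (ring n₀ m t - ring n₀ m t') ^ 2
        ≤ ∑ m ∈ Finset.Ico n M, ((step n₀ m t - step n₀ m t') ^ 2
            + (step n₀ (m + 2) t - step n₀ (m + 2) t') ^ 2) := by
          refine Finset.sum_le_sum fun m _ => ?_
          unfold ring
          nlinarith [mul_nonneg (h0 m) (h0 (m + 2))]
      _ ≤ 4 * (t - t') ^ 2 := by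
          rw [Finset.sum_add_distrib,
            Finset.sum_Ico_add' (fun m => (step n₀ m t - step n₀ m t') ^ 2)]
          nlinarith [sum_step_sub_sq_le n₀ hM h,
            sum_step_sub_sq_le n₀ (Nat.add_le_add_right hM 2) h, sq_nonneg (t - t')]

theorem step_sub_sq_le (n₀ j : ℕ) (t t' : ℝ) :
    (step n₀ j t - step n₀ j t') ^ 2 ≤ min 1 ((t - t') ^ 2) := by
  refine le_min ?_ ?_
  · have := step_le_one n₀ j t
    have := step_nonneg n₀ j t
    have := step_le_one n₀ j t'
    have := step_nonneg n₀ j t'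
    rw [sq_le_one_iff_abs_le_one, abs_le]
    constructor <;> linarith
  · rcases le_total t' t with h | h
    · simpa using sum_step_sub_sq_le n₀ (Nat.le_succ j) h
    · rw [← neg_sub, neg_sq, ← neg_sub t' t, neg_sq]
      simpa using sum_step_sub_sq_le n₀ (Nat.le_succ j) h

/-- At each point at most three of the cutoffs are non-zero. -/
theorem card_ring_ne_zero_le (n₀ M : ℕ) {t : ℝ} (ht : 0 ≤ t) :
    ((Finset.Ico n₀ M).filter fun m => ring n₀ m t ≠ 0).card ≤ 3 := by
  -- The maximum with n₀ accounts for the innermost cutoff, which does not vanish towards the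
  -- centre.
  set l := max ⌊t⌋₊ n₀ with hl
  have hsub : ((Finset.Ico n₀ M).filter fun m => ring n₀ m t ≠ 0) ⊆ Finset.Icc (l - 1) (l + 1) := by
    intro m hm
    rw [Finset.mem_filter, Finset.mem_Ico] at hm
    obtain ⟨⟨hm1, -⟩, hm2⟩ := hm
    have h1 : t < m + 2 := by
      by_contra h
      exact hm2 (ring_eq_zero_of_ge (not_lt.1 h))
    have h2 : m ≤ n₀ ∨ (m : ℝ) - 1 < t := by
      by_contra h
      push Not at h
      exact hm2 (ring_eq_zero_of_le h.1 h.2)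
    have h3 : ⌊t⌋₊ < m + 2 := (Nat.floor_lt ht).2 (by exact_mod_cast h1)
    have h4 : m ≤ n₀ ∨ m ≤ ⌊t⌋₊ + 1 := by
      refine h2.imp id fun h => ?_
      have : (m : ℝ) < ⌊t⌋₊ + 2 := by linarith [Nat.lt_floor_add_one t]
      have : m < ⌊t⌋₊ + 2 := by exact_mod_cast this
      omega
    rw [Finset.mem_Icc]
    omega
  refine (Finset.card_le_card hsub).trans ?_
  rw [Nat.card_Icc]
  omega

end Cutoff

/-! ### Energy of products and the split into near and far points. -/

section Energy

variable {E : Type*} [MeasurableSpace E] {μ : Measure E} {q : E → E → ℝ}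

theorem measurable_carre [SFinite μ] (hq : Measurable (Function.uncurry q)) {f : E → ℝ}
    (hf : Measurable f) : Measurable (carre μ q f) := by
  have hq' : Measurable fun p : E × E => q p.1 p.2 := hq
  exact Measurable.lintegral_prod_right'
    (f := fun p : E × E => ENNReal.ofReal ((f p.1 - f p.2) ^ 2 * q p.1 p.2)) (by fun_prop)

theorem carre_mono (hq0 : ∀ x y, 0 ≤ q x y) {f g : E → ℝ} (h : ∀ x y, |f x - f y| ≤ |g x - g y|)
    (x : E) : carre μ q f x ≤ carre μ q g x := by
  refine lintegral_mono fun y => ENNReal.ofReal_le_ofReal ?_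
  exact mul_le_mul_of_nonneg_right (sq_le_sq.2 (h x y)) (hq0 x y)

/-- The part of `Γ(gφ)` in which the increment falls on `g`. -/
noncomputable def nearGrad (μ : Measure E) (q : E → E → ℝ) (φ g : E → ℝ) (x : E) : ℝ≥0∞ :=
  ∫⁻ y, ENNReal.ofReal (φ y ^ 2 * ((g x - g y) ^ 2 * q x y)) ∂μ

/-- The value of `Γ(u)` at a point where `u` vanishes. -/
noncomputable def farTerm (μ : Measure E) (q : E → E → ℝ) (u : E → ℝ) (x : E) : ℝ≥0∞ :=
  ∫⁻ y, ENNReal.ofReal (u y ^ 2 * q x y) ∂μ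

theorem measurable_nearGrad [SFinite μ] (hq : Measurable (Function.uncurry q)) {φ g : E → ℝ}
    (hφ : Measurable φ) (hg : Measurable g) : Measurable (nearGrad μ q φ g) := by
  have hq' : Measurable fun p : E × E => q p.1 p.2 := hq
  exact Measurable.lintegral_prod_right'
    (f := fun p : E × E => ENNReal.ofReal (φ p.2 ^ 2 * ((g p.1 - g p.2) ^ 2 * q p.1 p.2)))
    (by fun_prop)

/-- The increment is split as φ(y)(g(x) - g(y)) + g(x)(φ(x) - φ(y)). With this choice g is evaluated
at x in the second term, where the weight sits, and φ(y)² in the first can be summed over all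
cutoffs. -/
theorem carre_mul_le (hq : Measurable (Function.uncurry q)) (hq0 : ∀ x y, 0 ≤ q x y)
    {φ g : E → ℝ} (hφ : Measurable φ) (hg : Measurable g) (x : E) :
    carre μ q (fun z => g z * φ z) x ≤
      2 * nearGrad μ q φ g x + 2 * (ENNReal.ofReal (g x ^ 2) * carre μ q φ x) := by
  have hqx : Measurable (q x) := hq.of_uncurry_left
  unfold nearGrad carre
  rw [← lintegral_const_mul _ (by fun_prop), ← lintegral_const_mul _ (by fun_prop),
    ← lintegral_const_mul _ (by fun_prop), ← lintegral_add_left (by fun_prop)]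
  refine lintegral_mono fun y => ?_
  have h2 : (2 : ℝ≥0∞) = ENNReal.ofReal 2 := by simp
  have := hq0 x y
  rw [h2, ← ENNReal.ofReal_mul (by positivity), ← ENNReal.ofReal_mul (by positivity),
    ← ENNReal.ofReal_mul (by positivity), ← ENNReal.ofReal_add (by positivity) (by positivity)]
  apply ENNReal.ofReal_le_ofReal
  have key : (g x * φ x - g y * φ y) ^ 2 ≤
      2 * (φ y ^ 2 * (g x - g y) ^ 2) + 2 * (g x ^ 2 * (φ x - φ y) ^ 2) := by
    nlinarith [sq_nonneg (φ y * (g x - g y) - g x * (φ x - φ y))]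
  calc _ ≤ (2 * (φ y ^ 2 * (g x - g y) ^ 2) + 2 * (g x ^ 2 * (φ x - φ y) ^ 2)) * q x y := by
        gcongr
    _ = _ := by ring

theorem carre_of_eq_zero {u : E → ℝ} {x : E} (hx : u x = 0) :
    carre μ q u x = farTerm μ q u x := by
  refine lintegral_congr fun y => ?_
  rw [hx, zero_sub, neg_sq]

/-- Off A the constant is dominated by a weight, later a multiple of e^V or of a lower bound for it.
On A no such comparison is available, but φ vanishes there, so only jumps into its support remain.
-/
theorem mul_energy_mul_le [SFinite μ] (hq : Measurable (Function.uncurry q))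
    (hq0 : ∀ x y, 0 ≤ q x y) {φ g : E → ℝ} (hφ : Measurable φ) (hg : Measurable g) {A : Set E}
    (hA : MeasurableSet A) (hφA : ∀ x ∈ A, φ x = 0) {c : ℝ≥0∞} {w : E → ℝ≥0∞} (hw : Measurable w)
    (hcw : ∀ x ∉ A, c ≤ w x) :
    c * energy μ q μ (fun z => g z * φ z) ≤
      2 * ∫⁻ x, w x * nearGrad μ q φ g x ∂μ
      + 2 * ∫⁻ x, w x * (ENNReal.ofReal (g x ^ 2) * carre μ q φ x) ∂μ
      + c * ∫⁻ x in A, farTerm μ q (fun z => g z * φ z) x ∂μ := by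
  have m1 := measurable_nearGrad (μ := μ) hq hφ hg
  have m2 := measurable_carre (μ := μ) hq hφ
  have m3 := measurable_carre (μ := μ) hq (hg.mul hφ)
  have m4 : Measurable (carre μ q fun z => g z * φ z) := m3
  unfold energy
  rw [← lintegral_add_compl _ hA, mul_add, add_comm]
  gcongr ?_ + ?_
  · rw [← lintegral_const_mul _ m4, ← lintegral_const_mul _ (by fun_prop),
      ← lintegral_const_mul _ (by fun_prop), ← lintegral_add_left (by fun_prop)]
    refine (setLIntegral_mono (by fun_prop) fun x hx => ?_).trans (setLIntegral_le_lintegral Aᶜ _)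
    calc c * carre μ q (fun z => g z * φ z) x
        ≤ w x * (2 * nearGrad μ q φ g x + 2 * (ENNReal.ofReal (g x ^ 2) * carre μ q φ x)) :=
          mul_le_mul' (hcw x hx) (carre_mul_le hq hq0 hφ hg x)
      _ = _ := by ring
  · gcongr 1
    refine le_of_eq (setLIntegral_congr_fun hA fun x hx => ?_)
    exact carre_of_eq_zero (by simp [hφA x hx])

theorem core_of_le {f : E → ℝ} (hf : Measurable f) {B : ℝ} (hB : ∀ x, |f x| ≤ B) {D : ℝ≥0∞}
    (hD : D ≠ ⊤) (h : ∀ x, carre μ q f x ≤ D) : f ∈ core μ q :=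
  ⟨hf, ⟨B, hB⟩, D.toReal, fun x => by rw [ENNReal.ofReal_toReal hD]; exact h x⟩

theorem levelCut_mem_core (hq0 : ∀ x y, 0 ≤ q x y) {f : E → ℝ} (hf : f ∈ core μ q) {a b : ℝ}
    (hab : a ≤ b) : (fun x => levelCut a b (f x)) ∈ core μ q := by
  obtain ⟨hm, -, D, hD⟩ := hf
  refine core_of_le (D := ENNReal.ofReal D) ((measurable_levelCut a b).comp hm) (B := b - a)
    (fun x => ?_) ENNReal.ofReal_ne_top fun x => (carre_mono hq0 (fun x y => ?_) x).trans (hD x)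
  · rw [abs_of_nonneg (levelCut_nonneg hab _)]
    exact levelCut_le _ _ _
  · rcases le_total |f y| |f x| with h | h
    · rw [abs_of_nonneg (sub_nonneg.2 (levelCut_mono h))]
      exact levelCut_sub_le h
    · rw [abs_sub_comm, abs_of_nonneg (sub_nonneg.2 (levelCut_mono h)), abs_sub_comm (f x)]
      exact levelCut_sub_le h

theorem mul_mem_core (hq : Measurable (Function.uncurry q)) (hq0 : ∀ x y, 0 ≤ q x y)
    {f φ : E → ℝ} (hf : f ∈ core μ q) (hφ : Measurable φ) (hφ1 : ∀ x, |φ x| ≤ 1) {D : ℝ≥0∞}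
    (hD : D ≠ ⊤) (hφD : ∀ x, carre μ q φ x ≤ D) : (fun x => f x * φ x) ∈ core μ q := by
  obtain ⟨hm, ⟨B, hB⟩, C, hC⟩ := hf
  refine core_of_le (hm.mul hφ) (B := B) (fun x => ?_)
    (D := 2 * ENNReal.ofReal C + 2 * (ENNReal.ofReal (B ^ 2) * D)) (by finiteness) fun x => ?_
  · rw [abs_mul]
    have := hB x
    have := hφ1 x
    nlinarith [abs_nonneg (f x), abs_nonneg (φ x)]
  · refine (carre_mul_le hq hq0 hφ hm x).trans ?_
    have hfx : f x ^ 2 ≤ B ^ 2 := by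
      rw [← sq_abs]
      exact pow_le_pow_left₀ (abs_nonneg _) (hB x) 2
    gcongr
    · refine le_trans (lintegral_mono fun y => ENNReal.ofReal_le_ofReal ?_) (hC x)
      have h1 : φ y ^ 2 ≤ 1 := by rw [sq_le_one_iff_abs_le_one]; exact hφ1 y
      exact mul_le_of_le_one_left (mul_nonneg (sq_nonneg _) (hq0 x y)) h1
    · exact hφD x

theorem energy_lt_top {ν : Measure E} [IsFiniteMeasure ν] {f : E → ℝ} (hf : f ∈ core μ q) :
    energy μ q ν f < ⊤ := by
  obtain ⟨-, -, D, hD⟩ := hf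
  refine (lintegral_mono hD).trans_lt ?_
  rw [lintegral_const]
  finiteness

theorem lintegral_sq_lt_top {ν : Measure E} [IsFiniteMeasure ν] {f : E → ℝ} (hf : f ∈ core μ q) :
    ∫⁻ x, ENNReal.ofReal (f x ^ 2) ∂ν < ⊤ := by
  obtain ⟨-, ⟨B, hB⟩, -⟩ := hf
  refine (lintegral_mono (g := fun _ => ENNReal.ofReal (B ^ 2)) fun x => ?_).trans_lt ?_
  · rw [← sq_abs]
    exact ENNReal.ofReal_le_ofReal (pow_le_pow_left₀ (abs_nonneg _) (hB x) 2)
  · rw [lintegral_const]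
    finiteness

theorem mem_formDomain_of_mem_core {ν : Measure E} [IsFiniteMeasure ν] {f : E → ℝ}
    (hf : f ∈ core μ q) : f ∈ formDomain μ q ν := by
  refine ⟨?_, fun _ => f, fun _ => hf, ?_, ?_⟩
  · obtain ⟨hm, ⟨B, hB⟩, -⟩ := hf
    exact MemLp.of_bound hm.aestronglyMeasurable B (Eventually.of_forall hB)
  · simp
  · simp [energy, carre]

/-- The Cauchy–Schwarz inequality for a function vanishing off a set. -/
theorem sq_lintegral_abs_le {ν : Measure E} {u : E → ℝ} (hu : Measurable u) {A : Set E}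
    (hA : MeasurableSet A) (h : ∀ x ∉ A, u x = 0) :
    (∫⁻ x, ENNReal.ofReal |u x| ∂ν) ^ 2 ≤ ν A * ∫⁻ x, ENNReal.ofReal (u x ^ 2) ∂ν := by
  have hol := ENNReal.lintegral_mul_le_Lp_mul_Lq ν Real.HolderConjugate.two_two
    (f := A.indicator 1) (g := fun x => ENNReal.ofReal |u x|)
    ((measurable_one.indicator hA).aemeasurable) (by fun_prop)
  have e1 : ∫⁻ x, (A.indicator (1 : E → ℝ≥0∞) * fun x => ENNReal.ofReal |u x|) x ∂ν
      = ∫⁻ x, ENNReal.ofReal |u x| ∂ν := by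
    refine lintegral_congr fun x => ?_
    by_cases hx : x ∈ A
    · simp [hx]
    · simp [hx, h x hx]
  have e2 : ∫⁻ x, (A.indicator (1 : E → ℝ≥0∞) x) ^ (2 : ℝ) ∂ν = ν A := by
    rw [← lintegral_indicator_one hA]
    refine lintegral_congr fun x => ?_
    by_cases hx : x ∈ A <;> simp [hx]
  have e3 : ∫⁻ x, (ENNReal.ofReal |u x|) ^ (2 : ℝ) ∂ν = ∫⁻ x, ENNReal.ofReal (u x ^ 2) ∂ν := by
    refine lintegral_congr fun x => ?_
    rw [ENNReal.ofReal_rpow_of_nonneg (abs_nonneg _) (by norm_num)]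
    norm_num
  rw [e1, e2, e3] at hol
  refine (pow_le_pow_left' hol 2).trans (le_of_eq ?_)
  rw [mul_pow, ← ENNReal.rpow_natCast, ← ENNReal.rpow_natCast, ← ENNReal.rpow_mul,
    ← ENNReal.rpow_mul]
  norm_num

end Energy

/-! ### Absorption and the generalized inverse of β. -/

section BetaInv

theorem le_two_mul_of_le_add_half {X Y : ℝ≥0∞} (hX : X ≠ ⊤) (h : X ≤ Y + 2⁻¹ * X) : X ≤ 2 * Y := by
  have h4 : X + X ≤ 2 * Y + X := by
    calc X + X = 2 * X := (two_mul X).symm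
      _ ≤ 2 * (Y + 2⁻¹ * X) := by gcongr
      _ = _ := by
        rw [mul_add, ← mul_assoc 2 2⁻¹, ENNReal.mul_inv_cancel (by norm_num) (by norm_num), one_mul]
  exact ENNReal.le_of_add_le_add_right hX h4

/-- Allows the infima defining `betaInv` and `betaV` to be used although they need not be attained.
Finiteness of Y makes t ↦ tY continuous at b, also when b = 0. -/
theorem le_mul_add_of_forall_gt {b X Y c : ℝ≥0∞} (hb : b ≠ ⊤) (hY : Y ≠ ⊤)
    (h : ∀ t, b < t → X ≤ t * Y + c) : X ≤ b * Y + c := by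
  have hlim : Tendsto (fun t : ℝ≥0∞ => t * Y + c) (𝓝[>] b) (𝓝 (b * Y + c)) :=
    ((ENNReal.Tendsto.mul_const tendsto_id (Or.inr hY)).add tendsto_const_nhds).mono_left
      nhdsWithin_le_nhds
  have : (𝓝[>] b).NeBot := nhdsGT_neBot_of_exists_gt ⟨⊤, hb.lt_top⟩
  refine ge_of_tendsto hlim ?_
  filter_upwards [self_mem_nhdsWithin] with t ht using h t ht

theorem le_betaInv_mul_add {β : ℝ → ℝ} {s X Y c : ℝ≥0∞} (hs : betaInv β s ≠ ⊤) (hY : Y ≠ ⊤)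
    (h : ∀ r : ℝ, 0 < r → ENNReal.ofReal (β r) ≤ s → X ≤ ENNReal.ofReal r * Y + c) :
    X ≤ betaInv β s * Y + c := by
  refine le_mul_add_of_forall_gt hs hY fun t ht => ?_
  simp only [betaInv, iInf_lt_iff] at ht
  obtain ⟨r, hr0, hr, hrt⟩ := ht
  refine (h r hr0 hr).trans ?_
  gcongr

theorem betaInv_anti (β : ℝ → ℝ) {s t : ℝ≥0∞} (h : s ≤ t) : betaInv β t ≤ betaInv β s := by
  unfold betaInv
  gcongr with r hr
  exact iInf_mono' fun h' => ⟨h'.trans h, le_rfl⟩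

variable {E : Type*} [MeasurableSpace E] {μ : Measure E} {q : E → E → ℝ} {β : ℝ → ℝ}

/-- On functions with small support the super Poincaré inequality becomes a Poincaré inequality. -/
theorem lintegral_sq_le_of_measure_support_le [IsFiniteMeasure μ]
    (h_sp : SuperPoincare μ q μ fun r => ENNReal.ofReal (β r)) {u : E → ℝ} (hu : u ∈ core μ q)
    {p : ℝ≥0∞} (hp : μ {x | u x ≠ 0} ≤ p) (hσ : betaInv β (1 / (2 * p)) ≠ ⊤) :
    ∫⁻ x, ENNReal.ofReal (u x ^ 2) ∂μ ≤ 2 * betaInv β (1 / (2 * p)) * energy μ q μ u := by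
  have hE := energy_lt_top (ν := μ) hu
  have hX := lintegral_sq_lt_top (ν := μ) hu
  have hA : MeasurableSet {x | u x ≠ 0} := (hu.1 (measurableSet_singleton 0)).compl
  have hcs := sq_lintegral_abs_le (ν := μ) hu.1 hA fun x hx => by simpa using hx
  set X := ∫⁻ x, ENNReal.ofReal (u x ^ 2) ∂μ
  suffices X ≤ betaInv β (1 / (2 * p)) * (2 * energy μ q μ u) + 0 by
    rw [add_zero] at this
    exact this.trans_eq (by ring)
  refine le_betaInv_mul_add hσ (by finiteness) fun r hr hβr => ?_
  have h1 := h_sp r hr u (mem_formDomain_of_mem_core hu)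
  have h2 : ENNReal.ofReal (β r) * p ≤ 2⁻¹ := by
    -- Only p⁻¹ p ≤ 1 is used, so the cases p = 0 and p = ∞ need no separate treatment.
    calc ENNReal.ofReal (β r) * p ≤ 1 / (2 * p) * p := by gcongr
      _ = 2⁻¹ * (p⁻¹ * p) := by
        rw [one_div, ENNReal.mul_inv (Or.inl (by norm_num)) (Or.inl (by norm_num)), mul_assoc]
      _ ≤ 2⁻¹ * 1 := by gcongr; exact ENNReal.inv_mul_le_one p
      _ = 2⁻¹ := mul_one _
  have h3 : X ≤ ENNReal.ofReal r * energy μ q μ u + 2⁻¹ * X := by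
    refine h1.trans (add_le_add le_rfl ?_)
    calc _ ≤ ENNReal.ofReal (β r) * (p * X) := by gcongr; exact hcs.trans (by gcongr)
      _ = ENNReal.ofReal (β r) * p * X := by ring
      _ ≤ _ := by gcongr
  rw [add_zero]
  exact (le_two_mul_of_le_add_half hX.ne h3).trans_eq (by ring)

end BetaInv

/-! ### The measure μ_V and passage from 𝒜 to the closed form. -/

section Perturbed

variable {E : Type*} [MeasurableSpace E] {μ : Measure E} {q : E → E → ℝ} {V : E → ℝ}

theorem lintegral_perturbed (hV : Measurable V) {g : E → ℝ≥0∞} (hg : Measurable g) :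
    ∫⁻ x, g x ∂(perturbed μ V) = ∫⁻ x, ENNReal.ofReal (Real.exp (V x)) * g x ∂μ := by
  rw [perturbed, lintegral_withDensity_eq_lintegral_mul _ (by fun_prop) hg]
  rfl

theorem isProbabilityMeasure_perturbed
    (hV_norm : ∫⁻ x, ENNReal.ofReal (Real.exp (V x)) ∂μ = 1) :
    IsProbabilityMeasure (perturbed μ V) :=
  ⟨by rw [perturbed, withDensity_apply _ MeasurableSet.univ, Measure.restrict_univ, hV_norm]⟩

theorem absolutelyContinuous_perturbed (hV : Measurable V) : μ ≪ perturbed μ V :=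
  withDensity_absolutelyContinuous' (by fun_prop)
    (Eventually.of_forall fun x => by simp [Real.exp_pos])

theorem lintegral_sq_eq_eLpNorm {ν : Measure E} (f : E → ℝ) :
    ∫⁻ x, ENNReal.ofReal (f x ^ 2) ∂ν = eLpNorm f 2 ν ^ 2 := by
  rw [eLpNorm_eq_lintegral_rpow_enorm_toReal (by norm_num) (by norm_num), ← ENNReal.rpow_natCast,
    ← ENNReal.rpow_mul]
  norm_num
  refine lintegral_congr fun x => ?_
  rw [Real.enorm_eq_ofReal_abs, ← ENNReal.ofReal_pow (abs_nonneg _), sq_abs]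

theorem lintegral_abs_eq_eLpNorm {ν : Measure E} (f : E → ℝ) :
    ∫⁻ x, ENNReal.ofReal |f x| ∂ν = eLpNorm f 1 ν := by
  rw [eLpNorm_one_eq_lintegral_enorm]
  simp only [Real.enorm_eq_ofReal_abs]

theorem tendsto_eLpNorm_of_tendsto_sub {ν : Measure E} {p : ℝ≥0∞} (hp : 1 ≤ p) {u : ℕ → E → ℝ}
    {f : E → ℝ} (hu : ∀ n, AEStronglyMeasurable (u n) ν) (hf : AEStronglyMeasurable f ν)
    (h : Tendsto (fun n => eLpNorm (u n - f) p ν) atTop (𝓝 0)) :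
    Tendsto (fun n => eLpNorm (u n) p ν) atTop (𝓝 (eLpNorm f p ν)) := by
  have e1 : ∀ n, eLpNorm (u n) p ν ≤ eLpNorm f p ν + eLpNorm (u n - f) p ν := fun n => by
    simpa using eLpNorm_add_le hf ((hu n).sub hf) hp
  have e2 : ∀ n, eLpNorm f p ν - eLpNorm (u n - f) p ν ≤ eLpNorm (u n) p ν := fun n => by
    rw [tsub_le_iff_right]
    simpa using eLpNorm_sub_le (hu n) ((hu n).sub hf) hp
  refine tendsto_of_tendsto_of_tendsto_of_le_of_le ?_ ?_ e2 e1
  · simpa using ENNReal.Tendsto.sub tendsto_const_nhds h (Or.inr (by simp))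
  · simpa using tendsto_const_nhds.add h

/-- An inequality of Poincaré type on `𝒜` extends to the domain of the closed form. -/
theorem poincareBound_of_core [SFinite μ] {ν : Measure E} [IsProbabilityMeasure ν] (hac : μ ≪ ν)
    (hq : Measurable (Function.uncurry q)) (hq0 : ∀ x y, 0 ≤ q x y) {a b : ℝ≥0∞} (ha : a ≠ ⊤)
    (hb : b ≠ ⊤) (h : ∀ f ∈ core μ q, PoincareBound μ q ν a b f) {f : E → ℝ}
    (hf : f ∈ formDomain μ q ν) : PoincareBound μ q ν a b f := by
  obtain ⟨hf2, u, hu⟩ := hf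
  have hum : ∀ n, AEStronglyMeasurable (u n) ν := fun n => (hu.1 n).1.aestronglyMeasurable
  have l2 := tendsto_eLpNorm_of_tendsto_sub (by norm_num) hum hf2.1 hu.2.1
  -- On a probability space the L² norm dominates the L¹ norm; together with the convergence of
  -- energies, all three terms pass to the limit.
  have l1 : Tendsto (fun n => eLpNorm (u n - f) 1 ν) atTop (𝓝 0) :=
    tendsto_of_tendsto_of_tendsto_of_le_of_le tendsto_const_nhds hu.2.1 (fun _ => zero_le)
      fun n => eLpNorm_le_eLpNorm_of_exponent_le (by norm_num) ((hum n).sub hf2.1)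
  have l1' := tendsto_eLpNorm_of_tendsto_sub le_rfl hum hf2.1 l1
  have lE := (tendsto_energy hac hq hq0 hf2 hu).2
  unfold PoincareBound at h ⊢
  simp only [lintegral_sq_eq_eLpNorm, lintegral_abs_eq_eLpNorm] at h ⊢
  refine le_of_tendsto_of_tendsto' ((ENNReal.continuous_pow 2).tendsto _ |>.comp l2)
    ((ENNReal.Tendsto.const_mul lE (Or.inr ha)).add (ENNReal.Tendsto.const_mul
      ((ENNReal.continuous_pow 2).tendsto _ |>.comp l1') (Or.inr hb))) fun n => h (u n) (hu.1 n)

end Perturbed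

/-- Superadditivity of the lower integral, which requires no measurability and is the direction
needed for upper bounds. -/
theorem sum_lintegral_le_lintegral_sum {α ι : Type*} [MeasurableSpace α] {μ : Measure α}
    (s : Finset ι) (F : ι → α → ℝ≥0∞) :
    ∑ i ∈ s, ∫⁻ x, F i x ∂μ ≤ ∫⁻ x, ∑ i ∈ s, F i x ∂μ := by
  classical
  induction s using Finset.induction_on with
  | empty => simp
  | insert i s hi ih =>
    simp only [Finset.sum_insert hi]
    exact (add_le_add le_rfl ih).trans (le_lintegral_add _ _)

theorem ofReal_sq_le_of_abs_le {a B : ℝ} (h : |a| ≤ B) :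
    ENNReal.ofReal (a ^ 2) ≤ ENNReal.ofReal (B ^ 2) := by
  rw [← sq_abs]
  exact ENNReal.ofReal_le_ofReal (pow_le_pow_left₀ (abs_nonneg _) h 2)

/-! ### Extremes of V on balls. -/

section Ball

variable {E : Type*} [MetricSpace E] {o : E} {V : E → ℝ}

theorem bddAbove_ball (hV : ∀ R : ℝ, ∃ C : ℝ, ∀ x, dist o x ≤ R → |V x| ≤ C) (R : ℝ) :
    BddAbove (V '' {x | dist o x ≤ R}) := by
  obtain ⟨C, hC⟩ := hV R
  exact ⟨C, by rintro _ ⟨x, hx, rfl⟩; exact (le_abs_self _).trans (hC x hx)⟩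

theorem bddBelow_ball (hV : ∀ R : ℝ, ∃ C : ℝ, ∀ x, dist o x ≤ R → |V x| ≤ C) (R : ℝ) :
    BddBelow (V '' {x | dist o x ≤ R}) := by
  obtain ⟨C, hC⟩ := hV R
  exact ⟨-C, by rintro _ ⟨x, hx, rfl⟩; exact (abs_le.1 (hC x hx)).1⟩

theorem le_supBall (hV : ∀ R : ℝ, ∃ C : ℝ, ∀ x, dist o x ≤ R → |V x| ≤ C) {R : ℝ} {x : E}
    (hx : dist o x ≤ R) : V x ≤ supBall o V R :=
  le_csSup (bddAbove_ball hV R) ⟨x, hx, rfl⟩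

theorem infBall_le (hV : ∀ R : ℝ, ∃ C : ℝ, ∀ x, dist o x ≤ R → |V x| ≤ C) {R : ℝ} {x : E}
    (hx : dist o x ≤ R) : infBall o V R ≤ V x :=
  csInf_le (bddBelow_ball hV R) ⟨x, hx, rfl⟩

theorem supBall_mono (hV : ∀ R : ℝ, ∃ C : ℝ, ∀ x, dist o x ≤ R → |V x| ≤ C) {R R' : ℝ}
    (hR : 0 ≤ R) (h : R ≤ R') : supBall o V R ≤ supBall o V R' :=
  csSup_le_csSup (bddAbove_ball hV R') ⟨V o, o, by simpa using hR, rfl⟩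
    (Set.image_mono fun _ hx => le_trans hx h)

theorem infBall_anti (hV : ∀ R : ℝ, ∃ C : ℝ, ∀ x, dist o x ≤ R → |V x| ≤ C) {R R' : ℝ}
    (hR : 0 ≤ R) (h : R ≤ R') : infBall o V R' ≤ infBall o V R :=
  csInf_le_csInf (bddBelow_ball hV R') ⟨V o, o, by simpa using hR, rfl⟩
    (Set.image_mono fun _ hx => le_trans hx h)

end Ball

/-! ### Energy cost of the radial cutoffs. -/

section CutoffEnergy

variable {E : Type*} [MetricSpace E] [MeasurableSpace E] {μ : Measure E} {q : E → E → ℝ} {o : E}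

theorem measurable_dist_right [OpensMeasurableSpace E] : Measurable fun x : E => dist o x :=
  (continuous_const.dist continuous_id).measurable

/-- The distance ρ is 1-Lipschitz, so the increments are bounded through 1 ∧ d(x,y)². Summing over
the family before integrating keeps the cost a fixed multiple of λ. -/
theorem sum_carre_comp_dist_le (hq : Measurable (Function.uncurry q)) (hq0 : ∀ x y, 0 ≤ q x y)
    {ι : Type*} (s : Finset ι) (φ : ι → ℝ → ℝ) {κ : ℝ} (hκ : 0 ≤ κ)
    (h : ∀ t t', ∑ i ∈ s, (φ i t - φ i t') ^ 2 ≤ κ * min 1 ((t - t') ^ 2)) (x : E)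
    [OpensMeasurableSpace E] :
    ∑ i ∈ s, carre μ q (fun z => φ i (dist o z)) x ≤ ENNReal.ofReal κ * jumpBound μ q := by
  have hqx : Measurable (q x) := hq.of_uncurry_left
  have hd : Measurable fun y : E => dist x y := measurable_dist_right
  calc ∑ i ∈ s, carre μ q (fun z => φ i (dist o z)) x
      ≤ ∫⁻ y, ∑ i ∈ s, ENNReal.ofReal ((φ i (dist o x) - φ i (dist o y)) ^ 2 * q x y) ∂μ :=
        sum_lintegral_le_lintegral_sum _ _
    _ ≤ ∫⁻ y, ENNReal.ofReal κ * ENNReal.ofReal (min 1 (dist x y ^ 2) * q x y) ∂μ := by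
        refine lintegral_mono fun y => ?_
        rw [← ENNReal.ofReal_sum_of_nonneg fun i _ => mul_nonneg (sq_nonneg _) (hq0 x y),
          ← ENNReal.ofReal_mul hκ, ← Finset.sum_mul, ← mul_assoc]
        refine ENNReal.ofReal_le_ofReal (mul_le_mul_of_nonneg_right ((h _ _).trans ?_) (hq0 x y))
        have h1 : (dist o x - dist o y) ^ 2 ≤ dist x y ^ 2 := by
          rw [← sq_abs]
          refine pow_le_pow_left₀ (abs_nonneg _) ?_ 2
          rw [dist_comm o x, dist_comm o y]
          exact abs_dist_sub_le x y o
        gcongr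
    _ = ENNReal.ofReal κ * ∫⁻ y, ENNReal.ofReal (min 1 (dist x y ^ 2) * q x y) ∂μ :=
        lintegral_const_mul _ (by fun_prop)
    _ ≤ _ := by
        gcongr
        exact le_iSup (fun x => ∫⁻ y, ENNReal.ofReal (min 1 (dist x y ^ 2) * q x y) ∂μ) x

theorem sum_carre_ring_le [OpensMeasurableSpace E] (hq : Measurable (Function.uncurry q))
    (hq0 : ∀ x y, 0 ≤ q x y) (n₀ : ℕ) {n M : ℕ} (hM : n ≤ M) (x : E) :
    ∑ m ∈ Finset.Ico n M, carre μ q (fun z => ring n₀ m (dist o z)) x ≤ 4 * jumpBound μ q := by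
  simpa using sum_carre_comp_dist_le (o := o) (μ := μ) hq hq0 (Finset.Ico n M) (fun m => ring n₀ m)
    (by norm_num : (0 : ℝ) ≤ 4) (sum_ring_sub_sq_le n₀ hM) x

theorem carre_one_sub_step_le [OpensMeasurableSpace E] (hq : Measurable (Function.uncurry q))
    (hq0 : ∀ x y, 0 ≤ q x y) (n₀ j : ℕ) (x : E) :
    carre μ q (fun z => 1 - step n₀ j (dist o z)) x ≤ jumpBound μ q := by
  simpa using sum_carre_comp_dist_le (o := o) (μ := μ) hq hq0 {()} (fun _ t => 1 - step n₀ j t)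
    zero_le_one (fun t t' => by
      rw [Finset.sum_singleton, one_mul, sub_sub_sub_cancel_left, ← neg_sub, neg_sq]
      exact step_sub_sq_le n₀ j t t') x

theorem sum_nearGrad_ring_le (hq : Measurable (Function.uncurry q)) (hq0 : ∀ x y, 0 ≤ q x y)
    (n₀ : ℕ) {n M : ℕ} (hM : n ≤ M) {g : E → ℝ} (hg : Measurable g) (x : E) :
    ∑ m ∈ Finset.Ico n M, nearGrad μ q (fun z => ring n₀ m (dist o z)) g x ≤ 2 * carre μ q g x := by
  have hqx : Measurable (q x) := hq.of_uncurry_left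
  refine (sum_lintegral_le_lintegral_sum _ _).trans ?_
  rw [carre, ← lintegral_const_mul _ (by fun_prop)]
  refine lintegral_mono fun y => ?_
  have h0 : 0 ≤ (g x - g y) ^ 2 * q x y := mul_nonneg (sq_nonneg _) (hq0 x y)
  rw [← ENNReal.ofReal_sum_of_nonneg fun i _ => mul_nonneg (sq_nonneg _) h0, ← Finset.sum_mul,
    ← ENNReal.ofReal_ofNat, ← ENNReal.ofReal_mul (by norm_num)]
  exact ENNReal.ofReal_le_ofReal (mul_le_mul_of_nonneg_right (sum_ring_sq_le n₀ hM _) h0)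

theorem mul_ring_mem_core [OpensMeasurableSpace E] (hq : Measurable (Function.uncurry q))
    (hq0 : ∀ x y, 0 ≤ q x y) (hqb : jumpBound μ q < ⊤) (n₀ m : ℕ) {g : E → ℝ}
    (hg : g ∈ core μ q) : (fun x => g x * ring n₀ m (dist o x)) ∈ core μ q := by
  refine mul_mem_core hq hq0 hg ((measurable_ring n₀ m).comp measurable_dist_right) (fun x => ?_)
    (D := 4 * jumpBound μ q) (by finiteness) fun x => ?_
  · rw [abs_of_nonneg (ring_nonneg _ _ _)]
    exact ring_le_one _ _ _
  · simpa using sum_carre_ring_le (o := o) (μ := μ) hq hq0 n₀ (Nat.le_succ m) x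

end CutoffEnergy

/-! ### The super Poincaré estimate outside a ball. -/

section Outer

variable {E : Type*} [MetricSpace E] [MeasurableSpace E] [BorelSpace E] {μ : Measure E}
  {q : E → E → ℝ} {o : E} {V : E → ℝ} {β : ℝ → ℝ}

theorem setLIntegral_le_sum_ring (hVm : Measurable V)
    (hV : ∀ R : ℝ, ∃ C : ℝ, ∀ x, dist o x ≤ R → |V x| ≤ C) {g : E → ℝ} (hg : Measurable g)
    {n₀ n M : ℕ} {A : Set E} (hA : MeasurableSet A)
    (h : ∀ x ∈ A, ∃ m ∈ Finset.Ico n M, ring n₀ m (dist o x) = 1) :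
    ∫⁻ x in A, ENNReal.ofReal (g x ^ 2) ∂(perturbed μ V) ≤
      ∑ m ∈ Finset.Ico n M, ENNReal.ofReal (Real.exp (supBall o V (m + 2))) *
        ∫⁻ x, ENNReal.ofReal ((g x * ring n₀ m (dist o x)) ^ 2) ∂μ := by
  have hr : ∀ m, Measurable fun x : E => ring n₀ m (dist o x) := fun m =>
    (measurable_ring n₀ m).comp measurable_dist_right
  rw [← lintegral_indicator hA, lintegral_perturbed hVm ((by fun_prop : Measurable fun x =>
    ENNReal.ofReal (g x ^ 2)).indicator hA)]
  have : ∀ m : ℕ, ENNReal.ofReal (Real.exp (supBall o V (m + 2))) *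
        ∫⁻ x, ENNReal.ofReal ((g x * ring n₀ m (dist o x)) ^ 2) ∂μ =
      ∫⁻ x, ENNReal.ofReal (Real.exp (supBall o V (m + 2))) *
        ENNReal.ofReal ((g x * ring n₀ m (dist o x)) ^ 2) ∂μ := fun m => by
    have := hr m
    rw [lintegral_const_mul _ (by fun_prop)]
  simp only [this]
  rw [← lintegral_finsetSum _ fun m _ => by have := hr m; fun_prop]
  refine lintegral_mono fun x => ?_
  by_cases hx : x ∈ A
  · obtain ⟨m, hm, h1⟩ := h x hx
    rw [Set.indicator_of_mem hx]
    refine le_trans ?_ (Finset.single_le_sum (fun _ _ => zero_le) hm)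
    rw [h1, mul_one]
    have : dist o x ≤ m + 2 := by
      by_contra h2
      rw [ring_eq_zero_of_ge (not_le.1 h2).le] at h1
      exact zero_ne_one h1
    gcongr
    exact le_supBall hV this
  · simp [hx]

theorem lintegral_exp_mul_carre {E : Type*} [MeasurableSpace E] {μ : Measure E} [SFinite μ]
    {q : E → E → ℝ} {V : E → ℝ} (hq : Measurable (Function.uncurry q))
    (hVm : Measurable V) {f : E → ℝ} (hf : Measurable f) (κ : ℝ≥0∞) :
    ∫⁻ x, κ * ENNReal.ofReal (Real.exp (V x)) * carre μ q f x ∂μ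
      = κ * energy μ q (perturbed μ V) f := by
  have := measurable_carre (μ := μ) hq hf
  simp only [mul_assoc]
  rw [lintegral_const_mul _ (by fun_prop), energy, lintegral_perturbed hVm this]

/-- The estimate of `μ_V(f²)` off a ball. -/
theorem setLIntegral_outer_le [IsFiniteMeasure μ] (hq : Measurable (Function.uncurry q))
    (hq0 : ∀ x y, 0 ≤ q x y) (hqb : jumpBound μ q < ⊤) (hVm : Measurable V)
    (hV : ∀ R : ℝ, ∃ C : ℝ, ∀ x, dist o x ≤ R → |V x| ≤ C)
    (h_sp : SuperPoincare μ q μ fun r => ENNReal.ofReal (β r)) {f : E → ℝ} (hf : f ∈ core μ q)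
    {B : ℝ} (hB : ∀ x, |f x| ≤ B) {n k : ℕ} (hn : 1 ≤ n) (hε : epsval μ β o V n k ≠ ⊤) (M : ℕ) :
    ∫⁻ x in {x | (n : ℝ) ≤ dist o x ∧ dist o x < M}, ENNReal.ofReal (f x ^ 2) ∂(perturbed μ V) ≤
      8 * epsval μ β o V n k * energy μ q (perturbed μ V) f
      + 16 * epsval μ β o V n k * (jumpBound μ q *
          ∫⁻ x, ENNReal.ofReal (f x ^ 2) ∂(perturbed μ V))
      + 4 * (zetaval μ β o V n * gammaval μ q o n k) * ENNReal.ofReal (B ^ 2) := by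
  have hfm := hf.1
  have hd : Measurable fun x : E => dist o x := measurable_dist_right
  set ε := epsval μ β o V n k with hεdef
  set ζ := zetaval μ β o V n with hζdef
  rcases le_total M n with hMn | hMn
  · have : {x : E | (n : ℝ) ≤ dist o x ∧ dist o x < M} = ∅ := by
      ext x
      simp only [Set.mem_empty_iff_false, iff_false]
      rintro ⟨h1, h2⟩
      have : (M : ℝ) ≤ n := by exact_mod_cast hMn
      linarith
    rw [this]
    simp
  set φ : ℕ → E → ℝ := fun m x => ring 0 m (dist o x) with hφ
  have hφm : ∀ m, Measurable (φ m) := fun m => (measurable_ring 0 m).comp measurable_dist_right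
  set w : E → ℝ≥0∞ := fun x => 2 * ε * ENNReal.ofReal (Real.exp (V x)) with hw
  have hwm : Measurable w := by fun_prop
  set G : ℕ → E → ℝ≥0∞ := fun m x =>
    ∫⁻ y in {y | (k : ℝ) < dist x y ∧ (n : ℝ) - 1 ≤ dist o y},
      ENNReal.ofReal (φ m y ^ 2 * q x y) ∂μ with hG
  have hGset : ∀ x : E, MeasurableSet {y | (k : ℝ) < dist x y ∧ (n : ℝ) - 1 ≤ dist o y} := fun x =>
    (measurableSet_lt measurable_const measurable_dist_right).inter
      (measurableSet_le measurable_const measurable_dist_right)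
  -- One ring: the support lies in {ρ > m-1}, so (sp) acts as a Poincaré inequality with constant
  -- 2τ. The weight e^{K_{m,k}} trades the supremum of V on the ring for the infimum on {ρ ≤ m+k+2},
  -- hence for e^{V(x)} there.
  have step1 : ∀ m ∈ Finset.Ico n M, ENNReal.ofReal (Real.exp (supBall o V (m + 2))) *
      ∫⁻ x, ENNReal.ofReal ((f x * φ m x) ^ 2) ∂μ ≤
      2 * ∫⁻ x, w x * nearGrad μ q (φ m) f x ∂μ
      + 2 * ∫⁻ x, w x * (ENNReal.ofReal (f x ^ 2) * carre μ q (φ m) x) ∂μ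
      + 2 * ζ * (ENNReal.ofReal (B ^ 2) * ∫⁻ x, G m x ∂μ) := by
    intro m hm
    rw [Finset.mem_Ico] at hm
    have hτ1 : tailInv μ β o m * ENNReal.ofReal (Real.exp (Kval o V m k)) ≤ ε :=
      le_iSup₂ (f := fun m (_ : n ≤ m) =>
        tailInv μ β o m * ENNReal.ofReal (Real.exp (Kval o V m k))) m hm.1
    have hτ2 : tailInv μ β o m * ENNReal.ofReal (Real.exp (Zval o V (m + 1))) ≤ ζ :=
      le_iSup₂ (f := fun m (_ : n ≤ m) =>
        tailInv μ β o m * ENNReal.ofReal (Real.exp (Zval o V (m + 1)))) m hm.1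
    have hZ : Zval o V (m + 1) = supBall o V (m + 2) := by
      unfold Zval
      congr 1
      push_cast
      ring
    rw [hZ] at hτ2
    have hτ : tailInv μ β o m ≠ ⊤ := by
      intro h
      rw [h, ENNReal.top_mul (by simp [Real.exp_pos])] at hτ1
      exact hε (top_le_iff.1 hτ1)
    set τ := tailInv μ β o m with hτdef
    set c := 2 * τ * ENNReal.ofReal (Real.exp (supBall o V (m + 2))) with hc
    have hsupp : μ {x | f x * φ m x ≠ 0} ≤ μ {x | (m : ℝ) - 1 < dist o x} := by
      refine measure_mono fun x hx => ?_
      by_contra h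
      exact hx (by rw [hφ]; simp only; rw [ring_eq_zero_of_le (by omega) (not_lt.1 h), mul_zero])
    have hloc := lintegral_sq_le_of_measure_support_le h_sp
      (mul_ring_mem_core (o := o) hq hq0 hqb 0 m hf) hsupp hτ
    have hA : MeasurableSet {x : E | (m : ℝ) + k + 2 < dist o x} :=
      measurableSet_lt measurable_const measurable_dist_right
    have hsplit := mul_energy_mul_le (μ := μ) hq hq0 (hφm m) hfm hA (c := c) (w := w)
      (fun x hx => by
        refine ring_eq_zero_of_ge ?_
        have h1 : (m : ℝ) + k + 2 < dist o x := hx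
        have h2 : (0 : ℝ) ≤ k := Nat.cast_nonneg k
        linarith) hwm (fun x hx => by
        have h1 : dist o x ≤ m + k + 2 := not_lt.1 hx
        calc c = 2 * (τ * ENNReal.ofReal (Real.exp (Kval o V m k)))
              * ENNReal.ofReal (Real.exp (infBall o V (m + k + 2))) := by
              rw [hc, Kval]
              rw [mul_assoc 2, mul_assoc 2, mul_assoc τ,
                ← ENNReal.ofReal_mul (Real.exp_pos _).le, ← Real.exp_add, sub_add_cancel]
          _ ≤ 2 * ε * ENNReal.ofReal (Real.exp (V x)) := by
              gcongr
              exact infBall_le hV h1)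
    calc ENNReal.ofReal (Real.exp (supBall o V (m + 2))) *
          ∫⁻ x, ENNReal.ofReal ((f x * φ m x) ^ 2) ∂μ
        ≤ ENNReal.ofReal (Real.exp (supBall o V (m + 2))) *
          (2 * τ * energy μ q μ fun x => f x * φ m x) := by gcongr; exact hloc
      _ = c * energy μ q μ fun x => f x * φ m x := by rw [hc]; ring
      _ ≤ _ := hsplit
      _ ≤ _ := by
        refine add_le_add le_rfl ?_
        have hcζ : c ≤ 2 * ζ := by
          rw [hc, mul_assoc]
          gcongr
        refine mul_le_mul' hcζ ?_
        -- From ρ(x) > m+k+2 into the support m-1 < ρ(y) < m+2 a jump is longer than k and ends in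
        -- {ρ ≥ n-1}, the region of γ_{n,k}.
        calc ∫⁻ x in {x | (m : ℝ) + k + 2 < dist o x}, farTerm μ q (fun z => f z * φ m z) x ∂μ
            ≤ ∫⁻ x in {x | (m : ℝ) + k + 2 < dist o x}, ENNReal.ofReal (B ^ 2) * G m x ∂μ := by
              refine setLIntegral_mono' hA fun x hx => ?_
              rw [hG]
              have hqx : Measurable (q x) := hq.of_uncurry_left
              have := hφm m
              simp only
              rw [← lintegral_const_mul _ (by fun_prop), ← lintegral_indicator (hGset x)]
              refine lintegral_mono fun y => ?_
              by_cases hy : φ m y = 0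
              · simp [hy]
              have h1 : dist o y < m + 2 := by
                by_contra h
                exact hy (ring_eq_zero_of_ge (not_lt.1 h))
              have h2 : (m : ℝ) - 1 < dist o y := by
                by_contra h
                exact hy (ring_eq_zero_of_le (by omega) (not_lt.1 h))
              have h3 : (n : ℝ) ≤ m := by exact_mod_cast hm.1
              have h4 : (m : ℝ) + k + 2 < dist o x := hx
              have h5 := dist_triangle o y x
              rw [dist_comm y x] at h5
              rw [Set.indicator_of_mem (show y ∈ {y | (k : ℝ) < dist x y ∧ (n : ℝ) - 1 ≤ dist o y}
                from ⟨by linarith, by linarith⟩), mul_pow, mul_assoc,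
                ENNReal.ofReal_mul (sq_nonneg _)]
              exact mul_le_mul' (ofReal_sq_le_of_abs_le (hB y)) le_rfl
          _ ≤ ∫⁻ x, ENNReal.ofReal (B ^ 2) * G m x ∂μ := setLIntegral_le_lintegral _ _
          _ = _ := lintegral_const_mul' _ _ ENNReal.ofReal_ne_top
  refine (setLIntegral_le_sum_ring hVm hV hfm (n₀ := 0) (n := n) (M := M)
    ((measurableSet_le measurable_const hd).inter (measurableSet_lt hd measurable_const))
    (fun x hx => ?_)).trans ((Finset.sum_le_sum step1).trans ?_)
  · refine ⟨⌊dist o x⌋₊, Finset.mem_Ico.2 ⟨Nat.le_floor hx.1, (Nat.floor_lt dist_nonneg).2 hx.2⟩,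
      ring_eq_one (Nat.zero_le _) (Or.inr (Nat.floor_le dist_nonneg)) (Nat.lt_floor_add_one _).le⟩
  · rw [Finset.sum_add_distrib, Finset.sum_add_distrib, ← Finset.mul_sum, ← Finset.mul_sum,
      ← Finset.mul_sum, ← Finset.mul_sum]
    refine add_le_add (add_le_add ?_ ?_) ?_
    · calc _ ≤ 2 * ∫⁻ x, ∑ m ∈ Finset.Ico n M, w x * nearGrad μ q (φ m) f x ∂μ := by
            gcongr; exact sum_lintegral_le_lintegral_sum _ _
        _ ≤ 2 * ∫⁻ x, 2 * (2 * ε) * ENNReal.ofReal (Real.exp (V x)) * carre μ q f x ∂μ := by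
            gcongr with x
            rw [← Finset.mul_sum]
            calc _ ≤ w x * (2 * carre μ q f x) := by
                  gcongr; exact sum_nearGrad_ring_le hq hq0 0 hMn hfm x
              _ = _ := by rw [hw]; ring
        _ = _ := by rw [lintegral_exp_mul_carre hq hVm hfm]; ring
    · calc _ ≤ 2 * ∫⁻ x, ∑ m ∈ Finset.Ico n M,
              w x * (ENNReal.ofReal (f x ^ 2) * carre μ q (φ m) x) ∂μ := by
            gcongr; exact sum_lintegral_le_lintegral_sum _ _
        _ ≤ 2 * ∫⁻ x, 2 * ε * (4 * jumpBound μ q) *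
              (ENNReal.ofReal (Real.exp (V x)) * ENNReal.ofReal (f x ^ 2)) ∂μ := by
            gcongr with x
            rw [← Finset.mul_sum, ← Finset.mul_sum]
            calc _ ≤ w x * (ENNReal.ofReal (f x ^ 2) * (4 * jumpBound μ q)) := by
                  gcongr; exact sum_carre_ring_le hq hq0 0 hMn x
              _ = _ := by rw [hw]; ring
        _ = _ := by
            rw [lintegral_const_mul _ (by fun_prop), ← lintegral_perturbed hVm (by fun_prop)]
            ring
    -- Keeping φ_m(y)² inside `G` means that summation over all rings costs only a factor 2.
    · have hγ : ∑ m ∈ Finset.Ico n M, ∫⁻ x, G m x ∂μ ≤ 2 * gammaval μ q o n k := by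
        refine (sum_lintegral_le_lintegral_sum _ _).trans ?_
        rw [gammaval, ← lintegral_const_mul' _ _ (by norm_num)]
        refine lintegral_mono fun x => (sum_lintegral_le_lintegral_sum _ _).trans ?_
        have hqx : Measurable (q x) := hq.of_uncurry_left
        rw [← lintegral_const_mul _ (by fun_prop)]
        refine lintegral_mono fun y => ?_
        rw [← ENNReal.ofReal_sum_of_nonneg fun i _ => mul_nonneg (sq_nonneg _) (hq0 x y),
          ← Finset.sum_mul, ← ENNReal.ofReal_ofNat, ← ENNReal.ofReal_mul (by norm_num)]
        exact ENNReal.ofReal_le_ofReal (mul_le_mul_of_nonneg_right (sum_ring_sq_le 0 hMn _)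
          (hq0 x y))
      calc _ ≤ 2 * ζ * (ENNReal.ofReal (B ^ 2) * (2 * gammaval μ q o n k)) := by gcongr
        _ = _ := by ring

end Outer

/-! ### The super Poincaré estimate inside a ball, and both combined. -/

section Inner

variable {E : Type*} [MetricSpace E] [MeasurableSpace E] [BorelSpace E] {μ : Measure E}
  {q : E → E → ℝ} {o : E} {V : E → ℝ} {β : ℝ → ℝ}

theorem lintegral_le_of_forall_ball_le {E : Type*} [MetricSpace E] [MeasurableSpace E] {o : E}
    {ν : Measure E} {F : E → ℝ≥0∞} {C : ℝ≥0∞}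
    (h : ∀ M : ℕ, ∫⁻ x in {x | dist o x < M}, F x ∂ν ≤ C) : ∫⁻ x, F x ∂ν ≤ C := by
  have hU : (⋃ M : ℕ, {x : E | dist o x < M}) = Set.univ :=
    Set.eq_univ_of_forall fun x => Set.mem_iUnion.2 (exists_nat_gt (dist o x))
  have hmono : Monotone fun M : ℕ => {x : E | dist o x < M} := fun a b hab x hx =>
    lt_of_lt_of_le (show dist o x < a from hx) (by exact_mod_cast hab)
  rw [← setLIntegral_univ, ← hU, setLIntegral_iUnion_of_directed F hmono.directed_le]
  exact iSup_le h

/-- The estimate of `μ_V(f²)` on a ball. -/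
theorem setLIntegral_inner_le [IsFiniteMeasure μ] (hq : Measurable (Function.uncurry q))
    (hq0 : ∀ x y, 0 ≤ q x y) (hqb : jumpBound μ q < ⊤) (hVm : Measurable V)
    (hV : ∀ R : ℝ, ∃ C : ℝ, ∀ x, dist o x ≤ R → |V x| ≤ C)
    (h_sp : SuperPoincare μ q μ fun r => ENNReal.ofReal (β r)) {f : E → ℝ} (hf : f ∈ core μ q)
    {B : ℝ} (hB : ∀ x, |f x| ≤ B) {δ : ℝ} (hδ : 0 ≤ δ) {i n k : ℕ}
    (ht : tval β o V δ i n k ≠ ⊤) :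
    ∫⁻ x in {x | dist o x ≤ n}, ENNReal.ofReal (f x ^ 2) ∂(perturbed μ V) ≤
      2 * (tval β o V δ i n k * ENNReal.ofReal (Real.exp (Kval o V n k))) *
        energy μ q (perturbed μ V) f
      + 2 * (tval β o V δ i n k * ENNReal.ofReal (Real.exp (Kval o V n k))) * (jumpBound μ q *
          ∫⁻ x, ENNReal.ofReal (f x ^ 2) ∂(perturbed μ V))
      + tval β o V δ i n k * ENNReal.ofReal (Real.exp (Zval o V n)) * etaval μ q o n k *
          ENNReal.ofReal (B ^ 2)
      + ENNReal.ofReal (1 / 4 * δ ^ i) * (∫⁻ x, ENNReal.ofReal |f x| ∂(perturbed μ V)) ^ 2 := by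
  have hfm := hf.1
  have hd : Measurable fun x : E => dist o x := measurable_dist_right
  set t := tval β o V δ i n k with htdef
  set Z := Zval o V n with hZ
  set I := infBall o V (n + k + 2) with hI
  have hk : (0 : ℝ) ≤ k := Nat.cast_nonneg k
  have hn : (0 : ℝ) ≤ n := Nat.cast_nonneg n
  set φ : E → ℝ := fun x => 1 - step 0 (n + 1) (dist o x) with hφ
  have hφm : Measurable φ := measurable_const.sub ((measurable_step _ _).comp hd)
  have hφ0 : ∀ x, 0 ≤ φ x := fun x => sub_nonneg.2 (step_le_one _ _ _)
  have hφ1 : ∀ x, φ x ≤ 1 := fun x => sub_le_self _ (step_nonneg _ _ _)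
  have hφin : ∀ x, dist o x ≤ n → φ x = 1 := fun x hx => by
    rw [hφ]
    simp only
    rw [step_eq_zero (by omega) (by push_cast; linarith), sub_zero]
  have hφout : ∀ x, (n : ℝ) + 1 ≤ dist o x → φ x = 0 := fun x hx => by
    rw [hφ]
    simp only
    rw [step_eq_one (by push_cast; exact hx), sub_self]
  have hφne : ∀ x, φ x ≠ 0 → dist o x ≤ n + 1 := fun x hx => by
    by_contra h
    exact hx (hφout x (not_le.1 h).le)
  have hu : (fun x => f x * φ x) ∈ core μ q :=
    mul_mem_core hq hq0 hf hφm (fun x => by rw [abs_of_nonneg (hφ0 x)]; exact hφ1 x) hqb.ne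
      (carre_one_sub_step_le hq hq0 0 (n + 1))
  set w : E → ℝ≥0∞ := fun x => t * ENNReal.ofReal (Real.exp (Kval o V n k)) *
    ENNReal.ofReal (Real.exp (V x)) with hw
  have hwm : Measurable w := by fun_prop
  have hA : MeasurableSet {x : E | (n : ℝ) + k + 2 < dist o x} := measurableSet_lt measurable_const hd
  have hcomp : ∫⁻ x in {x | dist o x ≤ n}, ENNReal.ofReal (f x ^ 2) ∂(perturbed μ V) ≤
      ENNReal.ofReal (Real.exp Z) * ∫⁻ x, ENNReal.ofReal ((f x * φ x) ^ 2) ∂μ := by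
    have hb : MeasurableSet {x : E | dist o x ≤ n} := measurableSet_le hd measurable_const
    rw [← lintegral_indicator hb, lintegral_perturbed hVm ((by fun_prop : Measurable fun x =>
      ENNReal.ofReal (f x ^ 2)).indicator hb), ← lintegral_const_mul _ (by fun_prop)]
    refine lintegral_mono fun x => ?_
    by_cases hx : x ∈ {x : E | dist o x ≤ n}
    · have hx' : dist o x ≤ n := hx
      rw [Set.indicator_of_mem hx, hφin x hx, mul_one]
      gcongr
      exact le_supBall hV (by linarith)
    · simp [hx]
  have hL1 : ∫⁻ x, ENNReal.ofReal |f x * φ x| ∂μ ≤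
      ENNReal.ofReal (Real.exp (-I)) * ∫⁻ x, ENNReal.ofReal |f x| ∂(perturbed μ V) := by
    rw [lintegral_perturbed hVm (by fun_prop), ← lintegral_const_mul _ (by fun_prop)]
    refine lintegral_mono fun x => ?_
    by_cases hx : φ x = 0
    · simp [hx]
    have h1 : I ≤ V x := infBall_le hV (by linarith [hφne x hx])
    rw [← mul_assoc, ← ENNReal.ofReal_mul (Real.exp_pos _).le, ← Real.exp_add,
      ← ENNReal.ofReal_mul (Real.exp_pos _).le]
    refine ENNReal.ofReal_le_ofReal ?_
    rw [abs_mul, abs_of_nonneg (hφ0 x)]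
    have h2 : (1 : ℝ) ≤ Real.exp (-I + V x) := Real.one_le_exp (by linarith)
    nlinarith [abs_nonneg (f x), hφ1 x, hφ0 x]
  have hmain : ∫⁻ x in {x | dist o x ≤ n}, ENNReal.ofReal (f x ^ 2) ∂(perturbed μ V) ≤
      t * (ENNReal.ofReal (Real.exp Z) * energy μ q μ fun x => f x * φ x) +
      ENNReal.ofReal (1 / 4 * δ ^ i) * (∫⁻ x, ENNReal.ofReal |f x| ∂(perturbed μ V)) ^ 2 := by
    have hE := energy_lt_top (ν := μ) hu
    refine le_betaInv_mul_add ht (by finiteness) fun r hr hβr => ?_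
    have h1 := h_sp r hr _ (mem_formDomain_of_mem_core hu)
    refine hcomp.trans ((mul_le_mul' le_rfl h1).trans ?_)
    rw [mul_add]
    refine add_le_add (le_of_eq (by ring)) ?_
    calc _ ≤ ENNReal.ofReal (Real.exp Z) *
          (ENNReal.ofReal (1 / 4 * δ ^ i * Real.exp (-Jval o V n k)) *
          (ENNReal.ofReal (Real.exp (-I)) * ∫⁻ x, ENNReal.ofReal |f x| ∂(perturbed μ V)) ^ 2) := by
          gcongr
      _ = ENNReal.ofReal (Real.exp Z * (1 / 4 * δ ^ i * Real.exp (-Jval o V n k)) *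
          Real.exp (-I) ^ 2) * (∫⁻ x, ENNReal.ofReal |f x| ∂(perturbed μ V)) ^ 2 := by
          rw [ENNReal.ofReal_mul (q := Real.exp (-I) ^ 2) (by positivity),
            ENNReal.ofReal_mul (p := Real.exp Z) (Real.exp_pos _).le, ENNReal.ofReal_pow (Real.exp_pos _).le]
          ring
      _ = _ := by
          congr 2
          -- J is defined for this cancellation: e^Z converts the square integral, and e^{-I} enters
          -- squared through the L¹ norm.
          have : Real.exp Z * Real.exp (-Jval o V n k) * Real.exp (-I) ^ 2 = 1 := by
            rw [← Real.exp_nat_mul, ← Real.exp_add, ← Real.exp_add, Real.exp_eq_one_iff, Jval, hI,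
              hZ, Zval]
            push_cast
            ring
          linear_combination (1 / 4 * δ ^ i) * this
  have hsplit := mul_energy_mul_le (μ := μ) hq hq0 hφm hfm hA
    (c := t * ENNReal.ofReal (Real.exp Z)) (w := w)
    (fun x hx => hφout x (by
      have h1 : (n : ℝ) + k + 2 < dist o x := hx
      linarith)) hwm (fun x hx => by
      have h1 : dist o x ≤ n + k + 2 := not_lt.1 hx
      have h2 : supBall o V (n + 1) ≤ supBall o V (n + 2) :=
        supBall_mono hV (by linarith) (by linarith)
      have h3 : infBall o V (n + k + 2) ≤ V x := infBall_le hV h1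
      rw [hw]
      simp only
      rw [mul_assoc, ← ENNReal.ofReal_mul (Real.exp_pos _).le, ← Real.exp_add]
      gcongr
      rw [hZ, Zval, Kval]
      linarith)
  refine hmain.trans (add_le_add ?_ le_rfl)
  rw [← mul_assoc]
  refine hsplit.trans (add_le_add (add_le_add ?_ ?_) ?_)
  · calc _ ≤ 2 * ∫⁻ x, w x * carre μ q f x ∂μ := by
          gcongr with x
          refine lintegral_mono fun y => ENNReal.ofReal_le_ofReal ?_
          refine mul_le_of_le_one_left (mul_nonneg (sq_nonneg _) (hq0 x y)) ?_
          exact pow_le_one₀ (hφ0 y) (hφ1 y)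
      _ = _ := by rw [lintegral_exp_mul_carre hq hVm hfm]; ring
  · calc _ ≤ 2 * ∫⁻ x, t * ENNReal.ofReal (Real.exp (Kval o V n k)) * jumpBound μ q *
            (ENNReal.ofReal (Real.exp (V x)) * ENNReal.ofReal (f x ^ 2)) ∂μ := by
          refine mul_le_mul' le_rfl (lintegral_mono fun x => ?_)
          calc _ ≤ w x * (ENNReal.ofReal (f x ^ 2) * jumpBound μ q) := by
                gcongr; exact carre_one_sub_step_le hq hq0 0 (n + 1) x
            _ = _ := by rw [hw]; ring
      _ = _ := by
          rw [lintegral_const_mul _ (by fun_prop), ← lintegral_perturbed hVm (by fun_prop)]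
          ring
  · rw [mul_assoc (t * ENNReal.ofReal (Real.exp Z)), etaval,
      ← lintegral_mul_const' _ _ ENNReal.ofReal_ne_top]
    gcongr with x
    have hqx : Measurable (q x) := hq.of_uncurry_left
    have hb : MeasurableSet {y : E | dist o y ≤ (n : ℝ) + 1} := measurableSet_le hd measurable_const
    rw [← lintegral_mul_const _ (by fun_prop), ← lintegral_indicator hb]
    refine lintegral_mono fun y => ?_
    by_cases hy : φ y = 0
    · simp [hy]
    rw [Set.indicator_of_mem (show y ∈ {y : E | dist o y ≤ (n : ℝ) + 1} from hφne y hy), mul_comm,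
      ENNReal.ofReal_mul (hq0 x y)]
    refine mul_le_mul' le_rfl (ofReal_sq_le_of_abs_le ?_)
    rw [abs_mul, abs_of_nonneg (hφ0 y)]
    exact (mul_le_of_le_one_right (abs_nonneg _) (hφ1 y)).trans (hB y)

/-- The estimate of `μ_V(f²)` for bounded `f`. -/
theorem lintegral_sq_perturbed_le [IsFiniteMeasure μ] (hq : Measurable (Function.uncurry q))
    (hq0 : ∀ x y, 0 ≤ q x y) (hqb : jumpBound μ q < ⊤) (hVm : Measurable V)
    (hV : ∀ R : ℝ, ∃ C : ℝ, ∀ x, dist o x ≤ R → |V x| ≤ C)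
    (h_sp : SuperPoincare μ q μ fun r => ENNReal.ofReal (β r)) {f : E → ℝ} (hf : f ∈ core μ q)
    {B : ℝ} (hB : ∀ x, |f x| ≤ B) {δ : ℝ} (hδ : 0 ≤ δ) {i n k : ℕ} (hn : 1 ≤ n) {ε tK : ℝ≥0∞}
    (hε : ε = epsval μ β o V n k) (hε' : ε ≠ ⊤)
    (htK : tK = tval β o V δ i n k * ENNReal.ofReal (Real.exp (Kval o V n k))) (htK' : tK ≠ ⊤) :
    ∫⁻ x, ENNReal.ofReal (f x ^ 2) ∂(perturbed μ V) ≤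
      2 * (8 * ε + tK) * (energy μ q (perturbed μ V) f + jumpBound μ q *
          ∫⁻ x, ENNReal.ofReal (f x ^ 2) ∂(perturbed μ V))
      + (6 * (zetaval μ β o V n * gammaval μ q o n k) +
          tval β o V δ i n k * ENNReal.ofReal (Real.exp (Zval o V n)) * etaval μ q o n k) *
          ENNReal.ofReal (B ^ 2)
      + ENNReal.ofReal (1 / 4 * δ ^ i) * (∫⁻ x, ENNReal.ofReal |f x| ∂(perturbed μ V)) ^ 2 := by
  subst hε htK
  have ht : tval β o V δ i n k ≠ ⊤ := by
    intro h
    rw [h, ENNReal.top_mul (by simp [Real.exp_pos])] at htK'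
    exact htK' rfl
  have hin := setLIntegral_inner_le hq hq0 hqb hVm hV h_sp hf hB hδ ht
  refine lintegral_le_of_forall_ball_le (o := o) fun M => ?_
  have hout := setLIntegral_outer_le hq hq0 hqb hVm hV h_sp hf hB hn hε' M
  have hsub : {x : E | dist o x < M} ⊆
      {x | dist o x ≤ n} ∪ {x | (n : ℝ) ≤ dist o x ∧ dist o x < M} := fun x hx =>
    (le_total (dist o x) n).imp id fun h => ⟨h, hx⟩
  refine (lintegral_mono_set hsub).trans ((lintegral_union_le _ _ _).trans
    ((add_le_add hin hout).trans ?_))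
  set X := ∫⁻ x, ENNReal.ofReal (f x ^ 2) ∂(perturbed μ V)
  set Ev := energy μ q (perturbed μ V) f
  set ε := epsval μ β o V n k
  set tK := tval β o V δ i n k * ENNReal.ofReal (Real.exp (Kval o V n k))
  set ζγ := zetaval μ β o V n * gammaval μ q o n k
  set tη := tval β o V δ i n k * ENNReal.ofReal (Real.exp (Zval o V n)) * etaval μ q o n k
  set m1 := ENNReal.ofReal (1 / 4 * δ ^ i) * (∫⁻ x, ENNReal.ofReal |f x| ∂(perturbed μ V)) ^ 2
  calc _ = 8 * ε * Ev + 2 * tK * Ev + 2 * (8 * ε + tK) * (jumpBound μ q * X)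
        + (4 * ζγ + tη) * ENNReal.ofReal (B ^ 2) + m1 := by ring
    -- The coefficient of the energy is enlarged from 8ε to 16ε to match that of λX, and 4ζγ to 6ζγ
    -- to match the condition in `MemD`.
    _ ≤ 16 * ε * Ev + 2 * tK * Ev + 2 * (8 * ε + tK) * (jumpBound μ q * X)
        + (6 * ζγ + tη) * ENNReal.ofReal (B ^ 2) + m1 := by
        gcongr <;> norm_num
    _ = _ := by ring

end Inner

/-! ### Summing over levels. -/

section Levels

variable {E : Type*} [MeasurableSpace E] {μ : Measure E} {q : E → E → ℝ}

theorem sum_energy_levelCut_le (hq0 : ∀ x y, 0 ≤ q x y) (ν : Measure E) {a : ℕ → ℝ}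
    (ha : Monotone a) {j N : ℕ} (hN : j ≤ N) (f : E → ℝ) :
    ∑ i ∈ Finset.Ico j N, energy μ q ν (fun x => levelCut (a i) (a (i + 1)) (f x))
      ≤ energy μ q ν f := by
  refine (sum_lintegral_le_lintegral_sum _ _).trans (lintegral_mono fun x => ?_)
  refine (sum_lintegral_le_lintegral_sum _ _).trans (lintegral_mono fun y => ?_)
  rw [← ENNReal.ofReal_sum_of_nonneg fun i _ => mul_nonneg (sq_nonneg _) (hq0 x y),
    ← Finset.sum_mul]
  exact ENNReal.ofReal_le_ofReal
    (mul_le_mul_of_nonneg_right (sum_levelCut_sub_sq_le ha hN _ _) (hq0 x y))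

theorem monotone_geometric {H s : ℝ} (hH : 0 ≤ H) (hs : 1 < s) : Monotone fun i : ℕ => H * s ^ i :=
  fun _ _ h => mul_le_mul_of_nonneg_left (pow_le_pow_right₀ hs.le h) hH

/-- With h the lowest level, u² ≤ (5/4) h|u| + 5 (|u| - h)₊² pointwise. The part below h is paid for
by the L¹ norm, and the excess by the slices through `sq_levelCut_le_sum`. -/
theorem lintegral_sq_le_sum_levelCut {ν : Measure E} {f : E → ℝ} (hf : Measurable f) {H s : ℝ}
    (hH : 0 ≤ H) (hs : 1 < s) {j N : ℕ} (hN : j ≤ N) (hfN : ∀ x, |f x| ≤ H * s ^ N) :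
    ∫⁻ x, ENNReal.ofReal (f x ^ 2) ∂ν ≤
      ENNReal.ofReal (5 / 4 * (H * s ^ j)) * ∫⁻ x, ENNReal.ofReal |f x| ∂ν
      + ENNReal.ofReal (10 * s / (s - 1)) * ∑ i ∈ Finset.Ico j N,
        ∫⁻ x, ENNReal.ofReal (levelCut (H * s ^ i) (H * s ^ (i + 1)) (f x) ^ 2) ∂ν := by
  have hm : ∀ i : ℕ, Measurable fun x => levelCut (H * s ^ i) (H * s ^ (i + 1)) (f x) := fun i =>
    (measurable_levelCut _ _).comp hf
  have hs1 : 0 < s - 1 := by linarith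
  have hh : 0 ≤ H * s ^ j := by positivity
  rw [← lintegral_finsetSum _ fun i _ => by have := hm i; fun_prop,
    ← lintegral_const_mul _ (by fun_prop), ← lintegral_const_mul _
      (Finset.measurable_fun_sum _ fun i _ => by have := hm i; fun_prop),
    ← lintegral_add_left (by fun_prop)]
  refine lintegral_mono fun x => ?_
  rw [← ENNReal.ofReal_sum_of_nonneg fun i _ => sq_nonneg _, ← ENNReal.ofReal_mul (by positivity),
    ← ENNReal.ofReal_mul (by positivity), ← ENNReal.ofReal_add (by positivity)
      (mul_nonneg (by positivity) (Finset.sum_nonneg fun i _ => sq_nonneg _))]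
  refine ENNReal.ofReal_le_ofReal ?_
  have key := sq_levelCut_le_sum hH hs hN (hfN x)
  have e : 10 * s / (s - 1) = 5 * (2 * s / (s - 1)) := by ring
  rw [e, mul_assoc 5]
  refine le_trans ?_ (add_le_add le_rfl (mul_le_mul_of_nonneg_left key (by norm_num)))
  rw [← sq_abs (f x)]
  generalize H * s ^ j = h at *
  have h0 := abs_nonneg (f x)
  rcases le_total |f x| h with h1 | h1
  · rw [max_eq_right (by linarith)]
    nlinarith
  · rw [max_eq_left (by linarith)]
    nlinarith [sq_nonneg (|f x| - h), sq_nonneg (2 * (|f x| - h) - h / 4)]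

/-- Chebyshev's inequality at a level of the form `√(ν(f²)) s^i`. -/
theorem measure_level_le {ν : Measure E} {f : E → ℝ} (hf : Measurable f) {M s : ℝ} (hM : 0 < M)
    (hX : ∫⁻ x, ENNReal.ofReal (f x ^ 2) ∂ν = ENNReal.ofReal M) (hs : 0 ≤ s) (i : ℕ) :
    ENNReal.ofReal ((s ^ 2) ^ i) * ν {x | Real.sqrt M * s ^ i < |f x|} ≤ 1 := by
  have h1 : ENNReal.ofReal (M * (s ^ 2) ^ i) * ν {x | Real.sqrt M * s ^ i < |f x|} ≤
      ENNReal.ofReal M := by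
    rw [← hX]
    refine le_trans ?_ (mul_meas_ge_le_lintegral (by fun_prop : Measurable fun x =>
      ENNReal.ofReal (f x ^ 2)) (ENNReal.ofReal (M * (s ^ 2) ^ i)))
    gcongr with x
    intro hx
    have hx' : Real.sqrt M * s ^ i < |f x| := hx
    refine ENNReal.ofReal_le_ofReal ?_
    rw [← sq_abs (f x)]
    calc M * (s ^ 2) ^ i = (Real.sqrt M * s ^ i) ^ 2 := by
          rw [mul_pow, Real.sq_sqrt hM.le]; ring
      _ ≤ _ := pow_le_pow_left₀ (by positivity) hx'.le 2
  rw [ENNReal.ofReal_mul hM.le, mul_assoc] at h1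
  have hM' : ENNReal.ofReal M ≠ 0 := by simpa using hM
  rwa [← ENNReal.mul_le_mul_iff_right hM' ENNReal.ofReal_ne_top, mul_one]

theorem exists_level_bound {H s : ℝ} (hH : 0 < H) (hs : 1 < s) (B : ℝ) (j : ℕ) :
    ∃ N, j ≤ N ∧ B ≤ H * s ^ N := by
  have h : Tendsto (fun N : ℕ => H * s ^ N) atTop atTop :=
    (tendsto_pow_atTop_atTop_of_one_lt hs).const_mul_atTop hH
  obtain ⟨N, h1, h2⟩ := ((eventually_ge_atTop j).and (h.eventually_ge_atTop B)).exists
  exact ⟨N, h1, h2⟩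

end Levels

/-! ### The super Poincaré inequality for μ_V. -/

section Super

variable {E : Type*} [MetricSpace E] [MeasurableSpace E] {μ : Measure E}
  {q : E → E → ℝ} {o : E} {V : E → ℝ} {β : ℝ → ℝ}

theorem cdelta_pos {δ : ℝ} (hδ : 1 < δ) : 0 < cdelta δ := by
  have h1 : 1 < Real.sqrt δ := by rw [Real.lt_sqrt] <;> linarith
  have h2 : 0 < Real.sqrt δ - 1 := by linarith
  unfold cdelta
  positivity

theorem exists_memD {δ : ℝ} (hδ : 1 < δ) (hqb : jumpBound μ q < ⊤) {n k : ℕ → ℕ}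
    (h : MemI μ q β o V δ n k) {r : ℝ} (hr : 0 < r) : ∃ j, MemD μ q β o V δ n k r j := by
  obtain ⟨-, hA1, hA2⟩ := h
  have hcpos := cdelta_pos hδ
  have h1 : ∀ᶠ j in atTop, ∀ i, j ≤ i → 8 * epsval μ β o V (n i) (k i) + tK β o V δ n k i
      ≤ min (1 / (64 * jumpBound μ q)) (ENNReal.ofReal (cdelta δ * r / 16)) := by
    have hlim : Tendsto (fun i => 8 * (epsval μ β o V (n i) (k i) + tK β o V δ n k i)) atTop
        (𝓝 0) := by
      simpa using ENNReal.Tendsto.const_mul (a := 8) hA1 (Or.inr (by norm_num))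
    have hpos : 0 < min (1 / (64 * jumpBound μ q)) (ENNReal.ofReal (cdelta δ * r / 16)) := by
      refine lt_min (ENNReal.div_pos one_ne_zero (by finiteness)) ?_
      rw [ENNReal.ofReal_pos]
      positivity
    refine (eventually_forall_ge_atTop.2 (hlim.eventually (gt_mem_nhds hpos))).mono
      fun j hj i hi => ?_
    refine le_trans ?_ (hj i hi).le
    rw [mul_add]
    gcongr
    exact le_mul_of_one_le_left zero_le (by norm_num)
  have h2 : ∀ᶠ j in atTop, ∑' i : ℕ, (6 * zetaGamma μ q β o V n k (j + i)
      + tZeta μ q β o V δ n k (j + i)) * ENNReal.ofReal (δ ^ (j + i + 2)) ≤ 1 / 256 := by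
    have hlim := ENNReal.Tendsto.const_mul (a := 6 * ENNReal.ofReal (δ ^ 2))
      (ENNReal.tendsto_sum_nat_add _ hA2.ne) (Or.inr (by finiteness))
    rw [mul_zero] at hlim
    have hev := (tendsto_order.1 hlim).2 (1 / 256) (by simp)
    obtain ⟨a, ha⟩ := eventually_atTop.1 hev
    refine eventually_atTop.2 ⟨a + 1, fun j hj => ?_⟩
    -- The series in `CondA2Weighted` starts at index 1, so the tail from j is its shift by j - 1.
    obtain ⟨l, rfl⟩ : ∃ l, j = l + 1 := ⟨j - 1, by omega⟩
    refine le_trans ?_ (ha l (by omega)).le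
    rw [← ENNReal.tsum_mul_left]
    refine ENNReal.tsum_le_tsum fun i => ?_
    have e1 : 1 + (i + l) = l + 1 + i := by ring
    rw [e1, pow_add δ _ 2, ENNReal.ofReal_mul (by positivity)]
    generalize ENNReal.ofReal (δ ^ 2) = d
    calc _ ≤ (6 * zetaGamma μ q β o V n k (l + 1 + i) + 6 * tZeta μ q β o V δ n k (l + 1 + i)) *
          (ENNReal.ofReal (δ ^ (l + 1 + i)) * d) := by
          gcongr
          exact le_mul_of_one_le_left zero_le (by norm_num)
      _ = _ := by ring
  obtain ⟨j, ⟨hj1, hj2⟩, hj3⟩ := ((h1.and h2).and (eventually_ge_atTop 1)).exists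
  exact ⟨j, hj3, hj1, hj2⟩

theorem betaV_lt_top {δ : ℝ} (hδ : 1 < δ) (hqb : jumpBound μ q < ⊤) {n k : ℕ → ℕ}
    (h : MemI μ q β o V δ n k) {r : ℝ} (hr : 0 < r) : betaV μ q β o V δ r < ⊤ := by
  obtain ⟨j, hj⟩ := exists_memD hδ hqb h hr
  simp only [betaV, iInf_lt_iff]
  exact ⟨n, k, h, j, hj, ENNReal.ofReal_lt_top⟩

variable [BorelSpace E]

/-- With s = √δ and M = ν(f²), every error on the i-th slice is either half of the slice itself or
summable in i with total a small multiple of M. -/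
theorem poincareBound_of_memD [IsFiniteMeasure μ] (hq : Measurable (Function.uncurry q))
    (hq0 : ∀ x y, 0 ≤ q x y) (hqb : jumpBound μ q < ⊤) (hVm : Measurable V)
    (hV : ∀ R : ℝ, ∃ C : ℝ, ∀ x, dist o x ≤ R → |V x| ≤ C)
    [IsFiniteMeasure (perturbed μ V)]
    (h_sp : SuperPoincare μ q μ fun r => ENNReal.ofReal (β r)) {δ : ℝ} (hδ : 1 < δ) {n k : ℕ → ℕ}
    (hnk : IsIndexSeq n k) {r : ℝ} (hr : 0 < r) {j : ℕ} (hj : MemD μ q β o V δ n k r j)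
    {f : E → ℝ} (hf : f ∈ core μ q) :
    PoincareBound μ q (perturbed μ V) (ENNReal.ofReal r) (ENNReal.ofReal (2 * δ ^ j)) f := by
  obtain ⟨hj1, hja, hjb⟩ := hj
  have hfm := hf.1
  obtain ⟨B, hB⟩ := hf.2.1
  set ν := perturbed μ V
  have hXtop := lintegral_sq_lt_top (ν := ν) hf
  have hEtop := energy_lt_top (ν := ν) hf
  have hmtop : ∫⁻ x, ENNReal.ofReal |f x| ∂ν < ⊤ := by
    refine (lintegral_mono fun x => ENNReal.ofReal_le_ofReal (hB x)).trans_lt ?_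
    rw [lintegral_const]
    finiteness
  unfold PoincareBound
  obtain ⟨M, hM0, hXM⟩ : ∃ M : ℝ, 0 ≤ M ∧ ∫⁻ x, ENNReal.ofReal (f x ^ 2) ∂ν = ENNReal.ofReal M :=
    ⟨_, ENNReal.toReal_nonneg, (ENNReal.ofReal_toReal hXtop.ne).symm⟩
  obtain ⟨e, he0, hEe⟩ : ∃ e : ℝ, 0 ≤ e ∧ energy μ q ν f = ENNReal.ofReal e :=
    ⟨_, ENNReal.toReal_nonneg, (ENNReal.ofReal_toReal hEtop.ne).symm⟩
  obtain ⟨m, hm0, hmm⟩ : ∃ m : ℝ, 0 ≤ m ∧ ∫⁻ x, ENNReal.ofReal |f x| ∂ν = ENNReal.ofReal m :=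
    ⟨_, ENNReal.toReal_nonneg, (ENNReal.ofReal_toReal hmtop.ne).symm⟩
  rcases hM0.eq_or_lt with hM | hM
  · rw [hXM, ← hM, ENNReal.ofReal_zero]
    exact zero_le
  set s := Real.sqrt δ with hs
  have hsδ : s ^ 2 = δ := Real.sq_sqrt (by linarith)
  have hs1 : 1 < s := by rw [hs, Real.lt_sqrt] <;> linarith
  set H := Real.sqrt M with hH
  have hHpos : 0 < H := Real.sqrt_pos.2 hM
  have hHM : H ^ 2 = M := Real.sq_sqrt hM.le
  obtain ⟨N, hjN, hBN⟩ := exists_level_bound hHpos hs1 B j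
  have hmono := monotone_geometric hHpos.le hs1
  set c := cdelta δ with hc
  have hcpos : 0 < c := cdelta_pos hδ
  set g : ℕ → E → ℝ := fun i x => levelCut (H * s ^ i) (H * s ^ (i + 1)) (f x) with hg
  set X : ℕ → ℝ≥0∞ := fun i => ∫⁻ x, ENNReal.ofReal (g i x ^ 2) ∂ν with hX
  set b : ℕ → ℝ≥0∞ := fun i => 6 * zetaGamma μ q β o V n k i + tZeta μ q β o V δ n k i with hb
  have hgcore : ∀ i, g i ∈ core μ q := fun i => levelCut_mem_core hq0 hf (hmono i.le_succ)
  have hlevel : ∀ i ∈ Finset.Ico j N, X i ≤ 2 * (2 * ENNReal.ofReal (c * r / 16) * energy μ q ν (g i)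
      + b i * ENNReal.ofReal (δ ^ (i + 2)) * ENNReal.ofReal (M * c)) := by
    intro i hi
    have hji : j ≤ i := (Finset.mem_Ico.1 hi).1
    have hai := hja i hji
    have ha1 := hai.trans (min_le_left _ _)
    have ha2 := hai.trans (min_le_right _ _)
    have hatop : 8 * epsval μ β o V (n i) (k i) + tK β o V δ n k i ≠ ⊤ :=
      (ha2.trans_lt ENNReal.ofReal_lt_top).ne
    rw [ENNReal.add_ne_top] at hatop
    have hεtop : epsval μ β o V (n i) (k i) ≠ ⊤ := fun h => hatop.1 (by
      rw [h]; exact ENNReal.mul_top (by norm_num))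
    have hXi : X i ≠ ⊤ := (lintegral_sq_lt_top (ν := ν) (hgcore i)).ne
    have hmain := lintegral_sq_perturbed_le hq hq0 hqb hVm hV h_sp (hgcore i)
      (B := H * s ^ (i + 1) - H * s ^ i) (fun x => by
        rw [abs_of_nonneg (levelCut_nonneg (hmono i.le_succ) _)]
        exact levelCut_le _ _ _) (δ := δ) (by linarith) (i := i) (hnk.pos i (hj1.trans hji)).1
      rfl hεtop (tK := tK β o V δ n k i) rfl hatop.2
    have hcs := sq_lintegral_abs_le (ν := ν) (hgcore i).1
      (A := {x | H * s ^ i < |f x|}) (measurableSet_lt measurable_const (by fun_prop))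
      fun x hx => levelCut_of_le (hmono i.le_succ) (not_lt.1 hx)
    have hch := measure_level_le (ν := ν) hfm hM hXM (s := s) (by linarith) i
    rw [hsδ] at hch
    refine le_two_mul_of_le_add_half hXi (hmain.trans ?_)
    have h1 : 2 * (8 * epsval μ β o V (n i) (k i) + tK β o V δ n k i) *
        (energy μ q ν (g i) + jumpBound μ q * X i) ≤
        2 * ENNReal.ofReal (c * r / 16) * energy μ q ν (g i) + 4⁻¹ * X i := by
      rw [mul_add]
      refine add_le_add (by gcongr) ?_
      rw [← mul_assoc]
      refine mul_le_mul' ?_ le_rfl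
      -- The bound obtained is 1/32, weakened to 1/4 so that it makes 1/2 with the Chebyshev term.
      -- The case λ = 0 is covered by λ⁻¹λ ≤ 1.
      calc _ ≤ 2 * (1 / (64 * jumpBound μ q)) * jumpBound μ q := by gcongr
        _ = 2 * 64⁻¹ * ((jumpBound μ q)⁻¹ * jumpBound μ q) := by
          rw [one_div, ENNReal.mul_inv (Or.inl (by norm_num)) (Or.inl (by norm_num))]
          ring
        _ ≤ 2 * 64⁻¹ * 1 := by gcongr; exact ENNReal.inv_mul_le_one _
        _ ≤ 4⁻¹ := by
          rw [mul_one, ← ENNReal.toReal_le_toReal (by finiteness) (by finiteness)]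
          norm_num
    -- Cauchy–Schwarz on the support of the slice produces its measure, and Chebyshev cancels δ^i.
    have h2 : ENNReal.ofReal (1 / 4 * δ ^ i) * (∫⁻ x, ENNReal.ofReal |g i x| ∂ν) ^ 2 ≤
        4⁻¹ * X i := by
      calc _ ≤ ENNReal.ofReal (1 / 4 * δ ^ i) * (ν {x | H * s ^ i < |f x|} * X i) := by
            gcongr
        _ = 4⁻¹ * (ENNReal.ofReal (δ ^ i) * ν {x | H * s ^ i < |f x|}) * X i := by
            rw [ENNReal.ofReal_mul (by norm_num)]
            have : ENNReal.ofReal (1 / 4) = 4⁻¹ := by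
              rw [one_div, ENNReal.ofReal_inv_of_pos (by norm_num)]
              norm_num
            rw [this]
            ring
        _ ≤ 4⁻¹ * 1 * X i := by gcongr
        _ = _ := by rw [mul_one]
    -- The squared height of the slice is M (√δ-1)² δ^i = M c(δ) δ^{i+2}; this explains c(δ) and the
    -- exponent in `MemD`.
    have h3 : ENNReal.ofReal ((H * s ^ (i + 1) - H * s ^ i) ^ 2) =
        ENNReal.ofReal (δ ^ (i + 2)) * ENNReal.ofReal (M * c) := by
      rw [← ENNReal.ofReal_mul (by positivity)]
      congr 1
      rw [hc, cdelta, ← hs, ← hHM, ← hsδ]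
      field_simp
      ring
    have h4 : (4⁻¹ : ℝ≥0∞) + 4⁻¹ = 2⁻¹ := by
      rw [← ENNReal.toReal_eq_toReal_iff' (by finiteness) (by finiteness),
        ENNReal.toReal_add (by finiteness) (by finiteness)]
      norm_num
    rw [h3]
    refine (add_le_add (add_le_add h1 le_rfl) h2).trans (le_of_eq ?_)
    rw [← h4, hb]
    simp only [zetaGamma, tZeta]
    ring
  have hsum : ∑ i ∈ Finset.Ico j N, X i ≤ ENNReal.ofReal (c * r / 4 * e + M * c / 128) := by
    have hbs : ∑ i ∈ Finset.Ico j N, b i * ENNReal.ofReal (δ ^ (i + 2)) ≤ 1 / 256 := by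
      rw [Finset.sum_Ico_eq_sum_range]
      exact (ENNReal.sum_le_tsum _).trans hjb
    have hes := sum_energy_levelCut_le (μ := μ) hq0 ν hmono hjN f
    calc _ ≤ ∑ i ∈ Finset.Ico j N, 2 * (2 * ENNReal.ofReal (c * r / 16) * energy μ q ν (g i)
          + b i * ENNReal.ofReal (δ ^ (i + 2)) * ENNReal.ofReal (M * c)) := Finset.sum_le_sum hlevel
      _ = 2 * (2 * ENNReal.ofReal (c * r / 16) * ∑ i ∈ Finset.Ico j N, energy μ q ν (g i)
          + (∑ i ∈ Finset.Ico j N, b i * ENNReal.ofReal (δ ^ (i + 2))) * ENNReal.ofReal (M * c)) := by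
          rw [← Finset.mul_sum, Finset.sum_add_distrib, Finset.mul_sum, Finset.sum_mul]
      _ ≤ 2 * (2 * ENNReal.ofReal (c * r / 16) * ENNReal.ofReal e
          + 1 / 256 * ENNReal.ofReal (M * c)) := by
          gcongr
          exact hes.trans_eq hEe
      _ = _ := by
          have h256 : (1 / 256 : ℝ≥0∞) = ENNReal.ofReal (1 / 256) := by
            rw [one_div, one_div, ENNReal.ofReal_inv_of_pos (by norm_num)]
            norm_num
          have h2 : (2 : ℝ≥0∞) = ENNReal.ofReal 2 := by simp
          rw [h256, h2, ← ENNReal.ofReal_mul (by positivity), ← ENNReal.ofReal_mul (by positivity),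
            ← ENNReal.ofReal_mul (by positivity), ← ENNReal.ofReal_add (by positivity)
            (by positivity), ← ENNReal.ofReal_mul (by positivity)]
          congr 1
          ring
  have hfin := lintegral_sq_le_sum_levelCut (ν := ν) hfm hHpos.le hs1 hjN
    fun x => (hB x).trans hBN
  rw [hXM, hmm, hEe, ← ENNReal.ofReal_pow hm0, ← ENNReal.ofReal_mul hr.le,
    ← ENNReal.ofReal_mul (by positivity), ← ENNReal.ofReal_add (by positivity) (by positivity)]
  rw [hXM, hmm] at hfin
  have hs2 : 0 < s - 1 := by linarith
  replace hfin := hfin.trans (add_le_add le_rfl (mul_le_mul' le_rfl hsum))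
  rw [← ENNReal.ofReal_mul (by positivity), ← ENNReal.ofReal_mul (by positivity),
    ← ENNReal.ofReal_add (by positivity) (by positivity),
    ENNReal.ofReal_le_ofReal_iff (by positivity)] at hfin
  refine ENNReal.ofReal_le_ofReal ?_
  -- The factor c(δ) offsets the blow-up of the slicing constant as δ → 1: the product equals
  -- 10(s-1)/s³.
  have hcs : 10 * s / (s - 1) * c ≤ 5 / 2 := by
    have : 10 * s / (s - 1) * c = 10 * (s - 1) / s ^ 3 := by
      rw [hc, cdelta, ← hs, ← hsδ]
      field_simp
    rw [this, div_le_iff₀ (by positivity)]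
    nlinarith [sq_nonneg (s - 2), mul_nonneg hs2.le (sq_nonneg s)]
  have hY : 10 * s / (s - 1) * (c * r / 4 * e + M * c / 128) ≤
      5 / 2 * (r / 4 * e + M / 128) := by
    calc _ = 10 * s / (s - 1) * c * (r / 4 * e + M / 128) := by ring
      _ ≤ _ := by gcongr
  -- Young's inequality. The multiples of M on the right total 5/16 + 5/256, which leaves enough on
  -- the left for the constants r and 2δ^j.
  have hhm : H * s ^ j * m ≤ M / 4 + δ ^ j * m ^ 2 := by
    have e1 : δ ^ j = (s ^ j) ^ 2 := by rw [← hsδ]; ring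
    rw [e1, ← hHM]
    nlinarith [sq_nonneg (H / 2 - s ^ j * m)]
  have hre : 0 ≤ r * e := by positivity
  have hdm : 0 ≤ δ ^ j * m ^ 2 := by positivity
  nlinarith

theorem superPoincare_perturbed [IsFiniteMeasure μ] (hq : Measurable (Function.uncurry q))
    (hq0 : ∀ x y, 0 ≤ q x y) (hqb : jumpBound μ q < ⊤) (hVm : Measurable V)
    (hV : ∀ R : ℝ, ∃ C : ℝ, ∀ x, dist o x ≤ R → |V x| ≤ C)
    [IsProbabilityMeasure (perturbed μ V)]
    (h_sp : SuperPoincare μ q μ fun r => ENNReal.ofReal (β r)) {δ : ℝ} (hδ : 1 < δ)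
    (h : ∃ n k : ℕ → ℕ, MemI μ q β o V δ n k) :
    SuperPoincare μ q (perturbed μ V) (betaV μ q β o V δ) := by
  intro r hr f hf
  obtain ⟨n₁, k₁, h₁⟩ := h
  have hm : (∫⁻ x, ENNReal.ofReal |f x| ∂(perturbed μ V)) ≠ ⊤ := by
    rw [lintegral_abs_eq_eLpNorm]
    exact (hf.1.mono_exponent (by norm_num)).2.ne
  unfold PoincareBound
  rw [add_comm]
  refine le_mul_add_of_forall_gt (betaV_lt_top hδ hqb h₁ hr).ne (by finiteness) fun t ht => ?_
  simp only [betaV, iInf_lt_iff] at ht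
  obtain ⟨n, k, hI, j, hj, hjt⟩ := ht
  have := poincareBound_of_core (absolutelyContinuous_perturbed hVm) hq hq0
    ENNReal.ofReal_ne_top ENNReal.ofReal_ne_top
    (fun g hg => poincareBound_of_memD hq hq0 hqb hVm hV h_sp hδ hI.1 hr hj hg) hf
  rw [add_comm]
  exact this.trans (by gcongr)

end Super

/-! ### The defective Poincaré inequality: estimates over rings. -/

section Defective

variable {E : Type*} [MetricSpace E] [MeasurableSpace E] {μ : Measure E}
  {q : E → E → ℝ} {o : E} {V : E → ℝ} {β : ℝ → ℝ}

/-- The weight `exp (inf_{ρ ≤ R} V)` with `R = max (ρ(x)) (n₀ + 3)`. -/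
noncomputable def infWeight {E : Type*} [MetricSpace E] (o : E) (V : E → ℝ) (n₀ : ℕ) (x : E) : ℝ≥0∞ :=
  ENNReal.ofReal (Real.exp (infBall o V (max (dist o x) (n₀ + 3))))

theorem le_infWeight {E : Type*} [MetricSpace E] {o : E} {V : E → ℝ}
    (hV : ∀ R : ℝ, ∃ C : ℝ, ∀ x, dist o x ≤ R → |V x| ≤ C) {n₀ : ℕ} {R : ℝ}
    {x : E} (h : dist o x ≤ R) (h' : (n₀ : ℝ) + 3 ≤ R) :
    ENNReal.ofReal (Real.exp (infBall o V R)) ≤ infWeight o V n₀ x := by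
  unfold infWeight
  gcongr
  exact infBall_anti hV (le_max_of_le_left dist_nonneg) (max_le h h')

theorem infWeight_le {E : Type*} [MetricSpace E] {o : E} {V : E → ℝ}
    (hV : ∀ R : ℝ, ∃ C : ℝ, ∀ x, dist o x ≤ R → |V x| ≤ C) (n₀ : ℕ) (x : E) :
    infWeight o V n₀ x ≤ ENNReal.ofReal (Real.exp (V x)) := by
  unfold infWeight
  gcongr
  exact infBall_le hV (le_max_left _ _)

theorem tendsto_measure_ball_compl [OpensMeasurableSpace E] (ν : Measure E) [IsFiniteMeasure ν]
    (o : E) : Tendsto (fun m : ℕ => ν {x | (m : ℝ) ≤ dist o x}) atTop (𝓝 0) := by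
  have h := tendsto_measure_iInter_atTop (μ := ν) (s := fun m : ℕ => {x : E | (m : ℝ) ≤ dist o x})
    (fun m => (measurableSet_le measurable_const measurable_dist_right).nullMeasurableSet)
    (fun a b hab x hx => le_trans (by exact_mod_cast hab : (a : ℝ) ≤ b) hx)
    ⟨0, measure_ne_top _ _⟩
  have he : (⋂ m : ℕ, {x : E | (m : ℝ) ≤ dist o x}) = ∅ := by
    rw [Set.eq_empty_iff_forall_notMem]
    intro x hx
    obtain ⟨m, hm⟩ := exists_nat_gt (dist o x)
    exact (not_le.2 hm) (Set.mem_iInter.1 hx m)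
  rwa [he, measure_empty] at h

variable [BorelSpace E]

theorem measurable_infWeight (hV : ∀ R : ℝ, ∃ C : ℝ, ∀ x, dist o x ≤ R → |V x| ≤ C) (n₀ : ℕ) :
    Measurable (infWeight o V n₀) := by
  have h : Antitone fun t : ℝ => infBall o V (max t (n₀ + 3)) := fun a b hab =>
    infBall_anti hV (le_max_of_le_right (by positivity)) (max_le_max hab le_rfl)
  have h' : Measurable fun x : E => infBall o V (max (dist o x) (n₀ + 3)) :=
    h.measurable.comp measurable_dist_right
  unfold infWeight
  fun_prop

/-- The estimate of `μ_V(g²)` on one ring. The radius beyond which jumps count as long is adapted to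
the measure of the support of `g`. -/
theorem lintegral_sq_ring_le [IsFiniteMeasure μ] (hq : Measurable (Function.uncurry q))
    (hq0 : ∀ x y, 0 ≤ q x y) (hqb : jumpBound μ q < ⊤)
    (hV : ∀ R : ℝ, ∃ C : ℝ, ∀ x, dist o x ≤ R → |V x| ≤ C)
    (h_sp : SuperPoincare μ q μ fun r => ENNReal.ofReal (β r)) {g : E → ℝ} (hg : g ∈ core μ q)
    {b : ℝ} (hb : ∀ x, |g x| ≤ b) {n k n₀ m : ℕ} (hk : 1 ≤ k) (hn : n ≤ n₀) (hm : n₀ ≤ m)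
    {C : ℝ≥0∞} (hC : epsval μ β o V n k ≤ C) (hC' : C ≠ ⊤)
    (hp : μ {x | g x * ring n₀ m (dist o x) ≠ 0} ≤ μ {x | (m : ℝ) - 1 < dist o x}) :
    ENNReal.ofReal (Real.exp (supBall o V (m + 2))) *
      ∫⁻ x, ENNReal.ofReal ((g x * ring n₀ m (dist o x)) ^ 2) ∂μ ≤
      2 * ∫⁻ x, 2 * C * infWeight o V n₀ x *
        nearGrad μ q (fun z => ring n₀ m (dist o z)) g x ∂μ
      + 2 * ∫⁻ x, 2 * C * infWeight o V n₀ x *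
        (ENNReal.ofReal (g x ^ 2) * carre μ q (fun z => ring n₀ m (dist o z)) x) ∂μ
      + 2 * C * jumpBound μ q * ENNReal.ofReal (b ^ 2) *
        ∫⁻ x in {x | g x * ring n₀ m (dist o x) ≠ 0}, infWeight o V n₀ x ∂μ := by
  have hgm := hg.1
  have hd : Measurable fun x : E => dist o x := measurable_dist_right
  set φ : E → ℝ := fun x => ring n₀ m (dist o x) with hφ
  have hφm : Measurable φ := (measurable_ring n₀ m).comp hd
  have hφ0 : ∀ x, (m : ℝ) + 2 ≤ dist o x → φ x = 0 := fun x hx => ring_eq_zero_of_ge hx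
  set p := μ {x | g x * φ x ≠ 0} with hpdef
  have hS : MeasurableSet {x | g x * φ x ≠ 0} :=
    ((hgm.mul hφm) (measurableSet_singleton 0)).compl
  rcases eq_or_ne p 0 with hp0 | hp0
  · have hae : ∀ᵐ x ∂μ, g x * φ x = 0 := by
      rw [ae_iff]
      exact hp0
    have : ∫⁻ x, ENNReal.ofReal ((g x * φ x) ^ 2) ∂μ = 0 := by
      rw [lintegral_eq_zero_iff (by fun_prop)]
      filter_upwards [hae] with x hx
      simp [hx]
    rw [this, mul_zero]
    exact zero_le
  -- The adapted radius: tails at l - 1 and at l bracket p. The lower bracket bounds the constant in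
  -- (sp) by `tailInv` at l; the upper one bounds the mass of far starting points.
  obtain ⟨l, hl1, hl2, hl3⟩ : ∃ l : ℕ, m ≤ l ∧ p ≤ μ {x | (l : ℝ) - 1 < dist o x} ∧
      μ {x | (l : ℝ) < dist o x} ≤ p := by
    have hex : ∃ l : ℕ, μ {x | ((m + l : ℕ) : ℝ) - 1 < dist o x} < p := by
      have h1 := (tendsto_order.1 (tendsto_measure_ball_compl μ o)).2 p (pos_iff_ne_zero.2 hp0)
      obtain ⟨a, ha⟩ := eventually_atTop.1 h1
      refine ⟨a + 1, (measure_mono fun x hx => ?_).trans_lt (ha a le_rfl)⟩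
      have hx' : ((m + (a + 1) : ℕ) : ℝ) - 1 < dist o x := hx
      have : (0 : ℝ) ≤ m := Nat.cast_nonneg m
      push_cast at hx'
      exact (by linarith : (a : ℝ) ≤ dist o x)
    classical
    have h0 := Nat.find_spec hex
    have hmin := fun j => Nat.find_min hex (m := j)
    set l := Nat.find hex
    have hl : l ≠ 0 := by
      intro h
      rw [h, add_zero] at h0
      exact absurd hp (not_le.2 h0)
    refine ⟨m + (l - 1), by omega, not_lt.1 (hmin (l - 1) (by omega)), ?_⟩
    have e : ((m + (l - 1) : ℕ) : ℝ) = ((m + l : ℕ) : ℝ) - 1 := by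
      have : m + l = m + (l - 1) + 1 := by omega
      rw [this]
      push_cast
      ring
    rw [e]
    exact h0.le
  have hτ : tailInv μ β o l * ENNReal.ofReal (Real.exp (Kval o V l k)) ≤ C :=
    le_trans (le_iSup₂ (f := fun m (_ : n ≤ m) =>
        tailInv μ β o m * ENNReal.ofReal (Real.exp (Kval o V m k))) l (by omega)) hC
  have hτtop : tailInv μ β o l ≠ ⊤ := by
    intro h
    rw [h, ENNReal.top_mul (by simp [Real.exp_pos])] at hτ
    exact hC' (top_le_iff.1 hτ)
  have hσ : betaInv β (1 / (2 * p)) ≤ tailInv μ β o l := betaInv_anti β (by gcongr)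
  have hloc := lintegral_sq_le_of_measure_support_le h_sp
    (mul_ring_mem_core (o := o) hq hq0 hqb n₀ m hg) le_rfl (ne_top_of_le_ne_top hτtop hσ)
  set σ := betaInv β (1 / (2 * p))
  have hml : (m : ℝ) ≤ l := by exact_mod_cast hl1
  have hnm : (n₀ : ℝ) ≤ m := by exact_mod_cast hm
  have hk' : (1 : ℝ) ≤ k := by exact_mod_cast hk
  have hm0 : (0 : ℝ) ≤ m := Nat.cast_nonneg m
  set c := 2 * σ * ENNReal.ofReal (Real.exp (supBall o V (m + 2))) with hc
  -- The radius l + k + 2 in K_{l,k} is at least l + 3 because k ≥ 1, so the infimum over the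
  -- smaller ball may be used.
  have hcC : c ≤ 2 * C * ENNReal.ofReal (Real.exp (infBall o V (l + 3))) := by
    have h1 : supBall o V (m + 2) ≤ supBall o V (l + 2) :=
      supBall_mono hV (by linarith) (by linarith)
    have h2 : infBall o V (l + k + 2) ≤ infBall o V (l + 3) :=
      infBall_anti hV (by linarith) (by linarith)
    calc c ≤ 2 * (tailInv μ β o l * ENNReal.ofReal (Real.exp (Kval o V l k)) *
          ENNReal.ofReal (Real.exp (infBall o V (l + 3)))) := by
          rw [hc, mul_assoc 2, mul_assoc (tailInv μ β o l),
            ← ENNReal.ofReal_mul (Real.exp_pos _).le, ← Real.exp_add]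
          gcongr
          rw [Kval]
          linarith
      _ ≤ _ := by
          rw [mul_assoc 2 C]
          gcongr
  have hwm : Measurable fun x => 2 * C * infWeight o V n₀ x := by
    have := measurable_infWeight hV n₀ (o := o)
    fun_prop
  have hA : MeasurableSet {x : E | (l : ℝ) + 3 < dist o x} := measurableSet_lt measurable_const hd
  have hsplit := mul_energy_mul_le (μ := μ) hq hq0 hφm hgm hA (c := c)
    (fun x hx => hφ0 x (by
      have h1 : (l : ℝ) + 3 < dist o x := hx
      linarith)) hwm (fun x hx => hcC.trans (by
      have h1 : dist o x ≤ l + 3 := not_lt.1 hx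
      gcongr
      exact le_infWeight hV h1 (by linarith)))
  calc ENNReal.ofReal (Real.exp (supBall o V (m + 2))) *
        ∫⁻ x, ENNReal.ofReal ((g x * φ x) ^ 2) ∂μ
      ≤ ENNReal.ofReal (Real.exp (supBall o V (m + 2))) *
        (2 * σ * energy μ q μ fun x => g x * φ x) := by gcongr
    _ = c * energy μ q μ fun x => g x * φ x := by rw [hc]; ring
    _ ≤ _ := hsplit
    _ ≤ _ := by
      refine add_le_add le_rfl ?_
      -- Such jumps end in {ρ < m+2} with m ≤ l, so they have length at least 1 and their rate is
      -- bounded by λ from every starting point.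
      have hfar : ∫⁻ x in {x | (l : ℝ) + 3 < dist o x}, farTerm μ q (fun z => g z * φ z) x ∂μ ≤
          ENNReal.ofReal (b ^ 2) * jumpBound μ q * p := by
        calc _ ≤ ∫⁻ x in {x | (l : ℝ) + 3 < dist o x}, ENNReal.ofReal (b ^ 2) * jumpBound μ q ∂μ := by
              refine setLIntegral_mono' hA fun x hx => ?_
              have h4 : (l : ℝ) + 3 < dist o x := hx
              have hqx : Measurable (q x) := hq.of_uncurry_left
              have hdx : Measurable fun y : E => dist x y := measurable_dist_right
              refine le_trans ?_ (mul_le_mul' le_rfl (le_iSup (fun x =>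
                ∫⁻ y, ENNReal.ofReal (min 1 (dist x y ^ 2) * q x y) ∂μ) x))
              rw [← lintegral_const_mul _ (by fun_prop)]
              refine lintegral_mono fun y => ?_
              by_cases hy : φ y = 0
              · simp [hy]
              have h1 : dist o y < m + 2 := by
                by_contra h
                exact hy (hφ0 y (not_lt.1 h))
              have h5 := dist_triangle o y x
              rw [dist_comm y x] at h5
              have h6 : 1 ≤ dist x y := by linarith
              rw [min_eq_left (one_le_pow₀ h6), one_mul, ENNReal.ofReal_mul (sq_nonneg _)]
              refine mul_le_mul' (ofReal_sq_le_of_abs_le ?_) le_rfl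
              rw [abs_mul, abs_of_nonneg (ring_nonneg _ _ _)]
              exact (mul_le_of_le_one_right (abs_nonneg _) (ring_le_one _ _ _)).trans (hb y)
          _ = ENNReal.ofReal (b ^ 2) * jumpBound μ q * μ {x | (l : ℝ) + 3 < dist o x} :=
              setLIntegral_const _ _
          _ ≤ _ := by
              gcongr
              refine (measure_mono fun x hx => ?_).trans hl3
              have h4 : (l : ℝ) + 3 < dist o x := hx
              exact (by linarith : (l : ℝ) < dist o x)
      -- Since p is the measure of the support and l + 3 is beyond it, the far contribution becomes
      -- a weighted measure of the support, free of l.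
      have hint : ENNReal.ofReal (Real.exp (infBall o V (l + 3))) * p ≤
          ∫⁻ x in {x | g x * φ x ≠ 0}, infWeight o V n₀ x ∂μ := by
        rw [hpdef, ← setLIntegral_const]
        refine setLIntegral_mono' hS fun x hx => ?_
        have h1 : dist o x < m + 2 := by
          by_contra h
          exact hx (by rw [hφ0 x (not_lt.1 h), mul_zero])
        exact le_infWeight hV (by linarith) (by linarith)
      calc c * _ ≤ 2 * C * ENNReal.ofReal (Real.exp (infBall o V (l + 3))) *
            (ENNReal.ofReal (b ^ 2) * jumpBound μ q * p) := mul_le_mul' hcC hfar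
        _ = 2 * C * jumpBound μ q * ENNReal.ofReal (b ^ 2) *
            (ENNReal.ofReal (Real.exp (infBall o V (l + 3))) * p) := by ring
        _ ≤ _ := by gcongr

/-- The weighted sum over all rings below a radius `M`. -/
noncomputable def ringSum (μ : Measure E) (o : E) (V : E → ℝ) (n₀ M : ℕ) (g : E → ℝ) : ℝ≥0∞ :=
  ∑ m ∈ Finset.Ico n₀ M, ENNReal.ofReal (Real.exp (supBall o V (m + 2))) *
    ∫⁻ x, ENNReal.ofReal ((g x * ring n₀ m (dist o x)) ^ 2) ∂μ

/-- The smallness assumption concerns only the innermost cutoff, which covers the whole ball; the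
others vanish on {ρ ≤ m-1} by construction. The factor 6 is 2 times the maximal overlap 3. -/
theorem ringSum_le [IsFiniteMeasure μ] (hq : Measurable (Function.uncurry q))
    (hq0 : ∀ x y, 0 ≤ q x y) (hqb : jumpBound μ q < ⊤) (hVm : Measurable V)
    (hV : ∀ R : ℝ, ∃ C : ℝ, ∀ x, dist o x ≤ R → |V x| ≤ C)
    (h_sp : SuperPoincare μ q μ fun r => ENNReal.ofReal (β r)) {g : E → ℝ} (hg : g ∈ core μ q)
    {b : ℝ} (hb : ∀ x, |g x| ≤ b) {n k n₀ M : ℕ} (hk : 1 ≤ k) (hn : n ≤ n₀) (hM : n₀ ≤ M)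
    {C : ℝ≥0∞} (hC : epsval μ β o V n k ≤ C) (hC' : C ≠ ⊤)
    (hp : μ {x | g x * ring n₀ n₀ (dist o x) ≠ 0} ≤ μ {x | (n₀ : ℝ) - 1 < dist o x}) :
    ringSum μ o V n₀ M g ≤ 8 * C * energy μ q (perturbed μ V) g
      + 16 * C * jumpBound μ q * ∫⁻ x, infWeight o V n₀ x * ENNReal.ofReal (g x ^ 2) ∂μ
      + 6 * C * jumpBound μ q * (ENNReal.ofReal (b ^ 2) *
        ∫⁻ x in {x | g x ≠ 0}, infWeight o V n₀ x ∂μ) := by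
  have hgm := hg.1
  have hw := measurable_infWeight hV n₀ (o := o)
  have hr : ∀ m, Measurable fun x : E => ring n₀ m (dist o x) := fun m =>
    (measurable_ring n₀ m).comp measurable_dist_right
  have step1 : ∀ m ∈ Finset.Ico n₀ M, _ := fun m hm =>
    lintegral_sq_ring_le hq hq0 hqb hV h_sp hg hb hk hn (Finset.mem_Ico.1 hm).1 hC hC' (by
      rcases (Finset.mem_Ico.1 hm).1.eq_or_lt with h | h
      · rw [← h]; exact hp
      · refine measure_mono fun x hx => ?_
        by_contra h'
        exact hx (by rw [ring_eq_zero_of_le h (not_lt.1 h'), mul_zero]))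
  refine (Finset.sum_le_sum step1).trans ?_
  rw [Finset.sum_add_distrib, Finset.sum_add_distrib, ← Finset.mul_sum, ← Finset.mul_sum,
    ← Finset.mul_sum]
  refine add_le_add (add_le_add ?_ ?_) ?_
  · calc _ ≤ 2 * ∫⁻ x, ∑ m ∈ Finset.Ico n₀ M, 2 * C * infWeight o V n₀ x *
            nearGrad μ q (fun z => ring n₀ m (dist o z)) g x ∂μ := by
          gcongr; exact sum_lintegral_le_lintegral_sum _ _
      _ ≤ 2 * ∫⁻ x, 4 * C * ENNReal.ofReal (Real.exp (V x)) * carre μ q g x ∂μ := by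
          refine mul_le_mul' le_rfl (lintegral_mono fun x => ?_)
          rw [← Finset.mul_sum]
          calc _ ≤ 2 * C * ENNReal.ofReal (Real.exp (V x)) * (2 * carre μ q g x) :=
                mul_le_mul' (mul_le_mul' le_rfl (infWeight_le hV n₀ x))
                  (sum_nearGrad_ring_le hq hq0 n₀ hM hgm x)
            _ = _ := by ring
      _ = _ := by rw [lintegral_exp_mul_carre hq hVm hgm]; ring
  · calc _ ≤ 2 * ∫⁻ x, ∑ m ∈ Finset.Ico n₀ M, 2 * C * infWeight o V n₀ x *
            (ENNReal.ofReal (g x ^ 2) * carre μ q (fun z => ring n₀ m (dist o z)) x) ∂μ := by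
          gcongr; exact sum_lintegral_le_lintegral_sum _ _
      _ ≤ 2 * ∫⁻ x, 8 * C * jumpBound μ q *
            (infWeight o V n₀ x * ENNReal.ofReal (g x ^ 2)) ∂μ := by
          refine mul_le_mul' le_rfl (lintegral_mono fun x => ?_)
          rw [← Finset.mul_sum, ← Finset.mul_sum]
          calc _ ≤ 2 * C * infWeight o V n₀ x * (ENNReal.ofReal (g x ^ 2) * (4 * jumpBound μ q)) := by
                gcongr; exact sum_carre_ring_le hq hq0 n₀ hM x
            _ = _ := by ring
      _ = _ := by rw [lintegral_const_mul _ (by fun_prop)]; ring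
  · have hS : ∀ m, MeasurableSet {x | g x * ring n₀ m (dist o x) ≠ 0} := fun m =>
      ((hgm.mul (hr m)) (measurableSet_singleton 0)).compl
    have hS' : MeasurableSet {x | g x ≠ 0} := (hgm (measurableSet_singleton 0)).compl
    have h3 : ∑ m ∈ Finset.Ico n₀ M, ∫⁻ x in {x | g x * ring n₀ m (dist o x) ≠ 0},
        infWeight o V n₀ x ∂μ ≤ 3 * ∫⁻ x in {x | g x ≠ 0}, infWeight o V n₀ x ∂μ := by
      simp only [← lintegral_indicator (hS _)]
      rw [← lintegral_indicator hS', ← lintegral_const_mul _ (hw.indicator hS')]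
      refine (sum_lintegral_le_lintegral_sum _ _).trans (lintegral_mono fun x => ?_)
      by_cases hx : g x = 0
      · simp [hx]
      · rw [Set.indicator_of_mem (show x ∈ {x | g x ≠ 0} from hx)]
        have : ∀ m, {x | g x * ring n₀ m (dist o x) ≠ 0}.indicator (infWeight o V n₀) x =
            if ring n₀ m (dist o x) ≠ 0 then infWeight o V n₀ x else 0 := fun m => by
          simp [Set.indicator_apply, hx]
        simp only [this]
        rw [← Finset.sum_filter, Finset.sum_const, nsmul_eq_mul]
        gcongr
        exact_mod_cast card_ring_ne_zero_le n₀ M (dist_nonneg (x := o) (y := x))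
    calc _ ≤ 2 * C * jumpBound μ q * ENNReal.ofReal (b ^ 2) *
          (3 * ∫⁻ x in {x | g x ≠ 0}, infWeight o V n₀ x ∂μ) := by gcongr
      _ = _ := by ring

theorem exists_ring_eq_one {E : Type*} [MetricSpace E] {o : E} {n₀ M : ℕ} (hM : n₀ < M) {x : E}
    (hx : dist o x < M) :
    ∃ m ∈ Finset.Ico n₀ M, (m : ℝ) ≤ max (dist o x) n₀ ∧ ring n₀ m (dist o x) = 1 := by
  have h1 : ⌊dist o x⌋₊ < M := (Nat.floor_lt dist_nonneg).2 hx
  have h2 := Nat.floor_le (dist_nonneg (x := o) (y := x))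
  have h3 := Nat.lt_floor_add_one (dist o x)
  rcases le_total n₀ ⌊dist o x⌋₊ with h | h
  · exact ⟨_, Finset.mem_Ico.2 ⟨h, h1⟩, le_max_of_le_left h2, ring_eq_one h (Or.inr h2) h3.le⟩
  · refine ⟨n₀, Finset.mem_Ico.2 ⟨le_rfl, hM⟩, le_max_right _ _,
      ring_eq_one le_rfl (Or.inl le_rfl) ?_⟩
    have : (⌊dist o x⌋₊ : ℝ) ≤ n₀ := by exact_mod_cast h
    linarith

/-- The gain e^{-L} comes from oscillation: `infWeight` is at most exp of the infimum over the ball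
of radius n₀, while every ring weight is at least exp of the supremum over that ball. -/
theorem lintegral_infWeight_mul_sq_le (hVm : Measurable V)
    (hV : ∀ R : ℝ, ∃ C : ℝ, ∀ x, dist o x ≤ R → |V x| ≤ C) {g : E → ℝ} (hg : Measurable g)
    {n₀ M : ℕ} (hM : n₀ < M) {L : ℝ} (hL : infBall o V n₀ + L ≤ supBall o V n₀) :
    ∫⁻ x, infWeight o V n₀ x * ENNReal.ofReal (g x ^ 2) ∂μ ≤
      ENNReal.ofReal (Real.exp (-L)) * ringSum μ o V n₀ M g
      + ∫⁻ x in {x | (M : ℝ) ≤ dist o x}, ENNReal.ofReal (g x ^ 2) ∂(perturbed μ V) := by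
  have hd : Measurable fun x : E => dist o x := measurable_dist_right
  have hr : ∀ m, Measurable fun x : E => ring n₀ m (dist o x) := fun m =>
    (measurable_ring n₀ m).comp hd
  have hw := measurable_infWeight hV n₀ (o := o)
  have hA : MeasurableSet {x : E | (M : ℝ) ≤ dist o x} := measurableSet_le measurable_const hd
  have h1 : ringSum μ o V n₀ M g = ∫⁻ x, ∑ m ∈ Finset.Ico n₀ M,
      ENNReal.ofReal (Real.exp (supBall o V (m + 2))) *
        ENNReal.ofReal ((g x * ring n₀ m (dist o x)) ^ 2) ∂μ := by
    rw [lintegral_finsetSum _ fun m _ => by have := hr m; fun_prop]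
    refine Finset.sum_congr rfl fun m _ => ?_
    have := hr m
    rw [lintegral_const_mul _ (by fun_prop)]
  rw [h1, ← lintegral_indicator hA, lintegral_perturbed hVm ((by fun_prop : Measurable fun x =>
    ENNReal.ofReal (g x ^ 2)).indicator hA), ← lintegral_const_mul _
      (Finset.measurable_fun_sum _ fun m _ => by have := hr m; fun_prop),
    ← lintegral_add_left (Measurable.const_mul
      (Finset.measurable_fun_sum _ fun m _ => by have := hr m; fun_prop) _)]
  refine lintegral_mono fun x => ?_
  rcases le_or_gt (M : ℝ) (dist o x) with hx | hx
  · refine le_add_left ?_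
    rw [Set.indicator_of_mem (show x ∈ {x : E | (M : ℝ) ≤ dist o x} from hx)]
    exact mul_le_mul' (infWeight_le hV n₀ x) le_rfl
  · refine le_add_right ?_
    obtain ⟨m, hm, hmx, h1⟩ := exists_ring_eq_one hM hx
    refine le_trans ?_ (mul_le_mul' le_rfl (Finset.single_le_sum (fun _ _ => zero_le) hm))
    rw [h1, mul_one, ← mul_assoc, ← ENNReal.ofReal_mul (Real.exp_pos _).le, ← Real.exp_add]
    have hn : (n₀ : ℝ) ≤ m := by exact_mod_cast (Finset.mem_Ico.1 hm).1
    have hn0 : (0 : ℝ) ≤ n₀ := Nat.cast_nonneg _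
    unfold infWeight
    gcongr
    have h2 : infBall o V (max (dist o x) (n₀ + 3)) ≤ infBall o V n₀ :=
      infBall_anti hV hn0 (le_max_of_le_right (by linarith))
    have h3 : supBall o V n₀ ≤ supBall o V (m + 2) := supBall_mono hV hn0 (by linarith)
    linarith

theorem ringSum_lt_top [IsFiniteMeasure μ] (hq : Measurable (Function.uncurry q))
    (hq0 : ∀ x y, 0 ≤ q x y) (hqb : jumpBound μ q < ⊤) {g : E → ℝ} (hg : g ∈ core μ q)
    (n₀ M : ℕ) : ringSum μ o V n₀ M g < ⊤ := by
  refine ENNReal.sum_lt_top.2 fun m _ => ENNReal.mul_lt_top ENNReal.ofReal_lt_top ?_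
  exact lintegral_sq_lt_top (mul_ring_mem_core (o := o) hq hq0 hqb n₀ m hg)

end Defective

/-! ### The defective Poincaré inequality: summation over levels and conclusion. -/

section Defective

variable {E : Type*} [MetricSpace E] [MeasurableSpace E] [BorelSpace E] {μ : Measure E}
  {q : E → E → ℝ} {o : E} {V : E → ℝ} {β : ℝ → ℝ}

theorem sum_level_weight_le (hVm : Measurable V)
    (hV : ∀ R : ℝ, ∃ C : ℝ, ∀ x, dist o x ≤ R → |V x| ≤ C) {f : E → ℝ} (hf : Measurable f)
    {H : ℝ} (hH : 0 < H) (n₀ j l : ℕ) :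
    ∑ i ∈ Finset.Ico j (j + l), ENNReal.ofReal ((H * 2 ^ i) ^ 2) *
        ∫⁻ x in {x | levelCut (H * 2 ^ i) (H * 2 ^ (i + 1)) (f x) ≠ 0}, infWeight o V n₀ x ∂μ ≤
      ENNReal.ofReal (H * 2 ^ j) * ∫⁻ x, ENNReal.ofReal |f x| ∂(perturbed μ V)
      + 4 * ∑ i ∈ Finset.Ico j (j + l), ∫⁻ x, infWeight o V n₀ x *
        ENNReal.ofReal (levelCut (H * 2 ^ i) (H * 2 ^ (i + 1)) (f x) ^ 2) ∂μ := by
  have hw := measurable_infWeight hV n₀ (o := o)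
  have hmono := monotone_geometric hH.le (by norm_num : (1 : ℝ) < 2)
  have hS : ∀ i : ℕ, MeasurableSet {x | levelCut (H * 2 ^ i) (H * 2 ^ (i + 1)) (f x) ≠ 0} :=
    fun i => (((measurable_levelCut _ _).comp hf) (measurableSet_singleton 0)).compl
  have hgt : ∀ (i : ℕ) (x : E), levelCut (H * 2 ^ i) (H * 2 ^ (i + 1)) (f x) ≠ 0 →
      H * 2 ^ i < |f x| := fun i x hx => by
    by_contra h
    exact hx (levelCut_of_le (hmono i.le_succ) (not_lt.1 h))
  have hfirst : ENNReal.ofReal ((H * 2 ^ j) ^ 2) *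
      ∫⁻ x in {x | levelCut (H * 2 ^ j) (H * 2 ^ (j + 1)) (f x) ≠ 0}, infWeight o V n₀ x ∂μ ≤
      ENNReal.ofReal (H * 2 ^ j) * ∫⁻ x, ENNReal.ofReal |f x| ∂(perturbed μ V) := by
    rw [← lintegral_indicator (hS j), lintegral_perturbed hVm (by fun_prop),
      ← lintegral_const_mul _ (hw.indicator (hS j)), ← lintegral_const_mul _ (by fun_prop)]
    refine lintegral_mono fun x => ?_
    by_cases hx : levelCut (H * 2 ^ j) (H * 2 ^ (j + 1)) (f x) = 0
    · simp [hx]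
    · rw [Set.indicator_of_mem (show x ∈ {x | levelCut (H * 2 ^ j) (H * 2 ^ (j + 1)) (f x) ≠ 0}
        from hx)]
      have h1 := hgt j x hx
      calc _ ≤ ENNReal.ofReal (H * 2 ^ j * |f x|) * ENNReal.ofReal (Real.exp (V x)) := by
            refine mul_le_mul' (ENNReal.ofReal_le_ofReal ?_) (infWeight_le hV n₀ x)
            rw [sq]
            gcongr
        _ = _ := by rw [ENNReal.ofReal_mul (by positivity)]; ring
  -- Where a slice is non-zero, the slice below has its full height H·2^i, so the height squared at
  -- level i+1 is 4 times the square of that slice. Only the lowest level lacks a predecessor and is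
  -- charged to the L¹ norm.
  have hnext : ∀ i : ℕ, ENNReal.ofReal ((H * 2 ^ (i + 1)) ^ 2) *
      ∫⁻ x in {x | levelCut (H * 2 ^ (i + 1)) (H * 2 ^ (i + 1 + 1)) (f x) ≠ 0},
        infWeight o V n₀ x ∂μ ≤
      4 * ∫⁻ x, infWeight o V n₀ x *
        ENNReal.ofReal (levelCut (H * 2 ^ i) (H * 2 ^ (i + 1)) (f x) ^ 2) ∂μ := by
    intro i
    have hg : Measurable fun x => levelCut (H * 2 ^ i) (H * 2 ^ (i + 1)) (f x) :=
      (measurable_levelCut _ _).comp hf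
    rw [← lintegral_indicator (hS (i + 1)), ← lintegral_const_mul _ (hw.indicator (hS (i + 1))),
      ← lintegral_const_mul _ (by fun_prop)]
    refine lintegral_mono fun x => ?_
    by_cases hx : levelCut (H * 2 ^ (i + 1)) (H * 2 ^ (i + 1 + 1)) (f x) = 0
    · simp [hx]
    · rw [Set.indicator_of_mem (show x ∈ {x | levelCut (H * 2 ^ (i + 1)) (H * 2 ^ (i + 1 + 1)) (f x)
        ≠ 0} from hx), levelCut_of_ge (hmono i.le_succ) (hgt _ _ hx).le]
      have e : (H * 2 ^ (i + 1)) ^ 2 = 4 * (H * 2 ^ (i + 1) - H * 2 ^ i) ^ 2 := by ring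
      have e4 : ENNReal.ofReal 4 = 4 := by simp
      rw [e, ENNReal.ofReal_mul (by norm_num), e4]
      exact le_of_eq (by ring)
  cases l with
  | zero => simp
  | succ l =>
    have key : ∀ l : ℕ, ∑ i ∈ Finset.Ico j (j + l + 1), ENNReal.ofReal ((H * 2 ^ i) ^ 2) *
        ∫⁻ x in {x | levelCut (H * 2 ^ i) (H * 2 ^ (i + 1)) (f x) ≠ 0}, infWeight o V n₀ x ∂μ ≤
      ENNReal.ofReal (H * 2 ^ j) * ∫⁻ x, ENNReal.ofReal |f x| ∂(perturbed μ V)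
      + 4 * ∑ i ∈ Finset.Ico j (j + l), ∫⁻ x, infWeight o V n₀ x *
        ENNReal.ofReal (levelCut (H * 2 ^ i) (H * 2 ^ (i + 1)) (f x) ^ 2) ∂μ := by
      intro l
      induction l with
      | zero => simpa using hfirst
      | succ l ih =>
        refine (Finset.sum_Ico_succ_top (show j ≤ j + (l + 1) by omega) _).le.trans
          ((add_le_add ih (hnext (j + l))).trans (le_of_eq ?_))
        rw [← add_assoc j l 1, Finset.sum_Ico_succ_top (show j ≤ j + l by omega), mul_add,
          ← add_assoc]
    rw [← add_assoc]
    exact (key l).trans (add_le_add le_rfl (mul_le_mul' le_rfl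
      (Finset.sum_le_sum_of_subset (Finset.Ico_subset_Ico_right (by omega)))))

/-- The bound for the sum of the truncations at geometric levels. -/
theorem sum_lintegral_levelCut_le [IsFiniteMeasure μ] (hq : Measurable (Function.uncurry q))
    (hq0 : ∀ x y, 0 ≤ q x y) (hqb : jumpBound μ q < ⊤) (hVm : Measurable V)
    (hV : ∀ R : ℝ, ∃ C : ℝ, ∀ x, dist o x ≤ R → |V x| ≤ C)
    [IsFiniteMeasure (perturbed μ V)]
    (h_sp : SuperPoincare μ q μ fun r => ENNReal.ofReal (β r)) {f : E → ℝ} (hf : f ∈ core μ q)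
    {n k n₀ : ℕ} (hk : 1 ≤ k) (hn : n ≤ n₀) {C : ℝ≥0∞} (hC : epsval μ β o V n k ≤ C) (hC' : C ≠ ⊤)
    {L : ℝ} (hL : infBall o V n₀ + L ≤ supBall o V n₀)
    (hCL : 40 * C * jumpBound μ q * ENNReal.ofReal (Real.exp (-L)) ≤ 2⁻¹) {H : ℝ} (hH : 0 < H)
    {j : ℕ} (l : ℕ) (hp : ∀ i, j ≤ i →
      μ {x | levelCut (H * 2 ^ i) (H * 2 ^ (i + 1)) (f x) * ring n₀ n₀ (dist o x) ≠ 0} ≤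
        μ {x | (n₀ : ℝ) - 1 < dist o x}) :
    ∑ i ∈ Finset.Ico j (j + l),
        ∫⁻ x, ENNReal.ofReal (levelCut (H * 2 ^ i) (H * 2 ^ (i + 1)) (f x) ^ 2) ∂(perturbed μ V) ≤
      16 * C * energy μ q (perturbed μ V) f + 12 * C * jumpBound μ q *
        (ENNReal.ofReal (H * 2 ^ j) * ∫⁻ x, ENNReal.ofReal |f x| ∂(perturbed μ V)) := by
  have hfm := hf.1
  obtain ⟨B, hB⟩ := hf.2.1
  have hd : Measurable fun x : E => dist o x := measurable_dist_right
  have hmono := monotone_geometric hH.le (by norm_num : (1 : ℝ) < 2)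
  set ν := perturbed μ V
  set g : ℕ → E → ℝ := fun i x => levelCut (H * 2 ^ i) (H * 2 ^ (i + 1)) (f x) with hg
  set s := Finset.Ico j (j + l) with hs
  set m := ∫⁻ x, ENNReal.ofReal |f x| ∂ν
  set lam := jumpBound μ q
  have hgcore : ∀ i, g i ∈ core μ q := fun i => levelCut_mem_core hq0 hf (hmono i.le_succ)
  set tail : ℕ → ℝ≥0∞ := fun M =>
    ∑ i ∈ s, ∫⁻ x in {x | (M : ℝ) ≤ dist o x}, ENNReal.ofReal (g i x ^ 2) ∂ν with htail
  have htail0 : Tendsto tail atTop (𝓝 0) := by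
    have h1 : Tendsto (fun M : ℕ => ∑ i ∈ s, ENNReal.ofReal (B ^ 2) *
        ν {x | (M : ℝ) ≤ dist o x}) atTop (𝓝 0) := by
      have h2 : Tendsto (fun M : ℕ => ENNReal.ofReal (B ^ 2) * ν {x | (M : ℝ) ≤ dist o x}) atTop
          (𝓝 0) := by
        simpa using ENNReal.Tendsto.const_mul (a := ENNReal.ofReal (B ^ 2))
          (tendsto_measure_ball_compl ν o) (Or.inr ENNReal.ofReal_ne_top)
      simpa using tendsto_finsetSum s fun i _ => h2
    refine tendsto_of_tendsto_of_tendsto_of_le_of_le tendsto_const_nhds h1 (fun _ => zero_le)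
      fun M => Finset.sum_le_sum fun i _ => ?_
    rw [← setLIntegral_const]
    refine lintegral_mono fun x => ofReal_sq_le_of_abs_le ?_
    rw [abs_of_nonneg (levelCut_nonneg (hmono i.le_succ) _)]
    exact (levelCut_le_abs (by positivity)).trans (hB x)
  -- The radius M makes W finite, which absorption requires; the tails beyond M vanish in the limit.
  -- The gradient and support terms give 16Cλ Q + 6Cλ · 4Q = 40Cλ Q, matching `hCL`.
  have hbound : ∀ M, n₀ < M → ∑ i ∈ s, ∫⁻ x, ENNReal.ofReal (g i x ^ 2) ∂ν ≤
      16 * C * energy μ q ν f + 12 * C * lam * (ENNReal.ofReal (H * 2 ^ j) * m)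
        + (80 * C * lam + 1) * tail M := by
    intro M hM
    set W := ∑ i ∈ s, ringSum μ o V n₀ M (g i) with hW
    set Q := ∑ i ∈ s, ∫⁻ x, infWeight o V n₀ x * ENNReal.ofReal (g i x ^ 2) ∂μ with hQ
    have hWtop : W ≠ ⊤ :=
      (ENNReal.sum_lt_top.2 fun i _ => ringSum_lt_top hq hq0 hqb (hgcore i) n₀ M).ne
    have hQW : Q ≤ ENNReal.ofReal (Real.exp (-L)) * W + tail M := by
      rw [hQ, hW, Finset.mul_sum, htail, ← Finset.sum_add_distrib]
      exact Finset.sum_le_sum fun i _ =>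
        lintegral_infWeight_mul_sq_le hVm hV (hgcore i).1 hM hL
    have hF := sum_level_weight_le (μ := μ) hVm hV hfm hH n₀ j l
    have hWQ : W ≤ 8 * C * energy μ q ν f + 16 * C * lam * Q
        + 6 * C * lam * (ENNReal.ofReal (H * 2 ^ j) * m + 4 * Q) := by
      have h1 : ∀ i ∈ s, ringSum μ o V n₀ M (g i) ≤ _ := fun i hi =>
        ringSum_le hq hq0 hqb hVm hV h_sp (hgcore i) (b := H * 2 ^ i) (fun x => by
          rw [abs_of_nonneg (levelCut_nonneg (hmono i.le_succ) _)]
          refine (levelCut_le _ _ _).trans (le_of_eq ?_)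
          rw [Nat.succ_eq_add_one]
          ring) hk hn hM.le hC hC' (hp i (Finset.mem_Ico.1 hi).1)
      refine (Finset.sum_le_sum h1).trans ?_
      rw [Finset.sum_add_distrib, Finset.sum_add_distrib, ← Finset.mul_sum, ← Finset.mul_sum,
        ← Finset.mul_sum]
      refine add_le_add (add_le_add ?_ le_rfl) (mul_le_mul' le_rfl hF)
      exact mul_le_mul' le_rfl (sum_energy_levelCut_le hq0 ν hmono (Nat.le_add_right j l) f)
    have hW2 : W ≤ 2 * (8 * C * energy μ q ν f + 6 * C * lam * (ENNReal.ofReal (H * 2 ^ j) * m)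
        + 40 * C * lam * tail M) := by
      refine le_two_mul_of_le_add_half hWtop (hWQ.trans ?_)
      calc _ = 8 * C * energy μ q ν f + 6 * C * lam * (ENNReal.ofReal (H * 2 ^ j) * m)
            + 40 * C * lam * Q := by ring
        _ ≤ 8 * C * energy μ q ν f + 6 * C * lam * (ENNReal.ofReal (H * 2 ^ j) * m)
            + 40 * C * lam * (ENNReal.ofReal (Real.exp (-L)) * W + tail M) := by gcongr
        _ = 8 * C * energy μ q ν f + 6 * C * lam * (ENNReal.ofReal (H * 2 ^ j) * m)
            + 40 * C * lam * tail M + 40 * C * lam * ENNReal.ofReal (Real.exp (-L)) * W := by ring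
        _ ≤ _ := by gcongr
    have hsplit : ∑ i ∈ s, ∫⁻ x, ENNReal.ofReal (g i x ^ 2) ∂ν ≤ W + tail M := by
      rw [hW, htail, ← Finset.sum_add_distrib]
      refine Finset.sum_le_sum fun i _ => ?_
      have hA : MeasurableSet {x : E | dist o x < M} := measurableSet_lt hd measurable_const
      rw [← lintegral_add_compl _ hA]
      refine add_le_add ?_ (lintegral_mono_set fun x hx => not_lt.1 (show ¬ dist o x < M from hx))
      exact setLIntegral_le_sum_ring hVm hV (hgcore i).1 hA fun x hx => by
        obtain ⟨m, h1, -, h2⟩ := exists_ring_eq_one hM hx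
        exact ⟨m, h1, h2⟩
    refine hsplit.trans ((add_le_add hW2 le_rfl).trans (le_of_eq ?_))
    ring
  have hlim : Tendsto (fun M => 16 * C * energy μ q ν f
      + 12 * C * lam * (ENNReal.ofReal (H * 2 ^ j) * m) + (80 * C * lam + 1) * tail M) atTop
      (𝓝 (16 * C * energy μ q ν f + 12 * C * lam * (ENNReal.ofReal (H * 2 ^ j) * m)
        + (80 * C * lam + 1) * 0)) :=
    tendsto_const_nhds.add (ENNReal.Tendsto.const_mul htail0 (Or.inr (by finiteness)))
  rw [mul_zero, add_zero] at hlim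
  exact ge_of_tendsto hlim ((eventually_gt_atTop n₀).mono hbound)

theorem defectivePoincare_of_ae_bounded {E : Type*} [MeasurableSpace E] {μ : Measure E}
    {q : E → E → ℝ} {V : E → ℝ} {β : ℝ → ℝ} [IsFiniteMeasure μ]
    (hq : Measurable (Function.uncurry q))
    (hq0 : ∀ x y, 0 ≤ q x y) (hVm : Measurable V) [IsProbabilityMeasure (perturbed μ V)]
    (hβ : 0 < β 1) (h_sp : SuperPoincare μ q μ fun r => ENNReal.ofReal (β r)) {c : ℝ}
    (hc : ∀ᵐ x ∂μ, |V x| ≤ c) : DefectivePoincare μ q (perturbed μ V) := by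
  have hle : ∀ F : E → ℝ≥0∞, Measurable F →
      ∫⁻ x, F x ∂μ ≤ ENNReal.ofReal (Real.exp c) * ∫⁻ x, F x ∂(perturbed μ V) := fun F hF => by
    rw [lintegral_perturbed hVm hF, ← lintegral_const_mul _ (by fun_prop)]
    refine lintegral_mono_ae ?_
    filter_upwards [hc] with x hx
    rw [← mul_assoc, ← ENNReal.ofReal_mul (Real.exp_pos _).le, ← Real.exp_add]
    refine le_mul_of_one_le_left zero_le ?_
    rw [ENNReal.one_le_ofReal]
    exact Real.one_le_exp (by linarith [(abs_le.1 hx).1])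
  refine ⟨Real.exp c * Real.exp c, Real.exp c * (β 1 * Real.exp c ^ 2), by positivity,
    by positivity, fun f hfV => ?_⟩
  refine poincareBound_of_core (absolutelyContinuous_perturbed hVm) hq hq0 ENNReal.ofReal_ne_top
    ENNReal.ofReal_ne_top (fun f hf => ?_) hfV
  have hfm : Measurable f := hf.1
  have hfa : Measurable fun x => ENNReal.ofReal |f x| := by fun_prop
  have h1 := h_sp 1 one_pos f (mem_formDomain_of_mem_core hf)
  unfold PoincareBound at h1 ⊢
  have h2 : ∫⁻ x, ENNReal.ofReal (f x ^ 2) ∂(perturbed μ V) ≤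
      ENNReal.ofReal (Real.exp c) * ∫⁻ x, ENNReal.ofReal (f x ^ 2) ∂μ := by
    have hf2 : Measurable fun x => ENNReal.ofReal (f x ^ 2) := by fun_prop
    rw [lintegral_perturbed hVm hf2, ← lintegral_const_mul _ hf2]
    refine lintegral_mono_ae ?_
    filter_upwards [hc] with x hx
    gcongr
    exact (abs_le.1 hx).2
  rw [ENNReal.ofReal_one, one_mul] at h1
  calc _ ≤ ENNReal.ofReal (Real.exp c) * (ENNReal.ofReal (Real.exp c) *
        energy μ q (perturbed μ V) f + ENNReal.ofReal (β 1) *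
        (ENNReal.ofReal (Real.exp c) * ∫⁻ x, ENNReal.ofReal |f x| ∂(perturbed μ V)) ^ 2) := by
        refine h2.trans (mul_le_mul' le_rfl (h1.trans (add_le_add ?_ ?_)))
        · exact hle _ (measurable_carre hq hfm)
        · exact mul_le_mul' le_rfl (pow_le_pow_left' (hle _ hfa) 2)
    _ = _ := by
        rw [ENNReal.ofReal_mul (Real.exp_pos _).le, ENNReal.ofReal_mul (Real.exp_pos _).le,
          ENNReal.ofReal_mul hβ.le, ENNReal.ofReal_pow (Real.exp_pos _).le]
        ring

/-- Chebyshev bounds the μ_V-measure of a level set; on a ball e^V is bounded below, so the bound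
transfers to μ. -/
theorem measure_level_ball_le
    (hV : ∀ R : ℝ, ∃ C : ℝ, ∀ x, dist o x ≤ R → |V x| ≤ C) {f : E → ℝ} (hf : Measurable f)
    {M : ℝ} (hM : 0 < M)
    (hX : ∫⁻ x, ENNReal.ofReal (f x ^ 2) ∂(perturbed μ V) = ENNReal.ofReal M) {R : ℝ} {j i : ℕ}
    (hji : j ≤ i) {A : Set E} (hA : ∀ x ∈ A, dist o x ≤ R ∧ Real.sqrt M * 2 ^ i < |f x|) :
    ENNReal.ofReal (4 ^ j * Real.exp (infBall o V R)) * μ A ≤ 1 := by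
  set S := {x : E | dist o x ≤ R ∧ Real.sqrt M * 2 ^ i < |f x|}
  have hS : MeasurableSet S := (measurableSet_le measurable_dist_right measurable_const).inter
    (measurableSet_lt measurable_const (f := fun _ => Real.sqrt M * 2 ^ i) (g := fun x => |f x|)
      (by fun_prop))
  have h1 := measure_level_le hf hM hX (by norm_num : (0 : ℝ) ≤ 2) i
  have h2 : ENNReal.ofReal (Real.exp (infBall o V R)) * μ S ≤ perturbed μ V S := by
    rw [perturbed, withDensity_apply _ hS, ← setLIntegral_const]
    refine setLIntegral_mono' hS fun x hx => ?_
    gcongr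
    exact infBall_le hV hx.1
  refine le_trans ?_ h1
  rw [ENNReal.ofReal_mul (by positivity), mul_assoc]
  refine mul_le_mul' (ENNReal.ofReal_le_ofReal ?_) ?_
  · norm_num
    exact pow_le_pow_right₀ (by norm_num) hji
  · exact (mul_le_mul' le_rfl (measure_mono hA)).trans (h2.trans (measure_mono fun x hx => hx.2))

/-- If the oscillation stayed below L on all large balls, V would differ from V(o) by at most |L|
everywhere. -/
theorem exists_ball_oscillation {E : Type*} [MetricSpace E] {o : E} {V : E → ℝ}
    (hV : ∀ R : ℝ, ∃ C : ℝ, ∀ x, dist o x ≤ R → |V x| ≤ C)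
    (h : ∀ c : ℝ, ∃ x, c < |V x|) (n : ℕ) (L : ℝ) :
    ∃ n₀, n ≤ n₀ ∧ infBall o V n₀ + L ≤ supBall o V n₀ := by
  by_contra! hcon
  obtain ⟨x, hx⟩ := h (|V o| + |L|)
  obtain ⟨a, ha⟩ := exists_nat_gt (dist o x)
  have h1 := hcon (max a n) (le_max_right _ _)
  have hR : dist o x ≤ (max a n : ℕ) := ha.le.trans (by exact_mod_cast le_max_left a n)
  have ho : dist o o ≤ (max a n : ℕ) := by simp
  have h2 := infBall_le hV hR
  have h3 := le_supBall hV hR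
  have h4 := infBall_le hV ho
  have h5 := le_supBall hV ho
  have h6 : |V x - V o| ≤ |L| :=
    (abs_le.2 ⟨by linarith, by linarith⟩ : |V x - V o| ≤ L).trans (le_abs_self L)
  have h7 := abs_sub_abs_le_abs_sub (V x) (V o)
  linarith

theorem defectivePoincare_perturbed [IsFiniteMeasure μ] (hq : Measurable (Function.uncurry q))
    (hq0 : ∀ x y, 0 ≤ q x y) (hqb : jumpBound μ q < ⊤) (hVm : Measurable V)
    (hV : ∀ R : ℝ, ∃ C : ℝ, ∀ x, dist o x ≤ R → |V x| ≤ C)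
    [IsProbabilityMeasure (perturbed μ V)] (hβ : 0 < β 1)
    (h_sp : SuperPoincare μ q μ fun r => ENNReal.ofReal (β r)) {n k : ℕ} (hk : 1 ≤ k)
    (hε : epsval μ β o V n k ≠ ⊤) : DefectivePoincare μ q (perturbed μ V) := by
  by_cases hbdd : ∃ c : ℝ, ∀ᵐ x ∂μ, |V x| ≤ c
  · obtain ⟨c, hc⟩ := hbdd
    exact defectivePoincare_of_ae_bounded hq hq0 hVm hβ h_sp hc
  have hunb : ∀ c : ℝ, ∃ x, c < |V x| := fun c => by
    by_contra! h
    exact hbdd ⟨c, Eventually.of_forall h⟩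
  set C := epsval μ β o V n k with hC
  set lam := jumpBound μ q with hlam
  obtain ⟨L, hL⟩ : ∃ L : ℝ, 40 * C * lam * ENNReal.ofReal (Real.exp (-L)) ≤ 2⁻¹ := by
    have h1 : Tendsto (fun L : ℝ => 40 * C * lam * ENNReal.ofReal (Real.exp (-L))) atTop (𝓝 0) := by
      have h2 := ENNReal.tendsto_ofReal
        (Real.tendsto_exp_atBot.comp tendsto_neg_atTop_atBot)
      rw [ENNReal.ofReal_zero] at h2
      simpa using ENNReal.Tendsto.const_mul (a := 40 * C * lam) h2 (Or.inr (by finiteness))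
    exact (((tendsto_order.1 h1).2 2⁻¹ (by simp)).exists).imp fun _ h => h.le
  obtain ⟨n₀, hn₀, hosc⟩ := exists_ball_oscillation hV hunb n L
  -- Otherwise μ would live on a ball, where V is bounded, contrary to the case assumption.
  have hT : μ {x | (n₀ : ℝ) - 1 < dist o x} ≠ 0 := by
    intro h
    obtain ⟨c, hc⟩ := hV ((n₀ : ℝ) - 1)
    refine hbdd ⟨c, measure_mono_null (fun x hx => ?_) h⟩
    by_contra hx'
    exact hx (hc x (not_lt.1 hx'))
  -- This j depends on n₀ but not on f: from this level on, Chebyshev makes the support of each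
  -- slice in the innermost cutoff small enough for the ring estimate.
  obtain ⟨j, hj⟩ : ∃ j : ℕ, 1 ≤ ENNReal.ofReal (4 ^ j * Real.exp (infBall o V (n₀ + 2))) *
      μ {x | (n₀ : ℝ) - 1 < dist o x} := by
    have hT' : 0 < (μ {x | (n₀ : ℝ) - 1 < dist o x}).toReal :=
      ENNReal.toReal_pos hT (measure_ne_top _ _)
    obtain ⟨j, -, hj⟩ := exists_level_bound (H := Real.exp (infBall o V (n₀ + 2)) *
      (μ {x | (n₀ : ℝ) - 1 < dist o x}).toReal) (by positivity) (by norm_num : (1 : ℝ) < 4) 1 0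
    refine ⟨j, ?_⟩
    rw [← ENNReal.ofReal_toReal (measure_ne_top μ {x | (n₀ : ℝ) - 1 < dist o x}),
      ← ENNReal.ofReal_mul (by positivity), ENNReal.one_le_ofReal]
    exact hj.trans_eq (by ring)
  obtain ⟨C', hC0, hCe⟩ : ∃ C' : ℝ, 0 ≤ C' ∧ C = ENNReal.ofReal C' :=
    ⟨_, ENNReal.toReal_nonneg, (ENNReal.ofReal_toReal hε).symm⟩
  obtain ⟨l', hl0, hle⟩ : ∃ l' : ℝ, 0 ≤ l' ∧ lam = ENNReal.ofReal l' :=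
    ⟨_, ENNReal.toReal_nonneg, (ENNReal.ofReal_toReal hqb.ne).symm⟩
  -- The slicing constant 10s/(s-1) is 20 for s = 2; it turns 12Cλ into 240Cλ and 16C into 320C.
  -- Absorbing half of M doubles the latter to 640C.
  set κ : ℝ := 5 / 4 + 240 * C' * l' with hκ
  have hκ0 : 0 < κ := by positivity
  refine ⟨640 * C' + 1, κ ^ 2 * 4 ^ j, by positivity, by positivity, fun f hfV => ?_⟩
  refine poincareBound_of_core (absolutelyContinuous_perturbed hVm) hq hq0 ENNReal.ofReal_ne_top
    ENNReal.ofReal_ne_top (fun f hf => ?_) hfV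
  have hfm := hf.1
  obtain ⟨B, hB⟩ := hf.2.1
  set ν := perturbed μ V
  have hXtop := lintegral_sq_lt_top (ν := ν) hf
  have hEtop := energy_lt_top (ν := ν) hf
  have hmtop : ∫⁻ x, ENNReal.ofReal |f x| ∂ν < ⊤ := by
    refine (lintegral_mono fun x => ENNReal.ofReal_le_ofReal (hB x)).trans_lt ?_
    rw [lintegral_const]
    finiteness
  unfold PoincareBound
  obtain ⟨M, hM0, hXM⟩ : ∃ M : ℝ, 0 ≤ M ∧ ∫⁻ x, ENNReal.ofReal (f x ^ 2) ∂ν = ENNReal.ofReal M :=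
    ⟨_, ENNReal.toReal_nonneg, (ENNReal.ofReal_toReal hXtop.ne).symm⟩
  obtain ⟨e, he0, hEe⟩ : ∃ e : ℝ, 0 ≤ e ∧ energy μ q ν f = ENNReal.ofReal e :=
    ⟨_, ENNReal.toReal_nonneg, (ENNReal.ofReal_toReal hEtop.ne).symm⟩
  obtain ⟨m, hm0, hmm⟩ : ∃ m : ℝ, 0 ≤ m ∧ ∫⁻ x, ENNReal.ofReal |f x| ∂ν = ENNReal.ofReal m :=
    ⟨_, ENNReal.toReal_nonneg, (ENNReal.ofReal_toReal hmtop.ne).symm⟩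
  rcases hM0.eq_or_lt with hM | hM
  · rw [hXM, ← hM, ENNReal.ofReal_zero]
    exact zero_le
  set H := Real.sqrt M with hH
  have hHpos : 0 < H := Real.sqrt_pos.2 hM
  have hHM : H ^ 2 = M := Real.sq_sqrt hM.le
  obtain ⟨N, hjN, hBN⟩ := exists_level_bound hHpos (by norm_num : (1 : ℝ) < 2) B j
  obtain ⟨l, rfl⟩ := Nat.exists_eq_add_of_le hjN
  have hmono := monotone_geometric hHpos.le (by norm_num : (1 : ℝ) < 2)
  have hsum := sum_lintegral_levelCut_le hq hq0 hqb hVm hV h_sp hf hk hn₀ hC.ge hε hosc hL hHpos l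
    (j := j) fun i hji => by
      have h1 := measure_level_ball_le hV hfm hM hXM (R := n₀ + 2) hji
        (A := {x | levelCut (H * 2 ^ i) (H * 2 ^ (i + 1)) (f x) * ring n₀ n₀ (dist o x) ≠ 0})
        fun x hx => by
          constructor
          · by_contra h
            exact hx (by rw [ring_eq_zero_of_ge (not_le.1 h).le, mul_zero])
          · by_contra h
            exact hx (by rw [levelCut_of_le (hmono i.le_succ) (not_lt.1 h), zero_mul])
      have h2 : ENNReal.ofReal (4 ^ j * Real.exp (infBall o V (n₀ + 2))) ≠ 0 := by
        rw [Ne, ENNReal.ofReal_eq_zero, not_le]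
        positivity
      exact (ENNReal.mul_le_mul_iff_right h2 ENNReal.ofReal_ne_top).1 (h1.trans hj)
  have hfin := lintegral_sq_le_sum_levelCut (ν := ν) hfm hHpos.le (by norm_num : (1 : ℝ) < 2) hjN
    fun x => (hB x).trans hBN
  replace hfin := hfin.trans (add_le_add le_rfl (mul_le_mul' le_rfl hsum))
  rw [hXM, hmm, hEe, ← ENNReal.ofReal_pow hm0, ← ENNReal.ofReal_mul (by positivity),
    ← ENNReal.ofReal_mul (by positivity), ← ENNReal.ofReal_add (by positivity) (by positivity)]
  rw [hXM, hmm, hEe, ← hlam, hCe, hle, ← ENNReal.ofReal_ofNat 16, ← ENNReal.ofReal_ofNat 12,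
    ← ENNReal.ofReal_mul (by positivity), ← ENNReal.ofReal_mul (by positivity),
    ← ENNReal.ofReal_mul (by positivity), ← ENNReal.ofReal_mul (by positivity),
    ← ENNReal.ofReal_mul (by positivity), ← ENNReal.ofReal_mul (by positivity),
    ← ENNReal.ofReal_mul (by positivity),
    ← ENNReal.ofReal_add (by positivity) (by positivity),
    ← ENNReal.ofReal_mul (by norm_num), ← ENNReal.ofReal_add (by positivity) (by positivity),
    ENNReal.ofReal_le_ofReal_iff (by positivity)] at hfin
  refine ENNReal.ofReal_le_ofReal ?_
  have h3 : M ≤ κ * (H * 2 ^ j * m) + 320 * C' * e := by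
    refine hfin.trans (le_of_eq ?_)
    rw [hκ]
    ring
  have h4 : κ * (H * 2 ^ j * m) ≤ M / 2 + κ ^ 2 * 4 ^ j * m ^ 2 / 2 := by
    have e1 : (4 : ℝ) ^ j = (2 ^ j) ^ 2 := by rw [← pow_mul, mul_comm, pow_mul]; norm_num
    rw [e1, ← hHM]
    nlinarith [sq_nonneg (H - κ * 2 ^ j * m)]
  nlinarith

end Defective

end LevyForm

theorem mainTheorem2 {E : Type*} [MetricSpace E] [PolishSpace E] [MeasurableSpace E] [BorelSpace E]
    (μ : Measure E) [IsProbabilityMeasure μ]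
    (q : E → E → ℝ) (hq_meas : Measurable (Function.uncurry q))
    (hq_nonneg : ∀ x y, 0 ≤ q x y) (hq_diag : ∀ x, q x x = 0)
    (hq_bound : LevyForm.jumpBound μ q < ⊤)
    (h_dense : ∀ f : E → ℝ, MemLp f 2 μ → ∀ ε : ℝ≥0∞, 0 < ε →
      ∃ u ∈ LevyForm.core μ q, eLpNorm (f - u) 2 μ < ε)
    (o : E) (V : E → ℝ) (hV_meas : Measurable V)
    (hV_bdd : ∀ R : ℝ, ∃ C : ℝ, ∀ x, dist o x ≤ R → |V x| ≤ C)
    (hV_norm : ∫⁻ x, ENNReal.ofReal (Real.exp (V x)) ∂μ = 1)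
    (β : ℝ → ℝ) (hβ_pos : ∀ r, 0 < r → 0 < β r) (hβ_anti : AntitoneOn β (Set.Ioi 0))
    (h_sp : LevyForm.SuperPoincare μ q μ fun r => ENNReal.ofReal (β r)) :
    (∀ δ : ℝ, 1 < δ → (∃ n k : ℕ → ℕ, LevyForm.MemI μ q β o V δ n k) →
      (∀ r : ℝ, 0 < r → LevyForm.betaV μ q β o V δ r < ⊤) ∧
      LevyForm.SuperPoincare μ q (LevyForm.perturbed μ V) (LevyForm.betaV μ q β o V δ)) ∧
    (∀ δ : ℝ, 1 < δ →
      (∃ n k : ℕ → ℕ, LevyForm.IsIndexSeq n k ∧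
        LevyForm.CondA1' μ β o V δ n k ∧ LevyForm.CondA2 μ q β o V δ n k) →
      LevyForm.DefectivePoincare μ q (LevyForm.perturbed μ V)) := by
  have := LevyForm.isProbabilityMeasure_perturbed hV_norm
  refine ⟨fun δ hδ h => ⟨fun r hr => ?_, ?_⟩, fun δ _ h => ?_⟩
  · obtain ⟨n, k, hI⟩ := h
    exact LevyForm.betaV_lt_top hδ hq_bound hI hr
  · exact LevyForm.superPoincare_perturbed hq_meas hq_nonneg hq_bound hV_meas hV_bdd h_sp hδ h
  · obtain ⟨n, k, hnk, hA, -⟩ := h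
    -- A finite limsup yields an index at which ε is finite; i ≥ 1 ensures k_i ≥ 1.
    obtain ⟨i, hi, hi1⟩ :=
      ((eventually_lt_of_limsup_lt hA).and (eventually_ge_atTop 1)).exists
    exact LevyForm.defectivePoincare_perturbed hq_meas hq_nonneg hq_bound hV_meas hV_bdd
      (hβ_pos 1 one_pos) h_sp (hnk.pos i hi1).2 (ENNReal.add_ne_top.1 hi.ne).1
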